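/- All theories are first-order theories with equality in a finite relational signature. A many-sorted theory is identified with the one-sorted theory that has, in addition, a unary predicate for every sort, reads quantifiers over a sort as relativized quantifiers, and has axioms saying that the sorts cover the domain, are pairwise disjoint and nonempty, and that each predicate holds only of arguments of its prescribed sorts. *Interpretations.* $T$ interprets $U$ $m$-dimensionally ($T\rhd_m U$, $m\ge 1$) if there are formulas of the language of $T$ that define, uniformly in parameters from a range that $T$ proves nonempty, a nonempty domain of $m$-tuples, an equality on it, and each predicate of $U$, such that $T$ proves, for all parameters in that range, the translations of the axioms of $U$ and of the axioms of equality. $T$ interprets $U$ if $T\rhd_m U$ for some $m\ge 1$. *Adjunctive classes.* $\mathsf{AC}(T)$ is the two-sorted theory with a sort of objects $x,y$ and a sort of classes $X,Y$, with the predicates of $T$ on the objects and the predicate $x\in X$, and with the axioms of $T$ relativized to the objects and $$\exists X\,\forall x\;\lnot\,x\in X,\qquad \forall X\,\forall x\,\exists Y\,\forall y\,\big(y\in Y\leftrightarrow(y\in X\lor y=x)\big).$$ *Adjunctive sets.* $\mathsf{AS}(T)$ is the extension of $T$ by a fresh binary predicate $\in$ and the axioms $$\exists x\,\forall y\;\lnot\,y\in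 x,\qquad \forall x\,\forall y\,\exists z\,\forall w\,\big(w\in z\leftrightarrow(w\in x\lor w=y)\big).$$ *Forcing-interpretations.* $\mathsf{KM}(U)$ (Kripke models of $U$) is the two-sorted theory with a sort of worlds $p,q,r$ and a sort of elements $x,y$, with predicates $p\preceq q$, $D(p,x)$, and $R^\star(p,x_1,\dots,x_k)$ for each $k$-ary predicate $R$ of $U$, equality included. Define $p\Vdash\varphi$ by: $p\Vdash R(\vec x)$ is $(\forall q\preceq p)(\exists r\preceq q)\,R^\star(r,\vec x)$; $\Vdash$ commutes with $\land$; $p\Vdash\lnot\varphi$ is $(\forall q\preceq p)\,\lnot\,(q\Vdash\varphi)$; $p\Vdash\forall y\,\varphi$ is $(\forall q\preceq p)\,\forall y\,(D(q,y)\to q\Vdash\varphi)$; the other connectives are expressed by $\land,\lnot,\forall$ (in particular $\varphi\to\psi$ is $\lnot(\varphi\land\lnot\psi)$, and falsum is never forced). The axioms of $\mathsf{KM}(U)$ say that $\preceq$ is reflexive and transitive; that every $D_p=\{x: D(p,x)\}$ is nonempty; that $D_p\subseteq D_q$ whenever $q\preceq p$; that $R^\star(p,\vec x)$ implies that all $x_i$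 are in $D_p$; that $R^\star(p,\vec x)$ and $q\preceq p$ imply $R^\star(q,\vec x)$; and that $p\Vdash\varphi$ for every world $p$ and every axiom $\varphi$ of $U$ (axioms of equality included). $T$ *forcing-interprets* $U$ if $T$ interprets $\mathsf{KM}(U)$. **Statement.** Let $T$ be a finitely axiomatizable theory. If $T\rhd_1\mathsf{AC}(T)$, i.e. $T$ one-dimensionally interprets $\mathsf{AC}(T)$, then $T$ forcing-interprets $\mathsf{AS}(T)$. -/

import Mathlib

open FirstOrder

universe u v u' v'

namespace ForcingInterp

open FirstOrder.Language

/-! Theories are Mathlib's first-order theories with equality, over relational languages;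
`T ⊨ᵇ φ` (truth in all nonempty models under all assignments) is provability from `T`. -/

/-- `T` is finitely axiomatizable: some finite set of sentences of the same language is
deductively equivalent to `T`. -/
def FinitelyAxiomatizable {L : FirstOrder.Language.{u, v}} (T : L.Theory) : Prop :=
  ∃ F : Set L.Sentence, F.Finite ∧ (∀ φ ∈ F, T ⊨ᵇ φ) ∧ ∀ φ ∈ T, Theory.ModelsBoundedFormula F φ

/-- In a relational language every term is a variable. -/
def termVar {L : FirstOrder.Language.{u, v}} [L.IsRelational] {β : Type*} : L.Term β → β
  | .var b => b
  | .func f _ => isEmptyElim f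

/-- The assignment `e`, extended by the value `y` for one more bound variable. -/
def extend {α W : Type*} {n : ℕ} (e : α ⊕ Fin n → W) (y : W) : α ⊕ Fin (n + 1) → W :=
  Sum.elim (e ∘ Sum.inl) (Fin.snoc (e ∘ Sum.inr) y)

section Equality

variable (L : FirstOrder.Language.{u, v})

/-- `∀ x, x = x`. -/
def eqRefl : L.Sentence := ∀' (&0 =' &0)

/-- `∀ x y, x = y → y = x`. -/
def eqSymm : L.Sentence := ∀' ∀' ((&0 =' &1) ⟹ (&1 =' &0))

/-- `∀ x y z, x = y → y = z → x = z`. -/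
def eqTrans : L.Sentence := ∀' ∀' ∀' ((&0 =' &1) ⟹ ((&1 =' &2) ⟹ (&0 =' &2)))

variable {L}

/-- `∀ x₀ … xₙ₋₁ y, xᵢ = y → R(x₀, …, xᵢ, …, xₙ₋₁) → R(x₀, …, y, …, xₙ₋₁)`. -/
def eqCongr {n : ℕ} (R : L.Relations n) (i : Fin n) : L.Sentence :=
  BoundedFormula.alls (n := n + 1)
    ((&(i.castSucc) =' &(Fin.last n)) ⟹
      (R.boundedFormula (fun j => &(j.castSucc)) ⟹
        R.boundedFormula (fun j => &(Function.update Fin.castSucc i (Fin.last n) j))))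

variable (L)

/-- The axioms of equality of the language `L`. -/
def eqAxioms : L.Theory :=
  {eqRefl L, eqSymm L, eqTrans L} ∪
    {φ | ∃ (n : ℕ) (R : L.Relations n) (i : Fin n), φ = eqCongr R i}

end Equality

section Interpretations

/-- An `m`-dimensional relative translation of the relational language `L` into `L'`, with `k`
parameters and with definable equality. The variables `(i, j)` stand for the `j`-th component of
the tuple that represents the `i`-th argument; variables `Sum.inr _` are the parameters. -/
structure Translation (L : FirstOrder.Language.{u, v}) (L' : FirstOrder.Language.{u', v'}) (m k : ℕ) where
  /-- the range of the parameters -/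
  param : L'.Formula (Fin k)
  /-- the domain -/
  dom : L'.Formula (Fin m ⊕ Fin k)
  /-- equality -/
  eq : L'.Formula ((Fin 2 × Fin m) ⊕ Fin k)
  /-- the predicates -/
  rel : ∀ {n : ℕ}, L.Relations n → L'.Formula ((Fin n × Fin m) ⊕ Fin k)

namespace Translation

variable {L : FirstOrder.Language.{u, v}} {L' : FirstOrder.Language.{u', v'}} {m k : ℕ}

/-- The translation of a formula: atoms are replaced by their defining formulas, and quantifiers
are replaced by blocks of `m` quantifiers relativized to the domain. `e` names the tuple of
variables that represents each variable, and `p` names the parameters. -/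
noncomputable def formula [L.IsRelational] (τ : Translation L L' m k) {α : Type} :
    ∀ {n : ℕ}, L.BoundedFormula α n →
      ∀ {V : Type}, (α ⊕ Fin n → Fin m → V) → (Fin k → V) → L'.Formula V
  | _, .falsum, _, _, _ => ⊥
  | _, .equal t₁ t₂, _, e, p =>
      τ.eq.relabel (Sum.elim (fun ij => e (![termVar t₁, termVar t₂] ij.1) ij.2) p)
  | _, .rel R ts, _, e, p =>
      (τ.rel R).relabel (Sum.elim (fun ij => e (termVar (ts ij.1)) ij.2) p)
  | _, .imp φ ψ, _, e, p => (τ.formula φ e p).imp (τ.formula ψ e p)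
  | _, .all φ, V, e, p =>
      Formula.iAlls (Fin m)
        ((τ.dom.relabel (Sum.elim Sum.inr (Sum.inl ∘ p)) : L'.Formula (V ⊕ Fin m)).imp
          (τ.formula φ (V := V ⊕ Fin m)
            (extend (fun a j => Sum.inl (e a j)) Sum.inr) (Sum.inl ∘ p)))

/-- The translation of a sentence; its free variables are the parameters. -/
noncomputable def sentence [L.IsRelational] (τ : Translation L L' m k) (φ : L.Sentence) :
    L'.Formula (Fin k) :=
  τ.formula φ (Sum.elim Empty.elim Fin.elim0) id

/-- `τ` is an interpretation of `U` in `T`: `T` proves that there are parameters in the range and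
that, for all parameters in it, the domain is nonempty and the translations of the axioms of `U`
and of the axioms of equality hold. -/
structure IsInterpretation [L.IsRelational] (τ : Translation L L' m k) (T : L'.Theory)
    (U : L.Theory) : Prop where
  exists_param : T ⊨ᵇ
    (Formula.iExs (α := Empty) (Fin k) (τ.param.relabel Sum.inr) : L'.Sentence)
  dom_nonempty : T ⊨ᵇ τ.param.imp
    (Formula.iExs (Fin m) (τ.dom.relabel Sum.swap : L'.Formula (Fin k ⊕ Fin m)))
  axioms_hold : ∀ φ ∈ U ∪ eqAxioms L, T ⊨ᵇ τ.param.imp (τ.sentence φ)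

end Translation

/-- `T` interprets `U` by an `m`-dimensional interpretation (with parameters). -/
def InterpretsDim {L : FirstOrder.Language.{u, v}} {L' : FirstOrder.Language.{u', v'}} [L.IsRelational] (m : ℕ)
    (T : L'.Theory) (U : L.Theory) : Prop :=
  ∃ (k : ℕ) (τ : Translation L L' m k), τ.IsInterpretation T U

/-- `T` interprets `U`, by an interpretation of some positive dimension. -/
def Interprets {L : FirstOrder.Language.{u, v}} {L' : FirstOrder.Language.{u', v'}} [L.IsRelational]
    (T : L'.Theory) (U : L.Theory) : Prop :=
  ∃ m : ℕ, 0 < m ∧ InterpretsDim m T U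

end Interpretations

section ManySorted

/-- A relational signature with the set of sorts `S`. -/
structure SortedSig (S : Type) where
  /-- the predicates of each arity -/
  Rel : ℕ → Type v
  /-- the sorts of the arguments of a predicate -/
  sort : ∀ {n : ℕ}, Rel n → Fin n → S

variable {S : Type}

/-- The predicates of the one-sorted signature attached to a many-sorted one: the given predicates
and a unary predicate for every sort. -/
inductive FlatRel (σ : SortedSig.{v} S) : ℕ → Type v
  | of {n : ℕ} (R : σ.Rel n) : FlatRel σ n
  | isSort (s : S) : FlatRel σ 1

/-- The one-sorted language attached to a many-sorted signature. -/
abbrev flat (σ : SortedSig.{v} S) : FirstOrder.Language.{0, v} := ⟨fun _ => Empty, FlatRel σ⟩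

instance (σ : SortedSig.{v} S) : (flat σ).IsRelational := fun _ => inferInstanceAs (IsEmpty Empty)

variable (σ : SortedSig.{v} S) {α : Type*} {n : ℕ}

/-- `x` is of sort `s`. -/
def inSort (s : S) (t : (flat σ).Term (α ⊕ Fin n)) : (flat σ).BoundedFormula α n :=
  Relations.boundedFormula (L := flat σ) (FlatRel.isSort s) ![t]

/-- `∀ xˢ, φ`, the quantifier over the sort `s`. -/
def allS (s : S) (φ : (flat σ).BoundedFormula α (n + 1)) : (flat σ).BoundedFormula α n :=
  ∀' (inSort σ s (&(Fin.last n)) ⟹ φ)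

/-- `∃ xˢ, φ`. -/
def exS (s : S) (φ : (flat σ).BoundedFormula α (n + 1)) : (flat σ).BoundedFormula α n :=
  ∃' (inSort σ s (&(Fin.last n)) ⊓ φ)

variable {σ} in
/-- The atomic formula `R(t₀, …)`, for a predicate `R` of the many-sorted signature. -/
def atom {l : ℕ} (R : σ.Rel l) (ts : Fin l → (flat σ).Term (α ⊕ Fin n)) :
    (flat σ).BoundedFormula α n :=
  Relations.boundedFormula (L := flat σ) (FlatRel.of R) ts

/-- The sorts cover the domain, are pairwise disjoint and nonempty, and every predicate holds only
of arguments of the right sorts. -/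
def sortAxioms [Finite S] : (flat σ).Theory :=
  {∀' (BoundedFormula.iSup (fun s : S => inSort σ s (&0)))} ∪
  {φ | ∃ s t : S, s ≠ t ∧ φ = ∀' ∼(inSort σ s (&0) ⊓ inSort σ t (&0))} ∪
  {φ | ∃ s : S, φ = ∃' (inSort σ s (&0))} ∪
  {φ | ∃ (l : ℕ) (R : σ.Rel l) (i : Fin l),
    φ = BoundedFormula.alls (n := l) (atom R (fun j => &j) ⟹ inSort σ (σ.sort R i) (&i))}

/-- The relativization of a formula to the sort `s`, for a language whose predicates `R` occur as
predicates `ρ R` of the many-sorted signature. -/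
def relativize {L : FirstOrder.Language.{u, v'}} [L.IsRelational] (ρ : ∀ {l : ℕ}, L.Relations l → σ.Rel l)
    (s : S) {α : Type*} : ∀ {n : ℕ}, L.BoundedFormula α n → (flat σ).BoundedFormula α n
  | _, .falsum => ⊥
  | _, .equal t₁ t₂ => Term.bdEqual (.var (termVar t₁)) (.var (termVar t₂))
  | _, .rel R ts => atom (ρ R) (fun i => .var (termVar (ts i)))
  | _, .imp φ ψ => (relativize ρ s φ).imp (relativize ρ s ψ)
  | _, .all φ => allS σ s (relativize ρ s φ)

end ManySorted

section AdjunctiveClasses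

/-- The sorts of `AC(T)`: objects and classes. -/
inductive ACSort
  | obj
  | cls

instance : Finite ACSort :=
  Finite.of_surjective (fun b : Bool => if b then ACSort.obj else ACSort.cls)
    (fun s => by cases s; exacts [⟨true, rfl⟩, ⟨false, rfl⟩])

/-- The predicates of `AC(T)`: those of `T` and `x ∈ X`. -/
inductive ACRel (L : FirstOrder.Language.{u, v}) : ℕ → Type v
  | base {n : ℕ} (R : L.Relations n) : ACRel L n
  | mem : ACRel L 2

/-- The sorts of the arguments of the predicates of `AC(T)`. -/
def acArgSort {L : FirstOrder.Language.{u, v}} : ∀ {n : ℕ}, ACRel L n → Fin n → ACSort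
  | _, .base _ => fun _ => .obj
  | _, .mem => ![.obj, .cls]

/-- The two-sorted signature of `AC(T)`. -/
abbrev acSig (L : FirstOrder.Language.{u, v}) : SortedSig.{v} ACSort := ⟨ACRel L, acArgSort⟩

variable (L : FirstOrder.Language.{u, v}) {α : Type*} {n : ℕ}

/-- `x ∈ X`. -/
def acMem (x X : (flat (acSig L)).Term (α ⊕ Fin n)) : (flat (acSig L)).BoundedFormula α n :=
  atom (σ := acSig L) ACRel.mem ![x, X]

/-- `∃ X ∀ x, x ∉ X`, for classes `X` and objects `x`. -/
def acEmpty : (flat (acSig L)).Sentence :=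
  exS (acSig L) .cls (allS (acSig L) .obj ∼(acMem L (&1) (&0)))

/-- `∀ X x ∃ Y ∀ y (y ∈ Y ↔ (y ∈ X ∨ y = x))`, for classes `X, Y` and objects `x, y`. -/
def acAdj : (flat (acSig L)).Sentence :=
  allS (acSig L) .cls (allS (acSig L) .obj (exS (acSig L) .cls (allS (acSig L) .obj
    (acMem L (&3) (&2) ⇔ (acMem L (&3) (&0) ⊔ (&3 =' &1))))))

variable {L}

/-- `AC(T)`: the extension of `T` with adjunctive classes. -/
def AC [L.IsRelational] (T : L.Theory) : (flat (acSig L)).Theory :=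
  sortAxioms (acSig L) ∪ relativize (acSig L) ACRel.base .obj '' T ∪ {acEmpty L, acAdj L}

end AdjunctiveClasses

section AdjunctiveSets

/-- The predicates of the language of sets: the binary `∈`. -/
inductive MemRel : ℕ → Type
  | mem : MemRel 2

/-- The language with the single binary predicate `∈`. -/
abbrev memLang : FirstOrder.Language.{0, 0} := ⟨fun _ => Empty, MemRel⟩

instance : memLang.IsRelational := fun _ => inferInstanceAs (IsEmpty Empty)

variable (L : FirstOrder.Language.{u, v}) {α : Type*} {n : ℕ}

/-- `x ∈ y`. -/
def asMem (x y : (L.sum memLang).Term (α ⊕ Fin n)) : (L.sum memLang).BoundedFormula α n :=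
  Relations.boundedFormula ((LHom.sumInr : memLang →ᴸ L.sum memLang).onRelation MemRel.mem) ![x, y]

/-- `∃ x ∀ y, y ∉ x`. -/
def asEmpty : (L.sum memLang).Sentence := ∃' ∀' ∼(asMem L (&1) (&0))

/-- `∀ x y ∃ z ∀ w (w ∈ z ↔ (w ∈ x ∨ w = y))`. -/
def asAdj : (L.sum memLang).Sentence :=
  ∀' ∀' ∃' ∀' (asMem L (&3) (&2) ⇔ (asMem L (&3) (&0) ⊔ (&3 =' &1)))

variable {L}

/-- `AS(T)`: the extension of `T` with adjunctive sets. -/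
def AS (T : L.Theory) : (L.sum memLang).Theory :=
  LHom.sumInl.onTheory T ∪ {asEmpty L, asAdj L}

end AdjunctiveSets

section KripkeModels

/-- The sorts of `KM(T)`: worlds and elements of their domains. -/
inductive KMSort
  | world
  | elt

instance : Finite KMSort :=
  Finite.of_surjective (fun b : Bool => if b then KMSort.world else KMSort.elt)
    (fun s => by cases s; exacts [⟨true, rfl⟩, ⟨false, rfl⟩])

/-- The predicates of `KM(T)`: `p ≼ q`, `D(p, x)`, and `R⋆(p, x₁, …, xₙ)` for each `n`-ary
predicate `R` of the signature of `T`, equality included. -/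
inductive KMRel (L : FirstOrder.Language.{u, v}) : ℕ → Type v
  | le : KMRel L 2
  | dom : KMRel L 2
  | star {n : ℕ} (R : L.Relations n) : KMRel L (n + 1)
  | eqStar : KMRel L 3

/-- The sorts of the arguments of the predicates of `KM(T)`. -/
def kmArgSort {L : FirstOrder.Language.{u, v}} : ∀ {n : ℕ}, KMRel L n → Fin n → KMSort
  | _, .le => ![.world, .world]
  | _, .dom => ![.world, .elt]
  | _, .star _ => Fin.cons .world (fun _ => .elt)
  | _, .eqStar => ![.world, .elt, .elt]

/-- The two-sorted signature of `KM(T)`. -/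
abbrev kmSig (L : FirstOrder.Language.{u, v}) : SortedSig.{v} KMSort := ⟨KMRel L, kmArgSort⟩

/-- The language of `KM(T)`. -/
abbrev kmLang (L : FirstOrder.Language.{u, v}) : FirstOrder.Language.{0, v} := flat (kmSig L)

variable {L : FirstOrder.Language.{u, v}} {V : Type}

/-- An atomic formula of `KM(T)` in the variables `ts`. -/
def kmAtom {l : ℕ} (R : KMRel L l) (ts : Fin l → V) : (kmLang L).Formula V :=
  atom (σ := kmSig L) R (fun i => .var (.inl (ts i)))

/-- `∀ xˢ, φ`, where `Sum.inr ()` is the quantified variable. -/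
noncomputable def kmAll (s : KMSort) (φ : (kmLang L).Formula (V ⊕ Unit)) : (kmLang L).Formula V :=
  Formula.iAlls Unit (BoundedFormula.imp (inSort (kmSig L) s (.var (.inl (.inr ())))) φ)

/-- `(∀ q ≼ p) φ`, where `Sum.inr ()` is the quantified variable `q`. -/
noncomputable def kmAllBelow (p : V) (φ : (kmLang L).Formula (V ⊕ Unit)) : (kmLang L).Formula V :=
  kmAll .world ((kmAtom .le ![Sum.inr (), Sum.inl p]).imp φ)

/-- `(∀ q ≼ p) (∃ r ≼ q) R⋆(r, x₁, …, xₗ)`. -/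
noncomputable def forceAtom {l : ℕ} (R : KMRel L (l + 1)) (p : V) (x : Fin l → V) :
    (kmLang L).Formula V :=
  kmAllBelow p (∼(kmAllBelow (Sum.inr ())
    ∼(kmAtom R (Fin.cons (Sum.inr ()) (fun i => Sum.inl (Sum.inl (x i)))))))

/-- The formula `p ⊩ φ` of the language of `KM(T)`; `e` names the variables to be used for those
of `φ`. The implication `φ → ψ` is read as `¬ (φ ∧ ¬ ψ)`, so that `p ⊩ (φ → ψ)` is
`(∀ q ≼ p) ¬ (q ⊩ φ ∧ (∀ r ≼ q) ¬ (r ⊩ ψ))`. -/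
noncomputable def force [L.IsRelational] {α : Type} :
    ∀ {n : ℕ}, L.BoundedFormula α n →
      ∀ {V : Type}, (α ⊕ Fin n → V) → V → (kmLang L).Formula V
  | _, .falsum, _, _, _ => ⊥
  | _, .equal t₁ t₂, _, e, p => forceAtom .eqStar p ![e (termVar t₁), e (termVar t₂)]
  | _, .rel R ts, _, e, p => forceAtom (.star R) p (fun i => e (termVar (ts i)))
  | _, .imp φ ψ, _, e, p =>
      kmAllBelow p ∼(force φ (fun a => Sum.inl (e a)) (Sum.inr ()) ⊓
        kmAllBelow (Sum.inr ()) ∼(force ψ (fun a => Sum.inl (Sum.inl (e a))) (Sum.inr ())))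
  | _, .all φ, _, e, p =>
      kmAllBelow p (kmAll .elt
        ((kmAtom .dom ![Sum.inl (Sum.inr ()), Sum.inr ()]).imp
          (force φ (extend (fun a => Sum.inl (Sum.inl (e a))) (Sum.inr ()))
            (Sum.inl (Sum.inr ())))))

/-- The sentence `∀ p, p ⊩ φ`. -/
noncomputable def forced [L.IsRelational] (φ : L.Sentence) : (kmLang L).Sentence :=
  kmAll .world (force φ (Sum.elim Empty.elim Fin.elim0) (Sum.inr ()))

variable {α : Type*} {n : ℕ}

/-- `p ≼ q`. -/
def kmLe (p q : (kmLang L).Term (α ⊕ Fin n)) : (kmLang L).BoundedFormula α n :=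
  atom (σ := kmSig L) KMRel.le ![p, q]

/-- `D(p, x)`. -/
def kmDom (p x : (kmLang L).Term (α ⊕ Fin n)) : (kmLang L).BoundedFormula α n :=
  atom (σ := kmSig L) KMRel.dom ![p, x]

variable (L)

/-- `∀ p, p ≼ p`. -/
def kmRefl : (kmLang L).Sentence := allS (kmSig L) .world (kmLe (&0) (&0))

/-- `∀ p q r, p ≼ q ∧ q ≼ r → p ≼ r`. -/
def kmTrans : (kmLang L).Sentence :=
  allS (kmSig L) .world (allS (kmSig L) .world (allS (kmSig L) .world
    ((kmLe (&0) (&1) ⊓ kmLe (&1) (&2)) ⟹ kmLe (&0) (&2))))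

/-- `∀ p ∃ x, D(p, x)`. -/
def kmDomNonempty : (kmLang L).Sentence :=
  allS (kmSig L) .world (exS (kmSig L) .elt (kmDom (&0) (&1)))

/-- `∀ p q (q ≼ p → ∀ x (D(p, x) → D(q, x)))`. -/
def kmDomMono : (kmLang L).Sentence :=
  allS (kmSig L) .world (allS (kmSig L) .world (kmLe (&1) (&0) ⟹
    allS (kmSig L) .elt (kmDom (&0) (&2) ⟹ kmDom (&1) (&2))))

variable {L}

/-- `∀ p x₁ … xₗ (R⋆(p, x₁, …, xₗ) → D(p, xᵢ))`. -/
def kmStarDom {l : ℕ} (R : KMRel L (l + 1)) (i : Fin l) : (kmLang L).Sentence :=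
  BoundedFormula.alls (n := l + 1)
    (atom (σ := kmSig L) R (fun j => &j) ⟹ kmDom (&0) (&(i.succ)))

/-- `∀ p x₁ … xₗ q (q ≼ p → R⋆(p, x₁, …, xₗ) → R⋆(q, x₁, …, xₗ))`. -/
def kmStarMono {l : ℕ} (R : KMRel L (l + 1)) : (kmLang L).Sentence :=
  BoundedFormula.alls (n := l + 2)
    (kmLe (&(Fin.last (l + 1))) (&0) ⟹
      (atom (σ := kmSig L) R (fun j => &(j.castSucc)) ⟹
        atom (σ := kmSig L) R
          (fun j => &(Fin.cons (α := fun _ => Fin (l + 2)) (Fin.last (l + 1))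
            (fun i : Fin l => i.succ.castSucc) j))))

/-- The predicates `R⋆` of `KM(T)`, for the predicates `R` of `T` and for equality. -/
inductive IsStar : ∀ {l : ℕ}, KMRel L (l + 1) → Prop
  | star {l : ℕ} (R : L.Relations l) : IsStar (KMRel.star R)
  | eqStar : IsStar (l := 2) KMRel.eqStar

/-- `KM(T)`: the theory of Kripke models of `T`. The axioms of equality count among the axioms of
`T` that have to be forced. -/
def KM [L.IsRelational] (T : L.Theory) : (kmLang L).Theory :=
  sortAxioms (kmSig L) ∪ {kmRefl L, kmTrans L, kmDomNonempty L, kmDomMono L} ∪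
  {φ | ∃ (l : ℕ) (R : KMRel L (l + 1)) (i : Fin l), IsStar R ∧ φ = kmStarDom R i} ∪
  {φ | ∃ (l : ℕ) (R : KMRel L (l + 1)), IsStar R ∧ φ = kmStarMono R} ∪
  forced '' (T ∪ eqAxioms L)

/-- `T` forcing-interprets `U`: there is an interpretation of `KM(U)` in `T`. -/
def ForcingInterprets {L' : FirstOrder.Language.{u', v'}} [L.IsRelational] (T : L'.Theory) (U : L.Theory) :
    Prop :=
  Interprets T (KM U)

end KripkeModels

end ForcingInterp

/-!
Provability is truth in all models, so an interpretation of theories is a translation that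
defines, in every model of the one, a model of the other (`interp_of_interpretsDim`,
`interpretsDim_of_interp`). The assumption says that every model of `T` defines a model `M` of `T`
together with a family of classes of elements of `M` which contains the empty class and is closed
under adding one element. Nothing like a pairing is available on `M`, and the classes need not be
closed under union or comprehension.

*Repeating the assumption.* Interpreting `T` in itself and adding classes again (`Interp.adj`),
one gets classes of classes of classes, and so on. Finitely many layers give codes for `n`-tuples
of objects and classes, and a last one gives an adjunctive family of sets of such tuples
(`interp_sets`). Besides, the objects of a model of `AC(T)` do not exhaust it, so every model of
`T` defines a model of `T` that omits one of its elements (`exists_shrinks`).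

*A set axiom by forcing.* One wants to assign a class to every object, such that for every object
`x` and every `y` some object is assigned the class of `x` with `y` added. The assignment is made
generic. The conditions are the coded sets of pairs `(z, k)` of an object `z` and a class `k` that
are partial functions; a condition decides the elements of the objects in its domain. To extend
conditions at will, one needs that their domains never contain all objects. But these sets are
finite only from the point of view of the interpretation, and there is no induction. The domains
are therefore restricted to the sets that are *small*: no model of a finite axiomatization of `T`
that is given by codes has its domain inside of them. The set of all objects is not small
(`HData.Small.exists_not`).

*Small sets are closed under adding an element* (`HData.Small.adjoin`). Suppose that `X ∪ {y}`
contains a coded model `A`. By `exists_shrinks` there is a model `B` inside `A` that omits some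
`z` in `A`. Exchanging the names `y` and `z` moves `B` into `X`. If the moved copy of `B` is
coded, this contradicts the smallness of `X`. The copy is first-order definable from the codes of
`A`, so it is coded if comprehension for the formulas in question holds on `X`. This is the
further condition `HData.Nice` on domains. It is stated such that it, too, passes from `X` to
`X ∪ {y}`: for every box over `X`, that is, every set of tuples some of whose components vary in `X`
while the others are fixed, the part of it on which the formula holds can be added to every coded
set (`HData.NiceFor.adjoin`). Here it is used that `T` is finitely axiomatized and that the
signature is finite, so that these conditions are expressible.

The Kripke model has the conditions as worlds, the objects as its constant domain, and the
predicates of the model of `T` at every world. Formulas without `∈` are forced if and only if they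
are true (`HData.forces_onFormula`), and the axioms on sets are forced as new objects can be
assigned the classes `∅` and `k ∪ {y}` below every condition (`HData.forces_asEmpty`,
`HData.forces_asAdj`).
-/

namespace ForcingInterp

open FirstOrder.Language FirstOrder.Language.Structure

universe w u₁ v₁ u₂ v₂ u₃ v₃

/-! ### Structures with definable domain and equality -/

/-- A structure for the relational language `L` whose domain is a part of `H` and whose equality is
a relation on `H`: what a one-dimensional translation yields before passing to the quotient. -/
structure Pre (L : FirstOrder.Language.{u, v}) (H : Type w) where
  dom : H → Prop
  eq : H → H → Prop
  rel : ∀ {n : ℕ}, L.Relations n → (Fin n → H) → Prop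

theorem extend_comp {α : Type*} {V W : Type*} {n : ℕ} (f : V → W) (e : α ⊕ Fin n → V) (y : V) :
    f ∘ extend e y = extend (f ∘ e) (f y) := by
  funext a
  rcases a with a | i
  · rfl
  · refine Fin.lastCases ?_ (fun j => ?_) i <;> simp [extend]

theorem extend_inr {α W : Type*} {n : ℕ} (e : α ⊕ Fin n → W) (y : W) :
    extend e y ∘ Sum.inr = Fin.snoc (e ∘ Sum.inr) y := rfl

theorem termVar_realize {L : FirstOrder.Language.{u, v}} [L.IsRelational] {β : Type*} {M : Type*}
    [L.Structure M] (t : L.Term β) (e : β → M) : t.realize e = e (termVar t) := by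
  cases t with
  | var => rfl
  | func f _ => exact isEmptyElim f

namespace Pre

variable {L : FirstOrder.Language.{u, v}} {H : Type w}

/-- Satisfaction in a structure with definable domain and equality. -/
def Sat [L.IsRelational] (A : Pre L H) {α : Type*} :
    ∀ {n : ℕ}, L.BoundedFormula α n → (α ⊕ Fin n → H) → Prop
  | _, .falsum, _ => False
  | _, .equal t₁ t₂, e => A.eq (e (termVar t₁)) (e (termVar t₂))
  | _, .rel R ts, e => A.rel R (fun i => e (termVar (ts i)))
  | _, .imp φ ψ, e => A.Sat φ e → A.Sat ψ e
  | _, .all φ, e => ∀ x, A.dom x → A.Sat φ (extend e x)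

/-- Satisfaction of a formula without bound variables. -/
def SatF [L.IsRelational] (A : Pre L H) {α : Type*} (φ : L.Formula α) (e : α → H) : Prop :=
  A.Sat φ (Sum.elim e Fin.elim0)

/-- `A` holds, through `f`, exactly what holds in `N`: the structure `N` is the quotient of the
domain of `A` by the equality of `A`. The values of `f` off the domain are irrelevant. -/
structure Presents (A : Pre L H) (N : Type*) [L.Structure N] (f : H → N) : Prop where
  surj : ∀ y, ∃ x, A.dom x ∧ f x = y
  eq_iff : ∀ {x y}, A.dom x → A.dom y → (A.eq x y ↔ f x = f y)
  rel_iff : ∀ {n} (R : L.Relations n) {x : Fin n → H}, (∀ i, A.dom (x i)) →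
    (A.rel R x ↔ RelMap R (f ∘ x))

section

variable {A : Pre L H} {N : Type*} [L.Structure N] {f : H → N}

theorem Presents.congr (h : A.Presents N f) {B : Pre L H} (hd : ∀ x, B.dom x ↔ A.dom x)
    (he : ∀ x y, A.dom x → A.dom y → (B.eq x y ↔ A.eq x y))
    (hr : ∀ {n} (R : L.Relations n) (x : Fin n → H), (∀ i, A.dom (x i)) →
      (B.rel R x ↔ A.rel R x)) : B.Presents N f where
  surj y := by
    obtain ⟨x, hx, rfl⟩ := h.surj y
    exact ⟨x, (hd x).2 hx, rfl⟩
  eq_iff hx hy := by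
    rw [hd] at hx hy
    rw [he _ _ hx hy, h.eq_iff hx hy]
  rel_iff R x hx := by
    simp only [hd] at hx
    rw [hr R x hx, h.rel_iff R hx]

theorem Presents.precomp (h : A.Presents N f) {H' : Type*} (s : H' → H)
    (hs : Function.Surjective s) :
    Presents ⟨fun x => A.dom (s x), fun x y => A.eq (s x) (s y), fun R x => A.rel R (s ∘ x)⟩ N
      (f ∘ s) where
  surj y := by
    obtain ⟨x, hx, rfl⟩ := h.surj y
    obtain ⟨z, rfl⟩ := hs x
    exact ⟨z, hx, rfl⟩
  eq_iff hx hy := h.eq_iff hx hy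
  rel_iff R _ hx := h.rel_iff R hx

variable [L.IsRelational]

/-- Satisfaction in `A` is truth in the structure `N` that `A` presents. -/
theorem Presents.sat_iff (h : A.Presents N f) {α : Type*} :
    ∀ {n : ℕ} (φ : L.BoundedFormula α n) {e : α ⊕ Fin n → H}, (∀ a, A.dom (e a)) →
      (A.Sat φ e ↔ φ.Realize (f ∘ e ∘ Sum.inl) (f ∘ e ∘ Sum.inr)) := by
  have key : ∀ {n : ℕ} (e : α ⊕ Fin n → H),
      (Sum.elim (f ∘ e ∘ Sum.inl) (f ∘ e ∘ Sum.inr) : α ⊕ Fin n → N) = f ∘ e := by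
    intro n e; funext a; cases a <;> rfl
  intro n φ
  induction φ with
  | falsum => intro e he; exact Iff.rfl
  | equal t₁ t₂ =>
    intro e he
    simp only [Sat, BoundedFormula.Realize, key, termVar_realize]
    exact h.eq_iff (he _) (he _)
  | rel R ts =>
    intro e he
    simp only [Sat, BoundedFormula.Realize, key, termVar_realize]
    exact h.rel_iff R fun i => he _
  | imp φ ψ ih₁ ih₂ =>
    intro e he
    simp only [Sat, BoundedFormula.realize_imp, ih₁ he, ih₂ he]
  | all φ ih =>
    intro e he
    have hx : ∀ x, A.dom x → ∀ a, A.dom (extend e x a) := by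
      intro x hx a
      rcases a with a | i
      · exact he _
      · refine Fin.lastCases ?_ (fun j => ?_) i
        · simpa [extend] using hx
        · simpa [extend] using he (Sum.inr j)
    have hs : ∀ x, f ∘ extend e x ∘ Sum.inr = Fin.snoc (f ∘ e ∘ Sum.inr) (f x) := by
      intro x
      rw [← Function.comp_assoc, extend_comp, extend_inr, Function.comp_assoc]
    simp only [Sat, BoundedFormula.realize_all]
    constructor
    · intro hall y
      obtain ⟨x, hxd, rfl⟩ := h.surj y
      have := (ih (hx x hxd)).1 (hall x hxd)
      rw [hs] at this
      exact this
    · intro hall x hxd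
      rw [ih (hx x hxd), hs]
      exact hall (f x)

theorem Presents.satF_iff (h : A.Presents N f) {α : Type*} (φ : L.Formula α) {e : α → H}
    (he : ∀ a, A.dom (e a)) : A.SatF φ e ↔ φ.Realize (f ∘ e) := by
  rw [SatF, h.sat_iff]
  · rw [Formula.Realize, iff_iff_eq]
    congr 1
    exact Subsingleton.elim _ _
  · rintro (a | i)
    · exact he a
    · exact i.elim0

theorem Presents.sentence_iff (h : A.Presents N f) (φ : L.Sentence) :
    A.SatF φ Empty.elim ↔ N ⊨ φ := by
  rw [h.satF_iff φ (fun a => a.elim), Sentence.Realize, iff_iff_eq]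
  congr 1
  exact Subsingleton.elim _ _

end

section Congruence

variable [L.IsRelational]

theorem sat_alls (A : Pre L H) {α : Type*} : ∀ {n : ℕ} (φ : L.BoundedFormula α n) (e : α → H),
    A.SatF φ.alls e ↔ ∀ xs : Fin n → H, (∀ i, A.dom (xs i)) → A.Sat φ (Sum.elim e xs) := by
  intro n
  induction n with
  | zero =>
    intro φ e
    constructor
    · intro h xs _
      rw [Subsingleton.elim xs Fin.elim0]
      exact h
    · intro h
      exact h _ fun i => i.elim0
  | succ n ih =>
    intro φ e
    have hext : ∀ (xs : Fin n → H) x, extend (Sum.elim e xs) x = Sum.elim e (Fin.snoc xs x) :=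
      fun _ _ => rfl
    rw [BoundedFormula.alls, ih]
    constructor
    · intro h xs hxs
      have := h (Fin.init xs) (fun i => hxs _) (xs (Fin.last n)) (hxs _)
      rwa [hext, Fin.snoc_init_self] at this
    · intro h xs hxs x hx
      rw [hext]
      refine h _ fun i => ?_
      refine Fin.lastCases ?_ (fun j => ?_) i
      · simpa using hx
      · simpa using hxs j

theorem satF_eqRefl {A : Pre L H} {e : Empty → H} (h : A.SatF (eqRefl L) e) (x : H)
    (hx : A.dom x) : A.eq x x := by
  have := h x hx
  simpa [Sat, extend, termVar, Term.bdEqual, Fin.snoc] using this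

theorem satF_eqSymm {A : Pre L H} {e : Empty → H} (h : A.SatF (eqSymm L) e) {x y : H}
    (hx : A.dom x) (hy : A.dom y) : A.eq x y → A.eq y x := by
  have := h x hx y hy
  simpa [Sat, extend, termVar, Term.bdEqual, Fin.snoc] using this

theorem satF_eqTrans {A : Pre L H} {e : Empty → H} (h : A.SatF (eqTrans L) e) {x y z : H}
    (hx : A.dom x) (hy : A.dom y) (hz : A.dom z) : A.eq x y → A.eq y z → A.eq x z := by
  have := h x hx y hy z hz
  simpa [Sat, extend, termVar, Term.bdEqual, Fin.snoc] using this

/-- The axiom of congruence in one argument of a predicate. -/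
theorem satF_eqCongr {A : Pre L H} {e : Empty → H} {n : ℕ} {R : L.Relations n} {i : Fin n}
    (h : A.SatF (eqCongr R i) e) {x : Fin n → H} (hx : ∀ i, A.dom (x i)) {y : H} (hy : A.dom y)
    (hxy : A.eq (x i) y) (hR : A.rel R x) : A.rel R (Function.update x i y) := by
  rw [eqCongr, sat_alls] at h
  have := h (Fin.snoc x y) (fun j => by
    refine Fin.lastCases ?_ (fun j => ?_) j
    · simpa using hy
    · simpa using hx j)
  simp only [Relations.boundedFormula, Sat, Term.bdEqual, termVar, Function.comp_apply,
    Sum.elim_inr, Fin.snoc_castSucc, Fin.snoc_last] at this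
  have h2 := this hxy hR
  convert h2 using 2 with j
  by_cases hj : j = i
  · subst hj; simp
  · simp [Function.update_of_ne hj]

/-- A structure with definable equality that satisfies the axioms of equality has a quotient. -/
theorem exists_presents {A : Pre L H} (hne : ∃ x, A.dom x) {e : Empty → H}
    (h : ∀ φ ∈ eqAxioms L, A.SatF φ e) :
    ∃ (N : Type w) (_ : L.Structure N) (_ : Nonempty N) (f : H → N), A.Presents N f := by
  classical
  have hrefl := satF_eqRefl (h _ (Or.inl (Or.inl rfl)))
  have hsymm := @satF_eqSymm L H _ A e (h _ (Or.inl (Or.inr (Or.inl rfl))))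
  have htrans := @satF_eqTrans L H _ A e (h _ (Or.inl (Or.inr (Or.inr rfl))))
  have hcongr : ∀ {n} (R : L.Relations n) (i : Fin n), A.SatF (eqCongr R i) e :=
    fun R i => h _ (Or.inr ⟨_, R, i, rfl⟩)
  -- replacing the arguments one after the other
  have hrel : ∀ {n} (R : L.Relations n) (x y : Fin n → H), (∀ i, A.dom (x i)) →
      (∀ i, A.dom (y i)) → (∀ i, A.eq (x i) (y i)) → A.rel R x → A.rel R y := by
    intro n R x y hx hy hxy hR
    have : ∀ s : Finset (Fin n), A.rel R (fun i => if i ∈ s then y i else x i) := by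
      intro s
      induction s using Finset.induction_on with
      | empty => simpa using hR
      | insert i s hi ih =>
        have := satF_eqCongr (hcongr R i) (x := fun i => if i ∈ s then y i else x i)
          (fun j => by split_ifs; exacts [hy j, hx j]) (hy i)
          (by simpa [hi] using hxy i) ih
        convert this using 2 with j
        by_cases hj : j = i
        · subst hj; simp
        · simp [hj]
    simpa using this Finset.univ
  let S : Setoid {x // A.dom x} :=
    { r := fun x y => A.eq x y
      iseqv := ⟨fun x => hrefl x x.2, fun {x y} => hsymm x.2 y.2,
        fun {x y z} => htrans x.2 y.2 z.2⟩ }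
  let N := Quotient S
  let str : L.Structure N :=
    { funMap := fun f => isEmptyElim f
      RelMap := fun {n} R y => ∃ x : Fin n → {x // A.dom x},
          (∀ i, (Quotient.mk S (x i) : N) = y i) ∧
          A.rel R (fun i => (x i).1) }
  obtain ⟨x₀, hx₀⟩ := hne
  let f : H → N := fun x => if hx : A.dom x then Quotient.mk S ⟨x, hx⟩ else Quotient.mk S ⟨x₀, hx₀⟩
  have hf : ∀ {x} (hx : A.dom x), f x = Quotient.mk S ⟨x, hx⟩ := fun {x} hx => dif_pos hx
  refine ⟨N, str, ⟨f x₀⟩, f, ⟨fun y => ?_, fun {x y} hx hy => ?_, fun {n} R x hx => ?_⟩⟩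
  · induction y using Quotient.inductionOn with
    | h x => exact ⟨x.1, x.2, hf x.2⟩
  · rw [hf hx, hf hy, Quotient.eq]
    rfl
  · constructor
    · intro hR
      exact ⟨fun i => ⟨x i, hx i⟩, fun i => (hf (hx i)).symm, hR⟩
    · rintro ⟨z, hz, hR⟩
      refine hrel R _ x (fun i => (z i).2) hx (fun i => ?_) hR
      have := hz i
      rw [Function.comp, hf (hx i)] at this
      exact Quotient.exact this

end Congruence

end Pre

/-! ### Uniformly definable predicates -/

section Uniform

variable {K : FirstOrder.Language.{u₁, v₁}} {V : Type}

variable (K) in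
/-- The predicate `P` of assignments in the structures of `K` is defined by one formula in all
structures. The lemmas whose names begin with `u` assert this of particular predicates. -/
def UD (P : ∀ (N : Type w) [K.Structure N], (V → N) → Prop) : Prop :=
  ∃ φ : K.Formula V, ∀ (N : Type w) [K.Structure N] (v : V → N), φ.Realize v ↔ P N v

namespace UD

variable {P Q : ∀ (N : Type w) [K.Structure N], (V → N) → Prop}

theorem congr (h : UD K P) (hPQ : ∀ (N : Type w) [K.Structure N] (v : V → N), P N v ↔ Q N v) :
    UD K Q := by
  obtain ⟨φ, hφ⟩ := h
  exact ⟨φ, fun N _ v => (hφ N v).trans (hPQ N v)⟩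

theorem ofFormula (φ : K.Formula V) : UD.{w} K fun N _ (v : V → N) => φ.Realize v :=
  ⟨φ, fun _ _ _ => Iff.rfl⟩

theorem relabel (h : UD K P) {W : Type} (g : V → W) :
    UD K fun N _ (w : W → N) => P N (fun a => w (g a)) := by
  obtain ⟨φ, hφ⟩ := h
  exact ⟨φ.relabel g, fun N _ w => by rw [Formula.realize_relabel, hφ]; rfl⟩

theorem ff : UD.{w} K fun N _ (_ : V → N) => False := ⟨⊥, fun _ _ _ => Iff.rfl⟩

theorem tt : UD.{w} K fun N _ (_ : V → N) => True := ⟨⊤, fun _ _ _ => by simp⟩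

theorem eq (a b : V) : UD.{w} K fun N _ (v : V → N) => v a = v b :=
  ⟨Term.equal (.var a) (.var b), fun N _ v => by simp⟩

theorem rel {n : ℕ} (R : K.Relations n) (g : Fin n → V) :
    UD.{w} K fun N _ (v : V → N) => RelMap R (fun i => v (g i)) :=
  ⟨R.formula (fun i => .var (g i)), fun N _ v => by simp [Formula.realize_rel]⟩

theorem imp (hP : UD K P) (hQ : UD K Q) : UD K fun N _ (v : V → N) => P N v → Q N v := by
  obtain ⟨φ, hφ⟩ := hP
  obtain ⟨ψ, hψ⟩ := hQ
  exact ⟨φ.imp ψ, fun N _ v => by rw [Formula.realize_imp, hφ, hψ]⟩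

theorem not (hP : UD K P) : UD K fun N _ (v : V → N) => ¬ P N v := imp hP ff

theorem and (hP : UD K P) (hQ : UD K Q) : UD K fun N _ (v : V → N) => P N v ∧ Q N v :=
  (not (imp hP (not hQ))).congr fun _ _ _ => by tauto

theorem or (hP : UD K P) (hQ : UD K Q) : UD K fun N _ (v : V → N) => P N v ∨ Q N v :=
  (imp (not hP) hQ).congr fun _ _ _ => by tauto

theorem iff (hP : UD K P) (hQ : UD K Q) : UD K fun N _ (v : V → N) => (P N v ↔ Q N v) :=
  (and (imp hP hQ) (imp hQ hP)).congr fun _ _ _ => by tauto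

theorem alls {ι : Type} [Finite ι]
    {P : ∀ (N : Type w) [K.Structure N], (V → N) → (ι → N) → Prop}
    (h : UD K fun N _ (w : V ⊕ ι → N) => P N (fun a => w (.inl a)) (fun i => w (.inr i))) :
    UD K fun N _ (v : V → N) => ∀ x, P N v x := by
  obtain ⟨φ, hφ⟩ := h
  exact ⟨φ.iAlls ι, fun N _ v => by
    rw [Formula.realize_iAlls]
    exact forall_congr' fun x => hφ N _⟩

theorem all {P : ∀ (N : Type w) [K.Structure N], (V → N) → N → Prop}
    (h : UD K fun N _ (w : V ⊕ Unit → N) => P N (fun a => w (.inl a)) (w (.inr ()))) :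
    UD K fun N _ (v : V → N) => ∀ x, P N v x :=
  (alls (ι := Unit) (P := fun N _ v x => P N v (x ())) h).congr fun _ _ _ =>
    ⟨fun h x => h fun _ => x, fun h x => h (x ())⟩

theorem exs {ι : Type} [Finite ι]
    {P : ∀ (N : Type w) [K.Structure N], (V → N) → (ι → N) → Prop}
    (h : UD K fun N _ (w : V ⊕ ι → N) => P N (fun a => w (.inl a)) (fun i => w (.inr i))) :
    UD K fun N _ (v : V → N) => ∃ x, P N v x :=
  (not (alls (P := fun N _ v x => ¬ P N v x) (not h))).congr fun _ _ _ => by simp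

theorem ex {P : ∀ (N : Type w) [K.Structure N], (V → N) → N → Prop}
    (h : UD K fun N _ (w : V ⊕ Unit → N) => P N (fun a => w (.inl a)) (w (.inr ()))) :
    UD K fun N _ (v : V → N) => ∃ x, P N v x :=
  (not (all (P := fun N _ v x => ¬ P N v x) (not h))).congr fun _ _ _ => by simp

theorem forall_index {ι : Type*} [Finite ι]
    {P : ι → ∀ (N : Type w) [K.Structure N], (V → N) → Prop} (h : ∀ i, UD K (P i)) :
    UD K fun N _ (v : V → N) => ∀ i, P i N v := by
  choose φ hφ using h
  exact ⟨Formula.iInf φ, fun N _ v => by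
    rw [Formula.realize_iInf]
    exact forall_congr' fun i => hφ i N v⟩

theorem forall_mem {ι : Type*} {S : Set ι} (hS : S.Finite)
    {P : ι → ∀ (N : Type w) [K.Structure N], (V → N) → Prop} (h : ∀ i, UD K (P i)) :
    UD K fun N _ (v : V → N) => ∀ i ∈ S, P i N v := by
  have := hS.to_subtype
  exact (forall_index (ι := S) (P := fun i => P i) fun i => h i).congr fun _ _ _ => by simp

/-- Implications with a premise that does not depend on the structure. -/
theorem imp_const {p : Prop} (hP : p → UD K P) : UD K fun N _ (v : V → N) => p → P N v := by
  by_cases hp : p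
  · exact (hP hp).congr fun _ _ _ => by simp [hp]
  · exact tt.congr fun _ _ _ => by simp [hp]

end UD

variable (K) in
/-- A family of structures with definable domain and equality, in all structures of `K`, depending
on parameters `V`, is uniformly definable. -/
structure UPre {L : FirstOrder.Language.{u, v}}
    (B : ∀ (N : Type w) [K.Structure N], (V → N) → Pre L N) : Prop where
  dom : ∀ {W : Type} (g : V → W) (a : W),
    UD K fun N _ (w : W → N) => (B N (fun i => w (g i))).dom (w a)
  eq : ∀ {W : Type} (g : V → W) (a b : W),
    UD K fun N _ (w : W → N) => (B N (fun i => w (g i))).eq (w a) (w b)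
  rel : ∀ {W : Type} {n : ℕ} (R : L.Relations n) (g : V → W) (a : Fin n → W),
    UD K fun N _ (w : W → N) => (B N (fun i => w (g i))).rel R (fun i => w (a i))

namespace UPre

variable {L : FirstOrder.Language.{u, v}}
  {B : ∀ (N : Type w) [K.Structure N], (V → N) → Pre L N}

theorem sat [L.IsRelational] (hB : UPre K B) {α : Type*} :
    ∀ {n : ℕ} (φ : L.BoundedFormula α n) {W : Type} (g : V → W) (e : α ⊕ Fin n → W),
      UD K fun N _ (w : W → N) => (B N (fun i => w (g i))).Sat φ (fun a => w (e a)) := by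
  intro n φ
  induction φ with
  | falsum => intro W g e; exact UD.ff
  | equal t₁ t₂ => intro W g e; exact hB.eq _ _ _
  | rel R ts => intro W g e; exact hB.rel _ _ _
  | imp φ ψ ih₁ ih₂ => intro W g e; exact UD.imp (ih₁ _ _) (ih₂ _ _)
  | all φ ih =>
    intro W g e
    refine UD.all (P := fun N _ w x => (B N fun i => w (g i)).dom x →
      (B N fun i => w (g i)).Sat φ (extend (fun a => w (e a)) x)) ?_
    refine UD.imp (hB.dom (fun i => Sum.inl (g i)) _) ?_
    refine (ih (fun i => Sum.inl (g i)) (extend (fun a => Sum.inl (e a)) (Sum.inr ()))).congr ?_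
    intro N _ w
    exact iff_of_eq (congrArg _ (extend_comp w _ _))

theorem satF [L.IsRelational] (hB : UPre K B) {α : Type*} (φ : L.Formula α) {W : Type}
    (g : V → W) (e : α → W) :
    UD K fun N _ (w : W → N) => (B N (fun i => w (g i))).SatF φ (fun a => w (e a)) :=
  (hB.sat φ g (Sum.elim e Fin.elim0)).congr fun N _ w => by
    refine iff_of_eq (congrArg _ ?_)
    funext a
    rcases a with a | i
    · rfl
    · exact i.elim0

theorem satS [L.IsRelational] (hB : UPre K B) (φ : L.Sentence) {W : Type} (g : V → W) :
    UD K fun N _ (w : W → N) => (B N (fun i => w (g i))).SatF φ Empty.elim :=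
  (hB.satF φ g Empty.elim).congr fun N _ w => by
    rw [Subsingleton.elim (fun a => w (Empty.elim a)) Empty.elim]

end UPre

end Uniform

/-! ### One-dimensional interpretations between classes of structures -/

section Interp

/-- A one-dimensional translation of the relational language `K` into `L`, with parameters indexed
by `ι`. -/
structure Tr (K : FirstOrder.Language.{u₁, v₁}) (L : FirstOrder.Language.{u, v}) (ι : Type) where
  par : L.Formula ι
  dom : L.Formula (Unit ⊕ ι)
  eq : L.Formula (Fin 2 ⊕ ι)
  rel : ∀ {n : ℕ}, K.Relations n → L.Formula (Fin n ⊕ ι)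

variable {K : FirstOrder.Language.{u₁, v₁}} {L : FirstOrder.Language.{u, v}}
  {K' : FirstOrder.Language.{u₂, v₂}} {ι κ : Type}

/-- The structure that a translation defines in `M` from the parameters `p`. -/
def Tr.pre (τ : Tr K L ι) (M : Type w) [L.Structure M] (p : ι → M) : Pre K M where
  dom x := τ.dom.Realize (Sum.elim (fun _ => x) p)
  eq x y := τ.eq.Realize (Sum.elim ![x, y] p)
  rel R x := (τ.rel R).Realize (Sum.elim x p)

/-- The structure that a translation defines, from the parameters `p`, in a structure with definable
domain and equality. -/
def Pre.comp [L.IsRelational] {H : Type w} (A : Pre L H) (τ : Tr K L ι) (p : ι → H) : Pre K H where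
  dom x := A.dom x ∧ A.SatF τ.dom (Sum.elim (fun _ => x) p)
  eq x y := A.SatF τ.eq (Sum.elim ![x, y] p)
  rel R x := A.SatF (τ.rel R) (Sum.elim x p)

theorem Pre.Presents.comp_dom_iff [L.IsRelational] {H : Type w} {A : Pre L H} {N : Type*}
    [L.Structure N] {f : H → N} (h : A.Presents N f) (τ : Tr K L ι) {p : ι → H}
    (hp : ∀ i, A.dom (p i)) {x : H} :
    (A.comp τ p).dom x ↔ A.dom x ∧ (τ.pre N (f ∘ p)).dom (f x) := by
  refine and_congr_right fun hx => ?_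
  rw [h.satF_iff]
  · rw [Sum.comp_elim]; rfl
  · rintro (a | i); exacts [hx, hp i]

/-- Composition of translations: if `A` presents `N`, and `τ` defines in `N` a structure
presenting `N'`, then `τ` applied to `A` presents `N'`. -/
theorem Pre.Presents.comp [L.IsRelational] {H : Type w} {A : Pre L H} {N : Type*}
    [L.Structure N] {f : H → N} (h : A.Presents N f) {τ : Tr K L ι} {p : ι → H}
    (hp : ∀ i, A.dom (p i)) {N' : Type*} [K.Structure N'] {f' : N → N'}
    (h' : (τ.pre N (f ∘ p)).Presents N' f') : (A.comp τ p).Presents N' (f' ∘ f) where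
  surj z := by
    obtain ⟨y, hy, rfl⟩ := h'.surj z
    obtain ⟨x, hx, rfl⟩ := h.surj y
    exact ⟨x, (h.comp_dom_iff τ hp).2 ⟨hx, hy⟩, rfl⟩
  eq_iff {x y} hx hy := by
    rw [h.comp_dom_iff τ hp] at hx hy
    refine Iff.trans ?_ (h'.eq_iff hx.2 hy.2)
    refine (h.satF_iff _ ?_).trans ?_
    · rintro (a | i)
      · refine Fin.cases hx.1 (fun j => ?_) a
        rw [Subsingleton.elim j 0]; exact hy.1
      · exact hp i
    · rw [Sum.comp_elim]
      have : f ∘ ![x, y] = ![f x, f y] := by funext i; fin_cases i <;> rfl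
      rw [this]; rfl
  rel_iff R x hx := by
    simp only [h.comp_dom_iff τ hp] at hx
    refine Iff.trans ?_ (h'.rel_iff R (x := f ∘ x) fun i => (hx i).2)
    refine (h.satF_iff _ ?_).trans ?_
    · rintro (a | i); exacts [(hx a).1, hp i]
    · rw [Sum.comp_elim]; rfl

/-- Translations act on uniformly definable families; the parameters of the family and of the
translation are put together. -/
theorem UPre.comp [L.IsRelational] {K₀ : FirstOrder.Language.{u₃, v₃}} {V : Type}
    {B : ∀ (N : Type w) [K₀.Structure N], (V → N) → Pre L N} (hB : UPre K₀ B) (τ : Tr K L ι) :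
    UPre K₀ fun N _ (v : V ⊕ ι → N) => (B N (fun i => v (.inl i))).comp τ
      (fun i => v (.inr i)) where
  dom g a := by
    refine UD.and (hB.dom (fun i => g (.inl i)) a) ?_
    refine (hB.satF τ.dom (fun i => g (.inl i))
      (Sum.elim (fun _ => a) (fun i => g (.inr i)))).congr fun N _ w => ?_
    refine iff_of_eq (congrArg _ ?_)
    funext x; cases x <;> rfl
  eq g a b := by
    refine (hB.satF τ.eq (fun i => g (.inl i))
      (Sum.elim ![a, b] (fun i => g (.inr i)))).congr fun N _ w => ?_
    refine iff_of_eq (congrArg _ ?_)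
    funext x
    rcases x with x | x
    · fin_cases x <;> rfl
    · rfl
  rel R g a := by
    refine (hB.satF (τ.rel R) (fun i => g (.inl i))
      (Sum.elim a (fun i => g (.inr i)))).congr fun N _ w => ?_
    refine iff_of_eq (congrArg _ ?_)
    funext x; cases x <;> rfl

theorem Tr.upre (τ : Tr K L ι) : UPre L fun (N : Type w) _ (v : ι → N) => τ.pre N v where
  dom g a := ((UD.ofFormula τ.dom).relabel (Sum.elim (fun _ => a) g)).congr fun N _ w => by
    refine iff_of_eq (congrArg _ ?_)
    funext x; cases x <;> rfl
  eq g a b := ((UD.ofFormula τ.eq).relabel (Sum.elim ![a, b] g)).congr fun N _ w => by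
    refine iff_of_eq (congrArg _ ?_)
    funext x
    rcases x with x | x
    · fin_cases x <;> rfl
    · rfl
  rel R g a := ((UD.ofFormula (τ.rel R)).relabel (Sum.elim a g)).congr fun N _ w => by
    refine iff_of_eq (congrArg _ ?_)
    funext x; cases x <;> rfl

/-- A uniformly definable family of structures, with a definable range of parameters, is given by
a translation. -/
theorem UPre.exists_tr {B : ∀ (N : Type w) [L.Structure N], (ι → N) → Pre K N} (hB : UPre L B)
    {P : ∀ (N : Type w) [L.Structure N], (ι → N) → Prop} (hP : UD L P) :
    ∃ τ : Tr K L ι, ∀ (N : Type w) [L.Structure N] (p : ι → N),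
      (τ.par.Realize p ↔ P N p) ∧ τ.pre N p = B N p := by
  obtain ⟨π, hπ⟩ := hP
  obtain ⟨δ, hδ⟩ := hB.dom (Sum.inr : ι → Unit ⊕ ι) (.inl ())
  obtain ⟨ε, hε⟩ := hB.eq (Sum.inr : ι → Fin 2 ⊕ ι) (.inl 0) (.inl 1)
  choose ρ hρ using fun (n : ℕ) (R : K.Relations n) => hB.rel R (Sum.inr : ι → Fin n ⊕ ι) Sum.inl
  refine ⟨⟨π, δ, ε, fun R => ρ _ R⟩, fun N _ p => ⟨hπ N p, ?_⟩⟩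
  have h1 : ∀ (C D : Pre K N), (∀ x, C.dom x ↔ D.dom x) → (∀ x y, C.eq x y ↔ D.eq x y) →
      (∀ n (R : K.Relations n) x, C.rel R x ↔ D.rel R x) → C = D := by
    rintro ⟨d, e, r⟩ ⟨d', e', r'⟩ hd he hr
    simp only [Pre.mk.injEq]
    refine ⟨funext fun x => propext (hd x), funext fun x => funext fun y => propext (he x y), ?_⟩
    funext n R x
    exact propext (hr n R x)
  refine h1 _ _ (fun x => ?_) (fun x y => ?_) (fun n R x => ?_)
  · exact hδ N _
  · exact hε N _
  · exact hρ n R N _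

/-- Every structure in the class `𝒞` defines, by one one-dimensional translation with parameters
from a definable nonempty range, a structure in the class `𝒟`. -/
def Interp (𝒞 : ∀ (M : Type w) [L.Structure M], Prop) (𝒟 : ∀ (N : Type w) [K.Structure N], Prop) :
    Prop :=
  ∃ (ι : Type) (_ : Finite ι) (τ : Tr K L ι), ∀ (M : Type w) [L.Structure M], 𝒞 M →
    (∃ p : ι → M, τ.par.Realize p) ∧ ∀ p : ι → M, τ.par.Realize p →
      ∃ (N : Type w) (_ : K.Structure N) (f : M → N), 𝒟 N ∧ (τ.pre M p).Presents N f

/-- Interpretations may be given by definable predicates instead of formulas. -/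
theorem Interp.of_upre [Finite ι] {𝒞 : ∀ (M : Type w) [L.Structure M], Prop}
    {𝒟 : ∀ (N : Type w) [K.Structure N], Prop}
    {B : ∀ (N : Type w) [L.Structure N], (ι → N) → Pre K N} (hB : UPre L B)
    {P : ∀ (N : Type w) [L.Structure N], (ι → N) → Prop} (hP : UD L P)
    (h : ∀ (M : Type w) [L.Structure M], 𝒞 M → (∃ p, P M p) ∧ ∀ p : ι → M, P M p →
      ∃ (N : Type w) (_ : K.Structure N) (f : M → N), 𝒟 N ∧ (B M p).Presents N f) :
    Interp 𝒞 𝒟 := by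
  obtain ⟨τ, hτ⟩ := hB.exists_tr hP
  refine ⟨ι, ‹_›, τ, fun M _ hM => ⟨?_, fun p hp => ?_⟩⟩
  · obtain ⟨p, hp⟩ := (h M hM).1
    exact ⟨p, (hτ M p).1.2 hp⟩
  · rw [(hτ M p).2]
    exact (h M hM).2 p ((hτ M p).1.1 hp)

/-- Interpretations compose; the parameters of the second one are represented by elements of the
domain of the first one. -/
theorem Interp.trans [K.IsRelational] {𝒞 : ∀ (M : Type w) [L.Structure M], Prop}
    {𝒟 : ∀ (N : Type w) [K.Structure N], Prop} {ℰ : ∀ (N : Type w) [K'.Structure N], Prop}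
    (h₁ : Interp 𝒞 𝒟) (h₂ : Interp 𝒟 ℰ) : Interp 𝒞 ℰ := by
  obtain ⟨ι, _, τ, hτ⟩ := h₁
  obtain ⟨κ, _, σ, hσ⟩ := h₂
  refine Interp.of_upre (τ.upre.comp σ) (P := fun M _ p => τ.par.Realize (fun i => p (.inl i)) ∧
    (∀ j, (τ.pre M (fun i => p (.inl i))).dom (p (.inr j))) ∧
    (τ.pre M (fun i => p (.inl i))).SatF σ.par (fun j => p (.inr j))) ?_ fun M _ hM => ⟨?_, ?_⟩
  · exact UD.and ((UD.ofFormula τ.par).relabel Sum.inl)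
      (UD.and (UD.forall_index fun j => τ.upre.dom _ _) (τ.upre.satF _ _ _))
  · obtain ⟨p, hp⟩ := (hτ M hM).1
    obtain ⟨N, _, f, hN, hf⟩ := (hτ M hM).2 p hp
    obtain ⟨q, hq⟩ := (hσ N hN).1
    choose r hr using fun j => hf.surj (q j)
    refine ⟨Sum.elim p r, hp, fun j => (hr j).1, ?_⟩
    refine (hf.satF_iff _ fun j => (hr j).1).2 ?_
    rwa [show f ∘ _ = q from funext fun j => (hr j).2]
  · rintro p ⟨hp, hq, hq'⟩
    obtain ⟨N, _, f, hN, hf⟩ := (hτ M hM).2 _ hp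
    obtain ⟨N', _, f', hN', hf'⟩ := (hσ N hN).2 _ ((hf.satF_iff _ hq).1 hq')
    exact ⟨N', _, f' ∘ f, hN', hf.comp hq hf'⟩

end Interp

/-! ### One-dimensional interpretations of theories -/

section Theories

variable {L : FirstOrder.Language.{u, v}} {K : FirstOrder.Language.{u₁, v₁}} 

/-- The structure that a one-dimensional translation defines from the parameters `p`. -/
def transPre {k : ℕ} (τ : Translation K L 1 k) (M : Type w) [L.Structure M] (p : Fin k → M) :
    Pre K M where
  dom x := τ.dom.Realize (Sum.elim (fun _ => x) p)
  eq x y := τ.eq.Realize (Sum.elim (fun ij => ![x, y] ij.1) p)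
  rel R x := (τ.rel R).Realize (Sum.elim (fun ij => x ij.1) p)

/-- The translation in the sense of `Translation` as one in the sense of `Tr`. -/
def Tr.ofTranslation {k : ℕ} (τ : Translation K L 1 k) : Tr K L (Fin k) where
  par := τ.param
  dom := τ.dom.relabel (Sum.map (fun _ => ()) id)
  eq := τ.eq.relabel (Sum.map Prod.fst id)
  rel R := (τ.rel R).relabel (Sum.map Prod.fst id)

theorem Tr.ofTranslation_pre {k : ℕ} (τ : Translation K L 1 k) (M : Type w) [L.Structure M]
    (p : Fin k → M) : (Tr.ofTranslation τ).pre M p = transPre τ M p := by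
  simp only [Tr.pre, Tr.ofTranslation, transPre, Formula.realize_relabel]
  simp only [Sum.elim_comp_map]
  rfl

/-- The translation in the sense of `Tr` as one in the sense of `Translation`. -/
noncomputable def Tr.toTranslation {k : ℕ} (τ : Tr K L (Fin k)) : Translation K L 1 k where
  param := τ.par
  dom := τ.dom.relabel (Sum.map (fun _ => 0) id)
  eq := τ.eq.relabel (Sum.map (fun i => (i, 0)) id)
  rel R := (τ.rel R).relabel (Sum.map (fun i => (i, 0)) id)

theorem Tr.transPre_toTranslation {k : ℕ} (τ : Tr K L (Fin k)) (M : Type w) [L.Structure M]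
    (p : Fin k → M) : transPre τ.toTranslation M p = τ.pre M p := by
  simp only [Tr.pre, Tr.toTranslation, transPre, Formula.realize_relabel]
  simp only [Sum.elim_comp_map]
  rfl

variable [K.IsRelational]

/-- A translated formula holds if and only if the formula is satisfied in the structure that the
translation defines. -/
theorem realize_formula {k : ℕ} (τ : Translation K L 1 k) {M : Type w} [L.Structure M]
    {α : Type} : ∀ {n : ℕ} (φ : K.BoundedFormula α n) {V : Type} (e : α ⊕ Fin n → Fin 1 → V)
      (p : Fin k → V) (v : V → M),
      (τ.formula φ e p).Realize v ↔ (transPre τ M (v ∘ p)).Sat φ (fun a => v (e a 0)) := by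
  intro n φ
  induction φ with
  | falsum => intro V e p v; exact Iff.rfl
  | equal t₁ t₂ =>
    intro V e p v
    simp only [Translation.formula, Formula.realize_relabel, Pre.Sat, transPre]
    refine iff_of_eq (congrArg _ ?_)
    funext a
    rcases a with ⟨i, j⟩ | i
    · rw [Subsingleton.elim j 0]; fin_cases i <;> rfl
    · rfl
  | rel R ts =>
    intro V e p v
    simp only [Translation.formula, Formula.realize_relabel, Pre.Sat, transPre]
    refine iff_of_eq (congrArg _ ?_)
    funext a
    rcases a with ⟨i, j⟩ | i
    · rw [Subsingleton.elim j 0]; rfl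
    · rfl
  | imp φ ψ ih₁ ih₂ =>
    intro V e p v
    simp only [Translation.formula, Formula.realize_imp, Pre.Sat, ih₁, ih₂]
  | all φ ih =>
    intro V e p v
    simp only [Translation.formula, Formula.realize_iAlls, Formula.realize_imp, Pre.Sat, ih,
      Formula.realize_relabel]
    have key : ∀ x : Fin 1 → M,
        ((transPre τ M (Sum.elim v x ∘ Sum.inl ∘ p)).Sat φ (fun a => (Sum.elim v x)
          (extend (fun a j => Sum.inl (e a j)) Sum.inr a 0)) ↔
        (transPre τ M (v ∘ p)).Sat φ (extend (fun a => v (e a 0)) (x 0))) := by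
      intro x
      refine iff_of_eq (congrArg _ ?_)
      have := extend_comp (fun g : Fin 1 → V ⊕ Fin 1 => Sum.elim v x (g 0))
        (fun a j => Sum.inl (e a j)) Sum.inr
      exact this
    have key2 : ∀ x : Fin 1 → M, (τ.dom.Realize
        (Sum.elim v x ∘ Sum.elim Sum.inr (Sum.inl ∘ p)) ↔ (transPre τ M (v ∘ p)).dom (x 0)) := by
      intro x
      refine iff_of_eq (congrArg _ ?_)
      funext a
      rcases a with i | i
      · rw [Subsingleton.elim i 0]; rfl
      · rfl
    constructor
    · intro h x hx
      exact (key fun _ => x).1 (h (fun _ => x) ((key2 fun _ => x).2 hx))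
    · intro h x hx
      exact (key x).2 (h (x 0) ((key2 x).1 hx))

theorem realize_transl_sentence {k : ℕ} (τ : Translation K L 1 k) {M : Type w} [L.Structure M]
    (φ : K.Sentence) (v : Fin k → M) :
    (τ.sentence φ).Realize v ↔ (transPre τ M v).SatF φ Empty.elim := by
  rw [Translation.sentence, realize_formula]
  refine iff_of_eq (congrArg _ ?_)
  funext a
  rcases a with a | i
  · exact a.elim
  · exact i.elim0

/-- The class of nonempty models of a theory. -/
def IsModel {L : FirstOrder.Language.{u, v}} (T : L.Theory) (M : Type w) [L.Structure M] : Prop :=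
  Nonempty M ∧ M ⊨ T

theorem satF_eqAxioms_of_presents {H : Type*} {A : Pre K H} {N : Type*} [K.Structure N] {f : H → N}
    (h : A.Presents N f) {φ : K.Sentence} (hφ : φ ∈ eqAxioms K) : A.SatF φ Empty.elim := by
  rw [h.sentence_iff]
  rcases hφ with (rfl | rfl | rfl) | ⟨n, R, i, rfl⟩
  · simp [eqRefl, Sentence.Realize, Formula.Realize]
  · simp only [eqSymm, Sentence.Realize, Formula.Realize, BoundedFormula.realize_all,
      BoundedFormula.realize_imp, BoundedFormula.realize_bdEqual]
    intro x y h
    exact h.symm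
  · simp only [eqTrans, Sentence.Realize, Formula.Realize, BoundedFormula.realize_all,
      BoundedFormula.realize_imp, BoundedFormula.realize_bdEqual]
    intro x y z h h'
    exact h.trans h'
  · rw [eqCongr, Sentence.Realize, BoundedFormula.realize_alls]
    intro xs
    simp only [BoundedFormula.realize_imp, BoundedFormula.realize_bdEqual,
      BoundedFormula.realize_rel, Function.comp_apply, Term.realize_var, Sum.elim_inr]
    intro heq hR
    convert hR using 2 with j
    by_cases hj : j = i
    · subst hj; simp [heq]
    · simp [Function.update_of_ne hj]

/-- An interpretation of theories acts on the models in `Type (max u v)`, truth in which is what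
`⊨ᵇ` means. -/
theorem interp_of_interpretsDim {T : L.Theory} {U : K.Theory} (h : InterpretsDim 1 T U) :
    Interp.{u, v, max u v, u₁, v₁} (IsModel T) (IsModel U) := by
  obtain ⟨k, τ, hτ⟩ := h
  refine ⟨Fin k, inferInstance, Tr.ofTranslation τ, fun M _ ⟨_, hM⟩ => ⟨?_, fun p hp => ?_⟩⟩
  · have := hτ.exists_param.realize_sentence M
    rw [Sentence.Realize, Formula.realize_iExs] at this
    obtain ⟨p, hp⟩ := this
    rw [Formula.realize_relabel] at hp
    exact ⟨p, hp⟩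
  · have hne := hτ.dom_nonempty.realize_formula M (v := p)
    rw [Formula.realize_imp, Formula.realize_iExs] at hne
    obtain ⟨x, hx⟩ := hne hp
    have hax : ∀ φ ∈ U ∪ eqAxioms K, (transPre τ M p).SatF φ Empty.elim := by
      intro φ hφ
      have := (hτ.axioms_hold φ hφ).realize_formula M (v := p)
      rw [Formula.realize_imp, realize_transl_sentence] at this
      exact this hp
    obtain ⟨N, _, hN, f, hf⟩ := Pre.exists_presents (A := transPre τ M p) ⟨x 0, by
      rw [Formula.realize_relabel] at hx
      refine (iff_of_eq (congrArg τ.dom.Realize ?_)).2 hx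
      funext a
      rcases a with i | i
      · rw [Subsingleton.elim i 0]; rfl
      · rfl⟩ (fun φ hφ => hax φ (Or.inr hφ))
    rw [Tr.ofTranslation_pre]
    exact ⟨N, _, f, ⟨hN, ⟨fun φ hφ => (hf.sentence_iff φ).1 (hax φ (Or.inl hφ))⟩⟩, hf⟩

/-- Conversely, an interpretation between the classes of models yields one of theories. Only
models in `Type (max u v)` have to be considered, as these are the ones in the definition of `⊨ᵇ`.
-/
theorem interpretsDim_of_interp {T : L.Theory} {U : K.Theory}
    (h : Interp.{u, v, max u v, u₁, v₁} (IsModel T) (IsModel U)) : InterpretsDim 1 T U := by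
  obtain ⟨ι, _, τ, hτ⟩ := h
  obtain ⟨k, ⟨g⟩⟩ := Finite.exists_equiv_fin ι
  obtain ⟨τ, hτ⟩ : ∃ τ' : Tr K L (Fin k), ∀ (M : Type max u v) [L.Structure M], IsModel T M →
      (∃ p : Fin k → M, τ'.par.Realize p) ∧ ∀ p : Fin k → M, τ'.par.Realize p →
      ∃ (N : Type max u v) (_ : K.Structure N) (f : M → N), IsModel U N ∧
        (τ'.pre M p).Presents N f := by
    obtain ⟨τ', hτ'⟩ := UPre.exists_tr
      (B := fun (M : Type max u v) _ (p : Fin k → M) => τ.pre M (fun i => p (g i)))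
      ⟨fun g' a => τ.upre.dom _ _, fun _ _ _ => τ.upre.eq _ _ _, fun _ _ _ => τ.upre.rel _ _ _⟩
      ((UD.ofFormula τ.par).relabel g)
    refine ⟨τ', fun M _ hM => ⟨?_, fun p hp => ?_⟩⟩
    · obtain ⟨p, hp⟩ := (hτ M hM).1
      refine ⟨p ∘ g.symm, (hτ' M _).1.2 ?_⟩
      simpa using hp
    · rw [(hτ' M p).2]
      exact (hτ M hM).2 _ ((hτ' M p).1.1 hp)
  refine ⟨k, τ.toTranslation, ⟨?_, ?_, ?_⟩⟩
  · rw [Theory.models_sentence_iff]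
    intro M
    obtain ⟨p, hp⟩ := (hτ M ⟨inferInstance, M.is_model⟩).1
    rw [Sentence.Realize, Formula.realize_iExs]
    refine ⟨p, ?_⟩
    rw [Formula.realize_relabel]
    exact hp
  · rw [Theory.models_formula_iff]
    intro M p
    rw [Formula.realize_imp, Formula.realize_iExs]
    intro hp
    obtain ⟨N, _, f, ⟨⟨y⟩, _⟩, hf⟩ := (hτ M ⟨inferInstance, M.is_model⟩).2 p hp
    obtain ⟨x, hx, -⟩ := hf.surj y
    refine ⟨fun _ => x, ?_⟩
    rw [← Tr.transPre_toTranslation] at hx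
    rw [Formula.realize_relabel]
    refine (iff_of_eq (congrArg τ.toTranslation.dom.Realize ?_)).1 hx
    funext a; cases a <;> rfl
  · intro φ hφ
    rw [Theory.models_formula_iff]
    intro M p
    rw [Formula.realize_imp, realize_transl_sentence, Tr.transPre_toTranslation]
    intro hp
    obtain ⟨N, _, f, ⟨_, hU⟩, hf⟩ := (hτ M ⟨inferInstance, M.is_model⟩).2 p hp
    rcases hφ with hφ | hφ
    · exact (hf.sentence_iff φ).2 (hU.realize_of_mem φ hφ)
    · exact satF_eqAxioms_of_presents hf hφ

end Theories

/-! ### Adjoining classes to an interpreted structure -/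

section Adjoin

theorem comp_vec₁ {A B : Type*} (f : A → B) (x : A) : f ∘ ![x] = ![f x] := by
  funext i; fin_cases i; rfl

theorem comp_vec₂ {A B : Type*} (f : A → B) (x y : A) : f ∘ ![x, y] = ![f x, f y] := by
  funext i; fin_cases i <;> rfl

theorem UD.rel₁ {K : FirstOrder.Language.{u₁, v₁}} {V : Type} (R : K.Relations 1) (a : V) :
    UD.{w} K fun N _ (v : V → N) => RelMap R ![v a] :=
  (UD.rel R ![a]).congr fun N _ v => by
    rw [show (fun i => v (![a] i)) = ![v a] from comp_vec₁ v a]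

theorem UD.rel₂ {K : FirstOrder.Language.{u₁, v₁}} {V : Type} (R : K.Relations 2) (a b : V) :
    UD.{w} K fun N _ (v : V → N) => RelMap R ![v a, v b] :=
  (UD.rel R ![a, b]).congr fun N _ v => by
    rw [show (fun i => v (![a, b] i)) = ![v a, v b] from comp_vec₂ v a b]

/-- The predicates of the language `K`, a unary predicate for the added classes, and a binary one
for membership in a class. -/
inductive AdjRel (K : FirstOrder.Language.{u₁, v₁}) : ℕ → Type v₁
  | old {n : ℕ} (R : K.Relations n) : AdjRel K n
  | newc : AdjRel K 1
  | memc : AdjRel K 2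

/-- The language of structures for `K` with added classes. -/
abbrev adjLang (K : FirstOrder.Language.{u₁, v₁}) : FirstOrder.Language.{0, v₁} :=
  ⟨fun _ => Empty, AdjRel K⟩

instance (K : FirstOrder.Language.{u₁, v₁}) : (adjLang K).IsRelational :=
  fun _ => inferInstanceAs (IsEmpty Empty)

variable (K : FirstOrder.Language.{u₁, v₁}) {G : Type w} [(adjLang K).Structure G]

/-- `x` is one of the added classes. -/
def Newc (x : G) : Prop := RelMap (L := adjLang K) AdjRel.newc ![x]

/-- The element `x` belongs to the added class `X`. -/
def Memc (x X : G) : Prop := RelMap (L := adjLang K) AdjRel.memc ![x, X]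

variable (G) in
/-- The structure for `K` on the elements that are not added classes. -/
def oldPre : Pre K G where
  dom x := ¬ Newc K x
  eq x y := x = y
  rel R x := RelMap (L := adjLang K) (AdjRel.old R) x

variable {K}

/-- A structure from `𝒟` with an adjunctive family of classes of its elements added. -/
structure Adj (𝒟 : ∀ (N : Type w) [K.Structure N], Prop) (G : Type w) [(adjLang K).Structure G] :
    Prop where
  old : ∃ (N : Type w) (_ : K.Structure N) (f : G → N), 𝒟 N ∧ (oldPre K G).Presents N f
  empty : ∃ X : G, Newc K X ∧ ∀ x : G, ¬ Newc K x → ¬ Memc K x X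
  adjoin : ∀ X x : G, Newc K X → ¬ Newc K x →
    ∃ Y, Newc K Y ∧ ∀ y : G, ¬ Newc K y → (Memc K y Y ↔ Memc K y X ∨ y = x)

theorem UD.newc {V : Type} (a : V) : UD.{w} (adjLang K) fun N _ (v : V → N) => Newc K (v a) :=
  UD.rel₁ (K := adjLang K) AdjRel.newc a

theorem UD.memc {V : Type} (a b : V) :
    UD.{w} (adjLang K) fun N _ (v : V → N) => Memc K (v a) (v b) :=
  UD.rel₂ (K := adjLang K) AdjRel.memc a b

theorem oldPre_upre {V : Type} :
    UPre (adjLang K) fun (N : Type w) _ (_ : V → N) => oldPre K N where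
  dom _ a := UD.not (UD.newc a)
  eq _ a b := UD.eq a b
  rel R _ a := UD.rel (K := adjLang K) (AdjRel.old R) a

/-- The structure with full domain and genuine equality that has the predicates of `A`. -/
abbrev Pre.str [K.IsRelational] {H : Type w} (A : Pre K H) : K.Structure H where
  funMap f := isEmptyElim f
  RelMap R x := A.rel R x

theorem Pre.presents_str [K.IsRelational] {H : Type w} (A : Pre K H) (hd : ∀ x, A.dom x)
    (he : ∀ x y, A.eq x y ↔ x = y) : @Pre.Presents _ _ A H A.str id :=
  letI := A.str
  { surj := fun y => ⟨y, hd y, rfl⟩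
    eq_iff := fun _ _ => he _ _
    rel_iff := fun _ _ _ => Iff.rfl }

/-- The part of a structure with genuine equality that is given by the domain of `A`. -/
abbrev Pre.subStr [K.IsRelational] {H : Type w} (A : Pre K H) : K.Structure {x // A.dom x} where
  funMap f := isEmptyElim f
  RelMap R x := A.rel R (fun i => (x i).1)

open Classical in
theorem Pre.presents_subStr [K.IsRelational] {H : Type w} (A : Pre K H)
    (he : ∀ x y, A.eq x y ↔ x = y) (x₀ : {x // A.dom x}) :
    @Pre.Presents _ _ A _ A.subStr fun x => if hx : A.dom x then ⟨x, hx⟩ else x₀ :=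
  letI := A.subStr
  { surj := fun y => ⟨y, y.2, dif_pos y.2⟩
    eq_iff := fun {x y} hx hy => by
      rw [he, dif_pos hx, dif_pos hy, Subtype.mk.injEq]
    rel_iff := fun {n} R x hx => by
      refine iff_of_eq (congrArg (A.rel R) ?_)
      funext i
      simp [hx i] }

end Adjoin

section AdjunctiveClassModels

variable {L : FirstOrder.Language.{u, v}} [L.IsRelational]

/-- The objects of a model of `AC(T)`, with the predicates of `T`. -/
def acObjPre (L : FirstOrder.Language.{u, v}) (G : Type w) [(flat (acSig L)).Structure G] :
    Pre L G where
  dom x := RelMap (L := flat (acSig L)) (FlatRel.isSort ACSort.obj) ![x]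
  eq x y := x = y
  rel R x := RelMap (L := flat (acSig L)) (FlatRel.of (ACRel.base R)) x

theorem realize_inSort {S : Type} {σ : SortedSig.{v} S} {α : Type*} {n : ℕ} {G : Type w}
    [(flat σ).Structure G] (s : S) (t : (flat σ).Term (α ⊕ Fin n)) (e : α → G) (xs : Fin n → G) :
    (inSort σ s t).Realize e xs ↔
      RelMap (L := flat σ) (FlatRel.isSort s) ![t.realize (Sum.elim e xs)] := by
  rw [inSort, BoundedFormula.realize_rel]
  refine iff_of_eq (congrArg _ ?_)
  funext i; fin_cases i; rfl

theorem realize_atom {S : Type} {σ : SortedSig.{v} S} {α : Type*} {n l : ℕ} {G : Type w}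
    [(flat σ).Structure G] (R : σ.Rel l) (ts : Fin l → (flat σ).Term (α ⊕ Fin n)) (e : α → G)
    (xs : Fin n → G) : (atom R ts).Realize e xs ↔
      RelMap (L := flat σ) (FlatRel.of R) (fun i => (ts i).realize (Sum.elim e xs)) := by
  rw [atom, BoundedFormula.realize_rel]

theorem realize_acMem {L : FirstOrder.Language.{u, v}} {G : Type w}
    [(flat (acSig L)).Structure G] {α : Type*} {n : ℕ}
    (x X : (flat (acSig L)).Term (α ⊕ Fin n)) (e : α → G) (xs : Fin n → G) :
    (acMem L x X).Realize e xs ↔ RelMap (L := flat (acSig L)) (FlatRel.of ACRel.mem)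
      ![x.realize (Sum.elim e xs), X.realize (Sum.elim e xs)] := by
  rw [acMem, realize_atom]
  refine iff_of_eq (congrArg _ ?_)
  funext i; fin_cases i <;> rfl

/-- Relativized formulas speak about the structure of the objects. -/
theorem realize_relativize {G : Type w} [(flat (acSig L)).Structure G] {α : Type*} :
    ∀ {n : ℕ} (φ : L.BoundedFormula α n) (e : α → G) (xs : Fin n → G),
      (relativize (acSig L) ACRel.base .obj φ).Realize e xs ↔
        (acObjPre L G).Sat φ (Sum.elim e xs) := by
  intro n φ
  induction φ with
  | falsum => intro e xs; exact Iff.rfl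
  | equal t₁ t₂ => intro e xs; exact Iff.rfl
  | rel R ts => intro e xs; exact Iff.rfl
  | imp φ ψ ih₁ ih₂ =>
    intro e xs
    simp only [relativize, BoundedFormula.realize_imp, Pre.Sat, ih₁, ih₂]
  | all φ ih =>
    intro e xs
    simp only [relativize, allS, BoundedFormula.realize_all, BoundedFormula.realize_imp, Pre.Sat,
      ih, realize_inSort]
    refine forall_congr' fun x => ?_
    have : extend (Sum.elim e xs) x = Sum.elim e (Fin.snoc xs x) := rfl
    rw [this]
    simp [acObjPre]

variable {T : L.Theory}

/-- A model of `AC(T)` read as a model of `T` with classes added. -/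
def acAdjPre (L : FirstOrder.Language.{u, v}) (G : Type w) [(flat (acSig L)).Structure G] :
    Pre (adjLang L) G where
  dom _ := True
  eq x y := x = y
  rel R x := match R with
    | .old R => RelMap (L := flat (acSig L)) (FlatRel.of (ACRel.base R)) x
    | .newc => RelMap (L := flat (acSig L)) (FlatRel.isSort ACSort.cls) x
    | .memc => RelMap (L := flat (acSig L)) (FlatRel.of ACRel.mem) x

/-- The sorts of a model of `AC(T)` being complementary, the objects are the elements that are not
classes. -/
theorem adj_of_isModel_AC {G : Type w} [(flat (acSig L)).Structure G] (h : IsModel (AC T) G) :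
    @Adj L (IsModel T) G (acAdjPre L G).str := by
  let sort : ACSort → G → Prop := fun s x => RelMap (L := flat (acSig L)) (FlatRel.isSort s) ![x]
  have hcover : ∀ x : G, ∃ s, sort s x := by
    have := h.2.realize_of_mem _ (Or.inl (Or.inl (Or.inl (Or.inl (Or.inl rfl)))) : _ ∈ AC T)
    simp only [Sentence.Realize, Formula.Realize, BoundedFormula.realize_all,
      BoundedFormula.realize_iSup, realize_inSort] at this
    exact this
  have hdisj : ∀ (x : G), sort .obj x → ¬ sort .cls x := by
    have := h.2.realize_of_mem _ (Or.inl (Or.inl (Or.inl (Or.inl (Or.inr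
      ⟨.obj, .cls, by simp, rfl⟩)))) : _ ∈ AC T)
    simp only [Sentence.Realize, Formula.Realize, BoundedFormula.realize_all,
      BoundedFormula.realize_not, BoundedFormula.realize_inf, realize_inSort, not_and] at this
    exact this
  have hobj : ∃ x, sort .obj x := by
    have := h.2.realize_of_mem _ (Or.inl (Or.inl (Or.inl (Or.inr ⟨.obj, rfl⟩))) : _ ∈ AC T)
    simp only [Sentence.Realize, Formula.Realize, BoundedFormula.realize_ex,
      realize_inSort] at this
    exact this
  have hempty : ∃ X, sort .cls X ∧ ∀ x, sort .obj x →
      ¬ RelMap (L := flat (acSig L)) (FlatRel.of ACRel.mem) ![x, X] := by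
    have := h.2.realize_of_mem _ (Or.inr (Or.inl rfl) : _ ∈ AC T)
    simp only [acEmpty, exS, allS, Sentence.Realize, Formula.Realize, BoundedFormula.realize_ex,
      BoundedFormula.realize_inf, BoundedFormula.realize_all, BoundedFormula.realize_imp,
      BoundedFormula.realize_not, realize_inSort, realize_acMem] at this
    exact this
  have hadj : ∀ X, sort .cls X → ∀ x, sort .obj x → ∃ Y, sort .cls Y ∧ ∀ y, sort .obj y →
      (RelMap (L := flat (acSig L)) (FlatRel.of ACRel.mem) ![y, Y] ↔
        RelMap (L := flat (acSig L)) (FlatRel.of ACRel.mem) ![y, X] ∨ y = x) := by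
    have := h.2.realize_of_mem _ (Or.inr (Or.inr rfl) : _ ∈ AC T)
    simp only [acAdj, exS, allS, Sentence.Realize, Formula.Realize, BoundedFormula.realize_ex,
      BoundedFormula.realize_inf, BoundedFormula.realize_all, BoundedFormula.realize_imp,
      BoundedFormula.realize_sup, BoundedFormula.realize_iff, BoundedFormula.realize_bdEqual,
      realize_inSort, realize_acMem] at this
    exact this
  have hiff : ∀ x, ¬ sort .cls x ↔ sort .obj x := by
    intro x
    constructor
    · intro hx
      obtain ⟨s, hs⟩ := hcover x
      cases s
      · exact hs
      · exact absurd hs hx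
    · exact hdisj x
  let _ := (acAdjPre L G).str
  have hnew : ∀ x : G, Newc L x ↔ sort .cls x := fun x => Iff.rfl
  refine ⟨?_, ?_, ?_⟩
  · obtain ⟨x₀, hx₀⟩ := hobj
    let _ := (acObjPre L G).subStr
    have hp := (acObjPre L G).presents_subStr (fun x y => Iff.rfl) ⟨x₀, hx₀⟩
    refine ⟨{x // (acObjPre L G).dom x}, inferInstance, _, ⟨⟨⟨x₀, hx₀⟩⟩, ⟨fun φ hφ => ?_⟩⟩,
      hp.congr (fun x => hiff x) (fun _ _ _ _ => Iff.rfl) (fun _ _ _ => Iff.rfl)⟩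
    rw [← hp.sentence_iff]
    have := h.2.realize_of_mem _ (Or.inl (Or.inr ⟨φ, hφ, rfl⟩) : _ ∈ AC T)
    rw [Sentence.Realize, Formula.Realize, realize_relativize] at this
    exact (iff_of_eq (congrArg _ (Subsingleton.elim _ _))).1 this
  · obtain ⟨X, hX, hX'⟩ := hempty
    exact ⟨X, hX, fun x hx => hX' x ((hiff x).1 hx)⟩
  · intro X x hX hx
    obtain ⟨Y, hY, hY'⟩ := hadj X hX x ((hiff x).1 hx)
    exact ⟨Y, hY, fun y hy => hY' y ((hiff y).1 hy)⟩

theorem interp_adj_of_interp_AC {K : FirstOrder.Language.{u₁, v₁}}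
    {𝒞 : ∀ (N : Type w) [K.Structure N], Prop} (h : Interp 𝒞 (IsModel (AC T))) :
    Interp 𝒞 (Adj (IsModel T)) := by
  refine h.trans (Interp.of_upre (ι := Empty) (B := fun N _ _ => acAdjPre L N)
    ⟨fun _ _ => UD.tt, fun _ a b => UD.eq a b, fun R _ a => ?_⟩
    UD.tt fun G _ hG => ⟨⟨Empty.elim, trivial⟩, ?_⟩)
  · cases R
    · exact UD.rel (K := flat (acSig L)) _ a
    · exact UD.rel (K := flat (acSig L)) _ a
    · exact UD.rel (K := flat (acSig L)) _ a
  · intro _ _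
    exact ⟨G, _, id, adj_of_isModel_AC hG,
      (acAdjPre L G).presents_str (fun _ => trivial) fun _ _ => Iff.rfl⟩

end AdjunctiveClassModels

section Functor

variable {L : FirstOrder.Language.{u, v}} [L.IsRelational] {K : FirstOrder.Language.{u₁, v₁}}

/-- The translation `τ`, applied to the elements that are not added classes, with the added classes
kept as classes of elements of the domain of `τ`, read modulo the equality of `τ`. -/
def adjPre {ι : Type} (τ : Tr K L ι) (G : Type w) [(adjLang L).Structure G] (p : ι → G) :
    Pre (adjLang K) G where
  dom x := ((oldPre L G).comp τ p).dom x ∨ Newc L x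
  eq x y := (Newc L x ∧ x = y) ∨
    (¬ Newc L x ∧ ¬ Newc L y ∧ ((oldPre L G).comp τ p).eq x y)
  rel R x := match R with
    | .old R => (∀ i, ¬ Newc L (x i)) ∧ ((oldPre L G).comp τ p).rel R x
    | .newc => Newc L (x 0)
    | .memc => ¬ Newc L (x 0) ∧ Newc L (x 1) ∧ ∃ z, ((oldPre L G).comp τ p).dom z ∧
        ((oldPre L G).comp τ p).eq z (x 0) ∧ Memc L z (x 1)

theorem adjPre_upre {ι : Type} (τ : Tr K L ι) :
    UPre (adjLang L) fun (G : Type w) _ (p : ι → G) => adjPre τ G p := by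
  have hB : UPre (adjLang L) fun (G : Type w) _ (p : Empty ⊕ ι → G) =>
    (oldPre L G).comp τ (fun i => p (.inr i)) := oldPre_upre.comp τ
  have hB' : UPre (adjLang L) fun (G : Type w) _ (p : ι → G) => (oldPre L G).comp τ p :=
    ⟨fun g a => hB.dom (Sum.elim Empty.elim g) a, fun g a b => hB.eq (Sum.elim Empty.elim g) a b,
      fun R g a => hB.rel R (Sum.elim Empty.elim g) a⟩
  refine ⟨fun g a => ?_, fun g a b => ?_, fun R g a => ?_⟩
  · exact UD.or (hB'.dom g a) (UD.newc a)
  · exact UD.or (UD.and (UD.newc a) (UD.eq a b))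
      (UD.and (UD.not (UD.newc a)) (UD.and (UD.not (UD.newc b)) (hB'.eq g a b)))
  · cases R with
    | old R =>
      exact UD.and (UD.forall_index fun i => UD.not (UD.newc (a i))) (hB'.rel R g a)
    | newc => exact UD.newc (a 0)
    | memc =>
      refine UD.and (UD.not (UD.newc (a 0))) (UD.and (UD.newc (a 1)) ?_)
      refine UD.ex (P := fun (G : Type w) _ (v : _ → G) z =>
          ((oldPre L G).comp τ (fun i => v (g i))).dom z ∧
        ((oldPre L G).comp τ (fun i => v (g i))).eq z (v (a 0)) ∧ Memc L z (v (a 1))) ?_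
      exact UD.and (hB'.dom (fun i => Sum.inl (g i)) _)
        (UD.and (hB'.eq (fun i => Sum.inl (g i)) _ (Sum.inl (a 0))) (UD.memc _ (Sum.inl (a 1))))

open Classical in
/-- Adjoining classes is functorial: an interpretation inside the objects extends to the structures
with adjoined classes. -/
theorem Interp.adj {𝒞 : ∀ (N : Type w) [L.Structure N], Prop}
    {𝒟 : ∀ (N : Type w) [K.Structure N], Prop} (h : Interp 𝒞 𝒟) : Interp (Adj 𝒞) (Adj 𝒟) := by
  obtain ⟨ι, _, τ, hτ⟩ := h
  have hB : UPre (adjLang L) fun (G : Type w) _ (_ : ι → G) => oldPre L G := oldPre_upre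
  refine Interp.of_upre (adjPre_upre τ) (P := fun G _ p => (∀ i, (oldPre L G).dom (p i)) ∧
    (oldPre L G).SatF τ.par p) ?_ fun G _ hG => ⟨?_, ?_⟩
  · exact UD.and (UD.forall_index fun i => hB.dom id i) (hB.satF τ.par id id)
  · obtain ⟨M, _, f, hM, hf⟩ := hG.old
    obtain ⟨p, hp⟩ := (hτ M hM).1
    choose q hq using fun i => hf.surj (p i)
    refine ⟨q, fun i => (hq i).1, (hf.satF_iff _ fun i => (hq i).1).2 ?_⟩
    rwa [show f ∘ q = p from funext fun i => (hq i).2]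
  · rintro p ⟨hp, hp'⟩
    obtain ⟨M, _, f, hM, hf⟩ := hG.old
    obtain ⟨N, _, f', hN, hf'⟩ := (hτ M hM).2 _ ((hf.satF_iff _ hp).1 hp')
    set B := (oldPre L G).comp τ p with hBdef
    have hB := hf.comp hp hf'
    rw [← hBdef] at hB
    set g : G → N := f' ∘ f
    have hold : ∀ {x}, B.dom x → ¬ Newc L x := fun hx => hx.1
    -- the quotient of the old part, with the added classes
    let A : Pre (adjLang K) (N ⊕ {x : G // Newc L x}) :=
      { dom := fun _ => True
        eq := fun x y => x = y
        rel := fun {n} R x => match R with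
          | .old R => ∃ y : _ → N, (∀ i, x i = .inl (y i)) ∧ RelMap R y
          | .newc => ∃ X, x 0 = .inr X
          | .memc => ∃ y X, x 0 = .inl y ∧ x 1 = .inr X ∧ ∃ z, B.dom z ∧ g z = y ∧ Memc L z X.1 }
    let _ := A.str
    have hnew : ∀ x : (N ⊕ {x : G // Newc L x}), Newc K x ↔ ∃ X, x = .inr X := fun x => Iff.rfl
    have hnew' : ∀ y : N, ¬ Newc K (.inl y : (N ⊕ {x : G // Newc L x})) := by
      intro y hy
      obtain ⟨X, hX⟩ := (hnew _).1 hy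
      simp at hX
    have hmem : ∀ (y : N) (X : {x : G // Newc L x}),
        Memc K (.inl y : (N ⊕ {x : G // Newc L x})) (.inr X) ↔
        ∃ z, B.dom z ∧ g z = y ∧ Memc L z X.1 := by
      intro y X
      constructor
      · rintro ⟨y', X', h1, h2, h3⟩
        obtain rfl := Sum.inl.inj h1
        obtain rfl := Sum.inr.inj h2
        exact h3
      · intro h3
        exact ⟨y, X, rfl, rfl, h3⟩
    let F : G → (N ⊕ {x : G // Newc L x}) := fun x =>
      if hx : Newc L x then .inr ⟨x, hx⟩ else .inl (g x)
    have F1 : ∀ {x} (hx : Newc L x), F x = .inr ⟨x, hx⟩ := fun hx => dif_pos hx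
    have F2 : ∀ {x}, ¬ Newc L x → F x = .inl (g x) := fun hx => dif_neg hx
    refine ⟨(N ⊕ {x : G // Newc L x}), inferInstance, F, ⟨?_, ?_, ?_⟩, ⟨?_, ?_, ?_⟩⟩
    · obtain ⟨y₀, -⟩ := hf'.surj (g (hG.empty.choose))
      refine ⟨N, ‹_›, fun x => x.elim id fun _ => g (hG.empty.choose), hN, ⟨?_, ?_, ?_⟩⟩
      · intro y
        exact ⟨.inl y, hnew' y, rfl⟩
      · rintro (x | X) (y | Y) hx hy
        · simp [oldPre]
        · exact absurd ⟨Y, rfl⟩ hy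
        · exact absurd ⟨X, rfl⟩ hx
        · exact absurd ⟨Y, rfl⟩ hy
      · intro n R x hx
        have hx' : ∀ i, ∃ y, x i = .inl y := by
          intro i
          rcases hxi : x i with y | X
          · exact ⟨y, rfl⟩
          · exact absurd ⟨X, hxi⟩ (hx i)
        choose y hy using hx'
        have hxy : (fun x : (N ⊕ {x : G // Newc L x}) =>
            x.elim id fun _ => g (hG.empty.choose)) ∘ x = y := by
          funext i; simp [hy i]
        rw [hxy]
        constructor
        · rintro ⟨y', hy', hR⟩
          have : y = y' := by
            funext i
            have := (hy i).symm.trans (hy' i)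
            exact Sum.inl.inj this
          rwa [this]
        · intro hR
          exact ⟨y, hy, hR⟩
    · obtain ⟨X, hX, hX'⟩ := hG.empty
      refine ⟨.inr ⟨X, hX⟩, ⟨_, rfl⟩, ?_⟩
      rintro (y | Y) hy
      · rw [hmem]
        rintro ⟨z, hz, -, hm⟩
        exact hX' z (hold hz) hm
      · exact absurd ⟨Y, rfl⟩ hy
    · rintro (X | X) (x | x) hX hx
      · exact absurd hX (hnew' X)
      · exact absurd hX (hnew' X)
      · obtain ⟨x, hxd, rfl⟩ := hB.surj x
        obtain ⟨Y, hY, hY'⟩ := hG.adjoin X.1 x X.2 (hold hxd)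
        refine ⟨.inr ⟨Y, hY⟩, ⟨_, rfl⟩, ?_⟩
        rintro (y | Z) hy
        · rw [hmem, hmem, Sum.inl.injEq]
          constructor
          · rintro ⟨z, hz, rfl, hm⟩
            rcases (hY' z (hold hz)).1 hm with hm | rfl
            · exact Or.inl ⟨z, hz, rfl, hm⟩
            · exact Or.inr rfl
          · rintro (⟨z, hz, rfl, hm⟩ | rfl)
            · exact ⟨z, hz, rfl, (hY' z (hold hz)).2 (Or.inl hm)⟩
            · exact ⟨x, hxd, rfl, (hY' x (hold hxd)).2 (Or.inr rfl)⟩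
        · exact absurd ⟨Z, rfl⟩ hy
      · exact absurd ⟨x, rfl⟩ hx
    · rintro (y | X)
      · obtain ⟨x, hx, rfl⟩ := hB.surj y
        exact ⟨x, Or.inl hx, F2 (hold hx)⟩
      · exact ⟨X.1, Or.inr X.2, F1 X.2⟩
    · intro x y hx hy
      by_cases h1 : Newc L x <;> by_cases h2 : Newc L y
      · simp [adjPre, F1 h1, F1 h2, h1]
      · have : x ≠ y := by rintro rfl; exact h2 h1
        simp [adjPre, F1 h1, F2 h2, h1, this]
      · simp [adjPre, F2 h1, F1 h2, h1, h2]
      · have hx' := hx.resolve_right h1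
        have hy' := hy.resolve_right h2
        have := hB.eq_iff hx' hy'
        simp [adjPre, F2 h1, F2 h2, h1, h2, ← hBdef, this]
    · intro n R x hx
      cases R with
      | old R =>
        constructor
        · rintro ⟨hn, hR⟩
          exact ⟨g ∘ x, fun i => F2 (hn i),
            (hB.rel_iff R fun i => (hx i).resolve_right (hn i)).1 hR⟩
        · rintro ⟨y, hy, hR⟩
          have hn : ∀ i, ¬ Newc L (x i) := by
            intro i hi
            have := hy i
            rw [Function.comp, F1 hi] at this
            simp at this
          refine ⟨hn, (hB.rel_iff R fun i => (hx i).resolve_right (hn i)).2 ?_⟩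
          have : g ∘ x = y := by
            funext i
            have := hy i
            rw [Function.comp, F2 (hn i)] at this
            exact Sum.inl.inj this
          rwa [this]
      | newc =>
        constructor
        · intro h0
          exact ⟨⟨_, h0⟩, F1 h0⟩
        · rintro ⟨X, hX⟩
          by_contra h0
          rw [Function.comp, F2 h0] at hX
          simp at hX
      | memc =>
        constructor
        · rintro ⟨h0, h1, z, hz, hz0, hm⟩
          exact ⟨g (x 0), ⟨x 1, h1⟩, F2 h0, F1 h1, z, hz,
            (hB.eq_iff hz ((hx 0).resolve_right h0)).1 hz0, hm⟩
        · rintro ⟨y, X, hy, hX, z, hz, rfl, hm⟩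
          have h0 : ¬ Newc L (x 0) := by
            intro h0
            rw [Function.comp, F1 h0] at hy
            simp at hy
          have h1 : Newc L (x 1) := by
            by_contra h1
            rw [Function.comp, F2 h1] at hX
            simp at hX
          rw [Function.comp, F2 h0] at hy
          rw [Function.comp, F1 h1] at hX
          obtain rfl := Sum.inr.inj hX
          exact ⟨h0, h1, z, hz, (hB.eq_iff hz ((hx 0).resolve_right h0)).2 (Sum.inl.inj hy).symm,
            hm⟩

end Functor

/-! ### Self-interpretations that omit an element -/

section Shrinking

variable {L : FirstOrder.Language.{u, v}}

/-- The translation `τ` defines in every model of `T`, from suitable parameters, a model of `T` that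
omits some element. -/
def Tr.Shrinks {ι : Type} (τ : Tr L L ι) (T : L.Theory) : Prop :=
  ∀ (M : Type w) [L.Structure M], IsModel T M →
    ∃ (p : ι → M) (N : Type w) (_ : L.Structure N) (f : M → N), IsModel T N ∧
      (τ.pre M p).Presents N f ∧ ∃ z, ¬ (τ.pre M p).dom z

/-- A model with classes contains a model, its objects, that omits some element, namely a class. -/
theorem exists_shrinks {T : L.Theory} (h : Interp.{u, v, w, 0, v} (IsModel T) (Adj (IsModel T))) :
    ∃ (ι : Type) (_ : Finite ι) (τ : Tr L L ι), Tr.Shrinks.{u, v, w} τ T := by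
  obtain ⟨ι, _, τ, hτ⟩ := h
  obtain ⟨σ, hσ⟩ := UPre.exists_tr (ι := Empty) (B := fun (N : Type w) _ _ => oldPre L N)
    oldPre_upre UD.tt
  obtain ⟨ρ, hρ⟩ := UPre.exists_tr (UPre.comp (Tr.upre.{u, v, w, 0, v} τ) σ) UD.tt
  refine ⟨_, inferInstance, ρ, fun M _ hM => ?_⟩
  obtain ⟨p, hp⟩ := (hτ M hM).1
  obtain ⟨G, _, f, hG, hf⟩ := (hτ M hM).2 p hp
  obtain ⟨N, _, f', hN, hf'⟩ := hG.old
  rw [← (hσ G (f ∘ Empty.elim)).2] at hf'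
  refine ⟨Sum.elim p Empty.elim, N, _, f' ∘ f, hN, ?_, ?_⟩
  · rw [(hρ M _).2]
    exact hf.comp (fun i => i.elim) hf'
  · obtain ⟨X, hX, -⟩ := hG.empty
    obtain ⟨c, hc, rfl⟩ := hf.surj X
    refine ⟨c, ?_⟩
    rw [(hρ M _).2]
    intro hc'
    have hc'' := ((hf.comp_dom_iff σ (p := Empty.elim) fun i => i.elim).1 hc').2
    rw [(hσ G _).2] at hc''
    exact hc'' hX

end Shrinking

/-! ### Finite relations on a model with classes -/

section FiniteRelations

/-- The predicates of a structure with objects, classes of objects, and codes, where codes stand for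
sets of `r`-tuples of objects and classes. -/
inductive HRel (L : FirstOrder.Language.{u, v}) (r : ℕ) : ℕ → Type v
  | base {n : ℕ} (R : L.Relations n) : HRel L r n
  | mem : HRel L r 2
  | obj : HRel L r 1
  | cls : HRel L r 1
  | code : HRel L r 1
  | tup : HRel L r (r + 1)

/-- The language of structures with objects, classes, and codes for sets of `r`-tuples. -/
abbrev hLang (L : FirstOrder.Language.{u, v}) (r : ℕ) : FirstOrder.Language.{0, v} :=
  ⟨fun _ => Empty, HRel L r⟩

instance (L : FirstOrder.Language.{u, v}) (r : ℕ) : (hLang L r).IsRelational :=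
  fun _ => inferInstanceAs (IsEmpty Empty)

/-- A structure for `hLang L r`, given by its predicates. -/
structure HData (L : FirstOrder.Language.{u, v}) (r : ℕ) (H : Type w) where
  base : ∀ {n : ℕ}, L.Relations n → (Fin n → H) → Prop
  mem : H → H → Prop
  obj : H → Prop
  cls : H → Prop
  code : H → Prop
  tup : H → (Fin r → H) → Prop

variable {L : FirstOrder.Language.{u, v}} {r : ℕ}

variable (L r) in
/-- The predicates of a structure for `hLang L r`. -/
def hData (H : Type w) [(hLang L r).Structure H] : HData L r H where
  base R x := RelMap (L := hLang L r) (HRel.base R) x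
  mem x y := RelMap (L := hLang L r) HRel.mem ![x, y]
  obj x := RelMap (L := hLang L r) HRel.obj ![x]
  cls x := RelMap (L := hLang L r) HRel.cls ![x]
  code x := RelMap (L := hLang L r) HRel.code ![x]
  tup k t := RelMap (L := hLang L r) HRel.tup (Fin.cons k t)

/-- A family of structures for `hLang L r`, on the structures for `K`, is uniformly definable. -/
structure UHData (K : FirstOrder.Language.{u₁, v₁})
    (D : ∀ (N : Type w) [K.Structure N], HData L r N) : Prop where
  base : ∀ {V : Type} {n : ℕ} (R : L.Relations n) (g : Fin n → V),
    UD K fun N _ (v : V → N) => (D N).base R (fun i => v (g i))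
  mem : ∀ {V : Type} (a b : V), UD K fun N _ (v : V → N) => (D N).mem (v a) (v b)
  obj : ∀ {V : Type} (a : V), UD K fun N _ (v : V → N) => (D N).obj (v a)
  cls : ∀ {V : Type} (a : V), UD K fun N _ (v : V → N) => (D N).cls (v a)
  code : ∀ {V : Type} (a : V), UD K fun N _ (v : V → N) => (D N).code (v a)
  tup : ∀ {V : Type} (a : V) (g : Fin r → V),
    UD K fun N _ (v : V → N) => (D N).tup (v a) (fun i => v (g i))

theorem uhData : UHData (hLang L r) fun (N : Type w) _ => hData L r N where
  base R g := UD.rel (K := hLang L r) (HRel.base R) g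
  mem a b := UD.rel₂ (K := hLang L r) HRel.mem a b
  obj a := UD.rel₁ (K := hLang L r) HRel.obj a
  cls a := UD.rel₁ (K := hLang L r) HRel.cls a
  code a := UD.rel₁ (K := hLang L r) HRel.code a
  tup a g := (UD.rel (K := hLang L r) HRel.tup (Fin.cons a g)).congr fun N _ v => by
    refine iff_of_eq (congrArg _ ?_)
    funext i
    refine Fin.cases ?_ (fun j => ?_) i <;> simp

theorem UD.all_old {K : FirstOrder.Language.{u₁, v₁}} {V : Type}
    {P : ∀ (N : Type w) [(adjLang K).Structure N], (V → N) → N → Prop}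
    (h : UD (adjLang K) fun N _ (w : V ⊕ Unit → N) =>
      P N (fun a => w (.inl a)) (w (.inr ()))) :
    UD (adjLang K) fun N _ (v : V → N) => ∀ x, ¬ Newc K x → P N v x :=
  UD.all (P := fun N _ v x => ¬ Newc K x → P N v x) (UD.imp (UD.not (UD.newc _)) h)

namespace HData

variable {H : Type w} (D : HData L r H)

/-- The structure for `hLang L r` with given predicates, full domain and genuine equality. -/
def pre : Pre (hLang L r) H where
  dom _ := True
  eq x y := x = y
  rel R x := match R with
    | .base R => D.base R x
    | .mem => D.mem (x 0) (x 1)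
    | .obj => D.obj (x 0)
    | .cls => D.cls (x 0)
    | .code => D.code (x 0)
    | .tup => D.tup (x 0) (Fin.tail x)

/-- A uniformly definable family of structures with objects, classes and codes is an
interpretation. -/
theorem interp {K : FirstOrder.Language.{u₁, v₁}} {D : ∀ (N : Type w) [K.Structure N], HData L r N}
    (hD : UHData K D) {𝒞 : ∀ (N : Type w) [K.Structure N], Prop}
    {P : ∀ {N : Type w}, HData L r N → Prop}
    (h : ∀ (N : Type w) [K.Structure N], 𝒞 N → P (D N)) :
    Interp 𝒞 fun (N : Type w) [(hLang L r).Structure N] => P (hData L r N) := by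
  refine Interp.of_upre (ι := Empty) (B := fun N _ _ => (D N).pre)
    ⟨fun _ _ => UD.tt, fun _ a b => UD.eq a b, fun R _ a => ?_⟩ UD.tt
    fun N _ hN => ⟨⟨Empty.elim, trivial⟩, fun _ _ => ⟨N, (D N).pre.str, id, h N hN,
      (D N).pre.presents_str (fun _ => trivial) fun _ _ => Iff.rfl⟩⟩
  cases R with
  | base R => exact hD.base R a
  | mem => exact hD.mem (a 0) (a 1)
  | obj => exact hD.obj (a 0)
  | cls => exact hD.cls (a 0)
  | code => exact hD.code (a 0)
  | tup => exact hD.tup (a 0) (Fin.tail a)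

/-- The structure for `L` on the objects. -/
def objPre : Pre L H where
  dom := D.obj
  eq x y := x = y
  rel R x := D.base R x

/-- `x` is an object or a class. -/
def elt (x : H) : Prop := D.obj x ∨ D.cls x

variable (T : L.Theory)

/-- The objects form a model of `T`, the classes are an adjunctive family of classes of objects, and
the codes are neither objects nor classes. -/
structure Core : Prop where
  not_cls : ∀ x, D.obj x → ¬ D.cls x
  not_code : ∀ x, D.elt x → ¬ D.code x
  model : ∃ (N : Type w) (_ : L.Structure N) (f : H → N), IsModel T N ∧ D.objPre.Presents N f
  cls_empty : ∃ X, D.cls X ∧ ∀ x, D.obj x → ¬ D.mem x X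
  cls_adjoin : ∀ X x, D.cls X → D.obj x →
    ∃ Y, D.cls Y ∧ ∀ y, D.obj y → (D.mem y Y ↔ D.mem y X ∨ y = x)

/-- Every `r`-tuple of objects and classes is the only one in the set of some code. -/
structure HasTuples : Prop extends D.Core T where
  tuple : ∀ t : Fin r → H, (∀ i, D.elt (t i)) →
    ∃ c, D.code c ∧ ∀ s : Fin r → H, (∀ i, D.elt (s i)) → (D.tup c s ↔ s = t)

/-- The codes stand for an adjunctive family of sets of `r`-tuples of objects and classes. -/
structure HasSets : Prop extends D.Core T where
  code_empty : ∃ k, D.code k ∧ ∀ t : Fin r → H, (∀ i, D.elt (t i)) → ¬ D.tup k t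
  code_adjoin : ∀ k (t : Fin r → H), D.code k → (∀ i, D.elt (t i)) →
    ∃ k', D.code k' ∧ ∀ s : Fin r → H, (∀ i, D.elt (s i)) → (D.tup k' s ↔ D.tup k s ∨ s = t)

end HData

variable {T : L.Theory}

theorem UHData.elt {K : FirstOrder.Language.{u₁, v₁}}
    {D : ∀ (N : Type w) [K.Structure N], HData L r N} (hD : UHData K D) {V : Type} (a : V) :
    UD K fun N _ (v : V → N) => (D N).elt (v a) :=
  UD.or (hD.obj a) (hD.cls a)

/-- The old predicates of a structure for `hLang L r` with classes added, on the whole of it. -/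
def oldData (L : FirstOrder.Language.{u, v}) (r : ℕ) (G : Type w)
    [(adjLang (hLang L r)).Structure G] : HData L r G where
  base R x := RelMap (L := adjLang (hLang L r)) (AdjRel.old (HRel.base R)) x
  mem x y := RelMap (L := adjLang (hLang L r)) (AdjRel.old HRel.mem) ![x, y]
  obj x := RelMap (L := adjLang (hLang L r)) (AdjRel.old HRel.obj) ![x]
  cls x := RelMap (L := adjLang (hLang L r)) (AdjRel.old HRel.cls) ![x]
  code x := RelMap (L := adjLang (hLang L r)) (AdjRel.old HRel.code) ![x]
  tup k t := RelMap (L := adjLang (hLang L r)) (AdjRel.old HRel.tup) (Fin.cons k t)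

theorem uoldData : UHData (adjLang (hLang L r)) fun (N : Type w) _ => oldData L r N where
  base R g := UD.rel (K := adjLang (hLang L r)) (AdjRel.old (HRel.base R)) g
  mem a b := UD.rel₂ (K := adjLang (hLang L r)) (AdjRel.old HRel.mem) a b
  obj a := UD.rel₁ (K := adjLang (hLang L r)) (AdjRel.old HRel.obj) a
  cls a := UD.rel₁ (K := adjLang (hLang L r)) (AdjRel.old HRel.cls) a
  code a := UD.rel₁ (K := adjLang (hLang L r)) (AdjRel.old HRel.code) a
  tup a g := (UD.rel (K := adjLang (hLang L r)) (AdjRel.old HRel.tup) (Fin.cons a g)).congr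
    fun N _ v => by
      refine iff_of_eq (congrArg _ ?_)
      funext i
      refine Fin.cases ?_ (fun j => ?_) i <;> simp

/-- Added classes become codes: the objects and classes are the old ones, the codes are the added
classes, and the predicate `tup` is `Θ`. -/
def codeData (L : FirstOrder.Language.{u, v}) (r : ℕ) {m : ℕ} (G : Type w)
    [(adjLang (hLang L r)).Structure G]
    (Θ : G → (Fin m → G) → Prop) : HData L m G where
  base := (oldData L r G).base
  mem := (oldData L r G).mem
  obj x := ¬ Newc (hLang L r) x ∧ (oldData L r G).obj x
  cls x := ¬ Newc (hLang L r) x ∧ (oldData L r G).cls x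
  code x := Newc (hLang L r) x
  tup := Θ

theorem ucodeData {m : ℕ}
    {Θ : ∀ (G : Type w) [(adjLang (hLang L r)).Structure G], G → (Fin m → G) → Prop}
    (hΘ : ∀ {V : Type} (a : V) (g : Fin m → V),
      UD (adjLang (hLang L r)) fun G _ (v : V → G) => Θ G (v a) (fun i => v (g i))) :
    UHData (adjLang (hLang L r)) fun (G : Type w) _ => codeData L r G (Θ G) where
  base R g := uoldData.base R g
  mem a b := uoldData.mem a b
  obj a := UD.and (UD.not (UD.newc a)) (uoldData.obj a)
  cls a := UD.and (UD.not (UD.newc a)) (uoldData.cls a)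
  code a := UD.newc a
  tup a g := hΘ a g

section Lift

variable {G : Type w} [(adjLang (hLang L r)).Structure G] {N : Type w} [(hLang L r).Structure N]
  {f : G → N}

theorem old_iff₁ (hf : (oldPre (hLang L r) G).Presents N f) (R : HRel L r 1) {x : G}
    (hx : ¬ Newc (hLang L r) x) : RelMap (L := adjLang (hLang L r)) (AdjRel.old R) ![x] ↔
      RelMap (L := hLang L r) R ![f x] := by
  rw [← comp_vec₁]
  refine hf.rel_iff (L := hLang L r) R fun i => ?_
  rw [Subsingleton.elim i 0]
  exact hx

theorem old_iff₂ (hf : (oldPre (hLang L r) G).Presents N f) (R : HRel L r 2) {x y : G}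
    (hx : ¬ Newc (hLang L r) x) (hy : ¬ Newc (hLang L r) y) :
    RelMap (L := adjLang (hLang L r)) (AdjRel.old R) ![x, y] ↔
      RelMap (L := hLang L r) R ![f x, f y] := by
  rw [← comp_vec₂]
  refine hf.rel_iff (L := hLang L r) R fun i => ?_
  fin_cases i
  · exact hx
  · exact hy

theorem old_tup_iff (hf : (oldPre (hLang L r) G).Presents N f) {k : G} {t : Fin r → G}
    (hk : ¬ Newc (hLang L r) k) (ht : ∀ i, ¬ Newc (hLang L r) (t i)) :
    (oldData L r G).tup k t ↔ (hData L r N).tup (f k) (f ∘ t) := by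
  have : (Fin.cons (f k) (f ∘ t) : Fin (r + 1) → N) = f ∘ (Fin.cons k t : Fin (r + 1) → G) := by
    funext i
    refine Fin.cases ?_ (fun j => ?_) i <;> simp
  simp only [hData, oldData]
  rw [this]
  refine hf.rel_iff (L := hLang L r) HRel.tup fun i => ?_
  refine Fin.cases ?_ (fun j => ?_) i
  · simpa [oldPre] using hk
  · simpa [oldPre] using ht j

theorem code_elt_iff {m : ℕ} (hf : (oldPre (hLang L r) G).Presents N f)
    {Θ : G → (Fin m → G) → Prop} {x : G} : (codeData L r G Θ).elt x ↔
      ¬ Newc (hLang L r) x ∧ (hData L r N).elt (f x) := by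
  by_cases hx : Newc (hLang L r) x
  · simp [codeData, HData.elt, hx]
  · have h1 := old_iff₁ hf HRel.obj hx
    have h2 := old_iff₁ hf HRel.cls hx
    simp only [codeData, HData.elt, oldData, hData, hx, h1, h2, not_false_eq_true, true_and]

/-- The objects and classes are untouched when added classes take the role of codes. -/
theorem core_codeData {m : ℕ} (hf : (oldPre (hLang L r) G).Presents N f)
    (h : (hData L r N).Core T) (Θ : G → (Fin m → G) → Prop) : (codeData L r G Θ).Core T := by
  have hobj : ∀ {x : G}, ¬ Newc (hLang L r) x → ((oldData L r G).obj x ↔ (hData L r N).obj (f x)) :=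
    fun hx => old_iff₁ hf HRel.obj hx
  have hcls : ∀ {x : G}, ¬ Newc (hLang L r) x → ((oldData L r G).cls x ↔ (hData L r N).cls (f x)) :=
    fun hx => old_iff₁ hf HRel.cls hx
  have hmem : ∀ {x y : G}, ¬ Newc (hLang L r) x → ¬ Newc (hLang L r) y →
      ((oldData L r G).mem x y ↔ (hData L r N).mem (f x) (f y)) :=
    fun hx hy => old_iff₂ hf HRel.mem hx hy
  refine ⟨?_, ?_, ?_, ?_, ?_⟩
  · rintro x ⟨hn, hx⟩ ⟨-, hx'⟩
    exact h.not_cls _ ((hobj hn).1 hx) ((hcls hn).1 hx')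
  · rintro x hx
    exact ((code_elt_iff hf).1 hx).1
  · obtain ⟨M, _, g, hM, hg⟩ := h.model
    refine ⟨M, _, g ∘ f, hM, ⟨fun z => ?_, fun {x y} hx hy => ?_, fun {n} R x hx => ?_⟩⟩
    · obtain ⟨y, hy, rfl⟩ := hg.surj z
      obtain ⟨x, hx, rfl⟩ := hf.surj y
      exact ⟨x, ⟨hx, (hobj hx).2 hy⟩, rfl⟩
    · exact (hf.eq_iff hx.1 hy.1).trans (hg.eq_iff ((hobj hx.1).1 hx.2) ((hobj hy.1).1 hy.2))
    · exact (hf.rel_iff (L := hLang L r) (HRel.base R) fun i => (hx i).1).trans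
        (hg.rel_iff R (x := f ∘ x) fun i => (hobj (hx i).1).1 (hx i).2)
  · obtain ⟨X, hX, hX'⟩ := h.cls_empty
    obtain ⟨X, hn, rfl⟩ := hf.surj X
    exact ⟨X, ⟨hn, (hcls hn).2 hX⟩, fun x hx hm => hX' _ ((hobj hx.1).1 hx.2) ((hmem hx.1 hn).1 hm)⟩
  · rintro X x ⟨hX, hX'⟩ ⟨hx, hx'⟩
    obtain ⟨Y, hY, hY'⟩ := h.cls_adjoin _ _ ((hcls hX).1 hX') ((hobj hx).1 hx')
    obtain ⟨Y, hn, rfl⟩ := hf.surj Y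
    refine ⟨Y, ⟨hn, (hcls hn).2 hY⟩, fun y hy => ?_⟩
    have e1 : (codeData L r G Θ).mem y Y ↔ _ := hmem hy.1 hn
    have e2 : (codeData L r G Θ).mem y X ↔ _ := hmem hy.1 hX
    have e3 : y = x ↔ _ := hf.eq_iff hy.1 hx
    rw [e1, e2, e3]
    exact hY' _ ((hobj hy.1).1 hy.2)

/-- The code of a tuple, seen from the structure with added classes. -/
theorem exists_tuple_code {m : ℕ} (hf : (oldPre (hLang L r) G).Presents N f)
    (h : (hData L r N).HasTuples T) (Θ : G → (Fin m → G) → Prop) (t : Fin r → G)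
    (ht : ∀ i, (codeData L r G Θ).elt (t i)) :
    ∃ c, ¬ Newc (hLang L r) c ∧ (oldData L r G).code c ∧ ¬ (codeData L r G Θ).elt c ∧
      ∀ s : Fin r → G, (∀ i, (codeData L r G Θ).elt (s i)) → ((oldData L r G).tup c s ↔ s = t) := by
  simp only [code_elt_iff hf] at ht ⊢
  obtain ⟨c, hc, hc'⟩ := h.tuple (f ∘ t) fun i => (ht i).2
  obtain ⟨c, hn, rfl⟩ := hf.surj c
  refine ⟨c, hn, (old_iff₁ hf HRel.code hn).2 hc, fun he => h.not_code _ he.2 hc, fun s hs => ?_⟩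
  rw [old_tup_iff hf hn fun i => (hs i).1, hc' (f ∘ s) fun i => (hs i).2]
  constructor
  · intro hst
    funext i
    exact (hf.eq_iff (hs i).1 (ht i).1).2 (congrFun hst i)
  · rintro rfl
    rfl

end Lift

/-- A model of `T` with classes added, read as a structure for `hLang L 0`. -/
def baseData (L : FirstOrder.Language.{u, v}) (G : Type w) [(adjLang L).Structure G] :
    HData L 0 G where
  base R x := RelMap (L := adjLang L) (AdjRel.old R) x
  mem x y := Memc L x y
  obj x := ¬ Newc L x
  cls x := Newc L x
  code _ := False
  tup _ _ := False

theorem interp_core {𝒞 : ∀ (N : Type w) [L.Structure N], Prop}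
    (h : Interp 𝒞 (Adj (IsModel T))) :
    Interp 𝒞 fun (N : Type w) [(hLang L 0).Structure N] => (hData L 0 N).Core T := by
  refine h.trans (HData.interp (D := fun G _ => baseData L G) (P := fun D => D.Core T)
    ⟨fun R g => ?_, ?_, ?_, ?_, ?_, ?_⟩ fun G _ hG => ⟨?_, ?_, ?_, ?_, ?_⟩)
  · exact UD.rel (K := adjLang L) (AdjRel.old R) g
  · exact fun a b => UD.memc a b
  · exact fun a => UD.not (UD.newc a)
  · exact fun a => UD.newc a
  · exact fun a => UD.ff
  · exact fun a g => UD.ff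
  · exact fun x hx => hx
  · exact fun x _ hx => hx
  · obtain ⟨N, _, f, hN, hf⟩ := hG.old
    exact ⟨N, _, f, hN, hf⟩
  · exact hG.empty
  · exact hG.adjoin

variable [L.IsRelational] {𝒯 : ∀ (N : Type w) [L.Structure N], Prop}

/-- The only `0`-tuple is coded by any class. -/
theorem interp_tuples_zero (hT : Interp 𝒯 (Adj 𝒯)) (h : Interp 𝒯 (Adj (IsModel T))) :
    Interp 𝒯 fun (N : Type w) [(hLang L 0).Structure N] => (hData L 0 N).HasTuples T := by
  refine (hT.trans (interp_core h).adj).trans (HData.interp (P := fun D => D.HasTuples T)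
    (D := fun G _ => codeData L 0 G fun _ _ => True) (ucodeData fun a g => UD.tt) fun G _ hG => ?_)
  obtain ⟨N, _, f, hN, hf⟩ := hG.old
  obtain ⟨X, hX, -⟩ := hG.empty
  exact ⟨core_codeData hf hN _, fun t _ => ⟨X, hX, fun s _ =>
    iff_of_true trivial (Subsingleton.elim _ _)⟩⟩

/-- Codes for tuples of length `n` and a further layer of classes give codes for tuples of length
`n + 1`: the tuple `(t, y)` is coded by the class `{c, y}`, where `c` is a code of `t`. Codes are
not elements, so `c` and `y` are told apart. -/
theorem interp_tuples_succ (hT : Interp 𝒯 (Adj 𝒯)) {n : ℕ}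
    (h : Interp 𝒯 fun (N : Type w) [(hLang L n).Structure N] => (hData L n N).HasTuples T) :
    Interp 𝒯 fun (N : Type w) [(hLang L (n + 1)).Structure N] =>
      (hData L (n + 1) N).HasTuples T := by
  -- the class `X` is `{y, c}`, where `y` is the last component and `c` codes the other ones
  let Θ : ∀ (G : Type w) [(adjLang (hLang L n)).Structure G], G → (Fin (n + 1) → G) → Prop :=
    fun G _ X t =>
      (∀ z : G, ¬ Newc (hLang L n) z → (oldData L n G).elt z →
        (Memc (hLang L n) z X ↔ z = t (Fin.last n))) ∧
      (¬ ∀ c : G, ¬ Newc (hLang L n) c → (oldData L n G).code c → ¬ Memc (hLang L n) c X) ∧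
      ∀ c : G, ¬ Newc (hLang L n) c → (oldData L n G).code c → Memc (hLang L n) c X →
        ∀ s : Fin n → G, (∀ i, ¬ Newc (hLang L n) (s i) ∧ (oldData L n G).elt (s i)) →
          ((oldData L n G).tup c s ↔ ∀ i, s i = t i.castSucc)
  have hΘ : ∀ {V : Type} (a : V) (g : Fin (n + 1) → V),
      UD (adjLang (hLang L n)) fun G _ (v : V → G) => Θ G (v a) (fun i => v (g i)) := by
    intro V a g
    refine UD.and (UD.all_old (P := fun G _ v z => (oldData L n G).elt z →
        (Memc (hLang L n) z (v a) ↔ z = v (g (Fin.last n)))) ?_)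
      (UD.and (UD.not (UD.all_old (P := fun G _ v c => (oldData L n G).code c →
        ¬ Memc (hLang L n) c (v a)) ?_))
      (UD.all_old (P := fun G _ v c => (oldData L n G).code c → Memc (hLang L n) c (v a) →
        ∀ s : Fin n → G, (∀ i, ¬ Newc (hLang L n) (s i) ∧ (oldData L n G).elt (s i)) →
          ((oldData L n G).tup c s ↔ ∀ i, s i = v (g i.castSucc))) ?_))
    · exact UD.imp (uoldData.elt _) (UD.iff (UD.memc _ (Sum.inl a)) (UD.eq _ (Sum.inl (g _))))
    · exact UD.imp (uoldData.code _) (UD.not (UD.memc _ (Sum.inl a)))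
    · refine UD.imp (uoldData.code _) (UD.imp (UD.memc _ (Sum.inl a)) (UD.alls
        (P := fun (G : Type w) _ (v : V ⊕ Unit → G) s =>
          (∀ i, ¬ Newc (hLang L n) (s i) ∧ (oldData L n G).elt (s i)) →
          ((oldData L n G).tup (v (Sum.inr ())) s ↔ ∀ i, s i = v (Sum.inl (g i.castSucc)))) ?_))
      exact UD.imp (UD.forall_index fun i => UD.and (UD.not (UD.newc _)) (uoldData.elt _))
        (UD.iff (uoldData.tup (Sum.inl (Sum.inr ())) Sum.inr)
          (UD.forall_index fun i => UD.eq _ (Sum.inl (Sum.inl (g i.castSucc)))))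
  refine (hT.trans h.adj).trans (HData.interp (P := fun D => D.HasTuples T)
    (D := fun G _ => codeData L n G (Θ G)) (ucodeData hΘ) fun G _ hG => ?_)
  obtain ⟨N, _, f, hN, hf⟩ := hG.old
  refine ⟨core_codeData hf hN.toCore _, fun t ht => ?_⟩
  have helt : ∀ x, (codeData L n G (Θ G)).elt x ↔ ¬ Newc (hLang L n) x ∧ (oldData L n G).elt x := by
    intro x
    simp only [codeData, HData.elt]
    tauto
  obtain ⟨c, hcn, hcc, hce, hct⟩ := exists_tuple_code hf hN (Θ G) (Fin.init t) fun i => ht _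
  obtain ⟨X₀, hX₀, hX₀'⟩ := hG.empty
  obtain ⟨X₁, hX₁, hX₁'⟩ := hG.adjoin X₀ (t (Fin.last n)) hX₀ ((helt _).1 (ht _)).1
  obtain ⟨X, hX, hX'⟩ := hG.adjoin X₁ c hX₁ hcn
  have hmem : ∀ z, ¬ Newc (hLang L n) z →
      (Memc (hLang L n) z X ↔ z = t (Fin.last n) ∨ z = c) := by
    intro z hz
    rw [hX' z hz, hX₁' z hz]
    simp [hX₀' z hz]
  have hinit : ∀ s : Fin (n + 1) → G, (∀ i, (codeData L n G (Θ G)).elt (s i)) →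
      ∀ i, (codeData L n G (Θ G)).elt (Fin.init s i) := fun s hs i => hs _
  refine ⟨X, hX, fun s hs => ⟨?_, ?_⟩⟩
  · rintro ⟨h1, -, h3⟩
    have hlast : t (Fin.last n) = s (Fin.last n) :=
      (h1 _ ((helt _).1 (ht _)).1 ((helt _).1 (ht _)).2).1
        ((hmem _ ((helt _).1 (ht _)).1).2 (Or.inl rfl))
    have htup := (h3 c hcn hcc ((hmem c hcn).2 (Or.inr rfl)) (Fin.init t)
      fun i => (helt _).1 (hinit t ht i)).1 ((hct _ (hinit t ht)).2 rfl)
    funext i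
    refine Fin.lastCases hlast.symm (fun j => (htup j).symm) i
  · rintro rfl
    refine ⟨fun z hz hz' => ?_, fun hno => ?_, fun c' hcn' hcc' hm q hq => ?_⟩
    · rw [hmem z hz]
      refine or_iff_left ?_
      rintro rfl
      exact hce ((helt _).2 ⟨hz, hz'⟩)
    · exact hno c hcn hcc ((hmem c hcn).2 (Or.inr rfl))
    · rcases (hmem c' hcn').1 hm with rfl | rfl
      · refine absurd ((old_iff₁ hf HRel.code hcn').1 hcc') ?_
        exact hN.not_code _ ((code_elt_iff hf).1 (hs (Fin.last n))).2
      · rw [hct q fun i => (helt _).2 (hq i)]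
        exact funext_iff

theorem interp_tuples (hT : Interp 𝒯 (Adj 𝒯)) (h : Interp 𝒯 (Adj (IsModel T))) : ∀ n : ℕ,
    Interp 𝒯 fun (N : Type w) [(hLang L n).Structure N] => (hData L n N).HasTuples T
  | 0 => interp_tuples_zero hT h
  | n + 1 => interp_tuples_succ hT (interp_tuples hT h n)

/-- If `T` interprets a model of itself with adjunctive classes, it interprets a model of `T` with
adjunctive classes and an adjunctive family of sets of `n`-tuples of objects and classes: with
codes of tuples at hand, a further layer of classes consists of classes of codes. -/
theorem interp_sets (hT : Interp 𝒯 (Adj 𝒯)) (h : Interp 𝒯 (Adj (IsModel T))) (n : ℕ) :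
    Interp 𝒯 fun (N : Type w) [(hLang L n).Structure N] => (hData L n N).HasSets T := by
  -- the set coded by the class `k` consists of the tuples that have codes in `k`
  let Θ : ∀ (G : Type w) [(adjLang (hLang L n)).Structure G], G → (Fin n → G) → Prop :=
    fun G _ k t => ¬ ∀ c : G, ¬ Newc (hLang L n) c → Memc (hLang L n) c k →
      ¬ ∀ s : Fin n → G, (∀ i, ¬ Newc (hLang L n) (s i) ∧ (oldData L n G).elt (s i)) →
          ((oldData L n G).tup c s ↔ ∀ i, s i = t i)
  have hΘ : ∀ {V : Type} (a : V) (g : Fin n → V),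
      UD (adjLang (hLang L n)) fun G _ (v : V → G) => Θ G (v a) (fun i => v (g i)) := by
    intro V a g
    refine UD.not (UD.all_old (P := fun G _ v c => Memc (hLang L n) c (v a) →
        ¬ ∀ s : Fin n → G, (∀ i, ¬ Newc (hLang L n) (s i) ∧ (oldData L n G).elt (s i)) →
          ((oldData L n G).tup c s ↔ ∀ i, s i = v (g i))) ?_)
    refine UD.imp (UD.memc _ (Sum.inl a)) (UD.not (UD.alls
        (P := fun (G : Type w) _ (v : V ⊕ Unit → G) s =>
          (∀ i, ¬ Newc (hLang L n) (s i) ∧ (oldData L n G).elt (s i)) →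
          ((oldData L n G).tup (v (Sum.inr ())) s ↔ ∀ i, s i = v (Sum.inl (g i)))) ?_))
    exact UD.imp (UD.forall_index fun i => UD.and (UD.not (UD.newc _)) (uoldData.elt _))
        (UD.iff (uoldData.tup (Sum.inl (Sum.inr ())) Sum.inr)
          (UD.forall_index fun i => UD.eq _ (Sum.inl (Sum.inl (g i)))))
  refine (hT.trans (interp_tuples hT h n).adj).trans (HData.interp (P := fun D => D.HasSets T)
    (D := fun G _ => codeData L n G (Θ G)) (ucodeData hΘ) fun G _ hG => ?_)
  obtain ⟨N, _, f, hN, hf⟩ := hG.old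
  have helt : ∀ x, (codeData L n G (Θ G)).elt x ↔ ¬ Newc (hLang L n) x ∧ (oldData L n G).elt x := by
    intro x
    simp only [codeData, HData.elt]
    tauto
  have htup : ∀ k t, (codeData L n G (Θ G)).tup k t ↔ ∃ c : G, ¬ Newc (hLang L n) c ∧
      Memc (hLang L n) c k ∧ ∀ s : Fin n → G, (∀ i, (codeData L n G (Θ G)).elt (s i)) →
        ((oldData L n G).tup c s ↔ s = t) := by
    intro k t
    simp only [helt, funext_iff]
    simp only [codeData, Θ]
    push Not
    rfl
  refine ⟨core_codeData hf hN.toCore _, ?_, ?_⟩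
  · obtain ⟨X, hX, hX'⟩ := hG.empty
    refine ⟨X, hX, fun t _ => ?_⟩
    rw [htup]
    rintro ⟨c, hc, hm, -⟩
    exact hX' c hc hm
  · intro k t hk ht
    obtain ⟨c, hcn, -, -, hct⟩ := exists_tuple_code hf hN (Θ G) t ht
    obtain ⟨k', hk', hkm⟩ := hG.adjoin k c hk hcn
    refine ⟨k', hk', fun s hs => ?_⟩
    rw [htup, htup]
    constructor
    · rintro ⟨d, hd, hm, hds⟩
      rcases (hkm d hd).1 hm with hm | rfl
      · exact Or.inl ⟨d, hd, hm, hds⟩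
      · exact Or.inr ((hct s hs).1 ((hds s hs).2 rfl))
    · rintro (⟨d, hd, hm, hds⟩ | rfl)
      · exact ⟨d, hd, (hkm d hd).2 (Or.inl hm), hds⟩
      · exact ⟨c, hcn, (hkm c hcn).2 (Or.inr rfl), hct⟩

end FiniteRelations

/-! ### Comprehension for small sets of objects -/

section Comprehension

variable {L : FirstOrder.Language.{u, v}} {m : ℕ} {H : Type w}

namespace HData

variable (D : HData L m H)

/-- The part of `S` on which `Φ` holds can be added to every coded set of tuples of objects. -/
def Absorbed (Φ S : (Fin m → H) → Prop) : Prop :=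
  ∀ k, D.code k → ∃ k', D.code k' ∧ ∀ t : Fin m → H, (∀ j, D.obj (t j)) →
    (D.tup k' t ↔ D.tup k t ∨ (S t ∧ Φ t))

/-- The tuples with components in `X` at the places in `J`, and the components of `b` elsewhere. -/
def Box (X : H → Prop) (J : Finset (Fin m)) (b t : Fin m → H) : Prop :=
  ∀ j, (j ∈ J → X (t j)) ∧ (j ∉ J → t j = b j)

/-- All boxes over `X` are absorbed. Together with the full powers of `X`, the boxes with some
components fixed are included to make the notion inductive, see `NiceFor.adjoin`. -/
def NiceFor (Φ : (Fin m → H) → Prop) (X : H → Prop) : Prop :=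
  ∀ (J : Finset (Fin m)) (b : Fin m → H), (∀ j, D.obj (b j)) → D.Absorbed Φ (Box X J b)

variable {D} {Φ S S' : (Fin m → H) → Prop}

theorem Absorbed.congr (h : D.Absorbed Φ S) (hS : ∀ t, (∀ j, D.obj (t j)) → (S' t ↔ S t)) :
    D.Absorbed Φ S' := by
  intro k hk
  obtain ⟨k', hk', ht⟩ := h k hk
  exact ⟨k', hk', fun t hto => by rw [ht t hto, hS t hto]⟩

theorem Absorbed.or (h : D.Absorbed Φ S) (h' : D.Absorbed Φ S') :
    D.Absorbed Φ fun t => S t ∨ S' t := by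
  intro k hk
  obtain ⟨k₁, hk₁, ht₁⟩ := h k hk
  obtain ⟨k₂, hk₂, ht₂⟩ := h' k₁ hk₁
  exact ⟨k₂, hk₂, fun t hto => by rw [ht₂ t hto, ht₁ t hto]; tauto⟩

theorem absorbed_of_forall_not (hS : ∀ t, (∀ j, D.obj (t j)) → ¬ S t) : D.Absorbed Φ S := by
  intro k hk
  exact ⟨k, hk, fun t hto => by simp [hS t hto]⟩

theorem absorbed_biUnion {ι : Type*} (s : Finset ι) (A : ι → (Fin m → H) → Prop)
    (h : ∀ i, D.Absorbed Φ (A i)) : D.Absorbed Φ fun t => ∃ i ∈ s, A i t := by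
  classical
  induction s using Finset.induction_on with
  | empty => exact absorbed_of_forall_not (by simp)
  | insert i s hi ih =>
    refine ((h i).or ih).congr fun t _ => ?_
    simp

variable {T : L.Theory}

theorem HasSets.absorbed_eq (hD : D.HasSets T) {b : Fin m → H} (hb : ∀ j, D.obj (b j)) :
    D.Absorbed Φ fun t => t = b := by
  intro k hk
  by_cases hΦ : Φ b
  · obtain ⟨k', hk', ht⟩ := hD.code_adjoin k b hk fun j => Or.inl (hb j)
    refine ⟨k', hk', fun t hto => ?_⟩
    rw [ht t fun j => Or.inl (hto j)]
    refine or_congr_right ⟨?_, fun h => h.1⟩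
    rintro rfl
    exact ⟨rfl, hΦ⟩
  · refine ⟨k, hk, fun t _ => ⟨Or.inl, ?_⟩⟩
    rintro (h | ⟨rfl, h⟩)
    · exact h
    · exact absurd h hΦ

variable {X X' : H → Prop}

/-- A box over the empty set is empty or a singleton, according to whether some component varies. -/
theorem HasSets.niceFor_empty (hD : D.HasSets T) (hX : ∀ x, ¬ X x) : D.NiceFor Φ X := by
  intro J b hb
  by_cases hJ : J = ∅
  · subst hJ
    refine (hD.absorbed_eq hb).congr fun t _ => ?_
    simp [Box, hX, funext_iff]
  · obtain ⟨j, hj⟩ := Finset.nonempty_iff_ne_empty.2 hJ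
    exact absorbed_of_forall_not fun t _ ht => hX _ ((ht j).1 hj)

/-- A box over `X ∪ {y}` is the union of boxes over `X`, according to the places where the component
is taken from `X`. -/
theorem NiceFor.adjoin (h : D.NiceFor Φ X) {y : H} (hy : D.obj y)
    (hX' : ∀ x, X' x ↔ X x ∨ x = y) : D.NiceFor Φ X' := by
  classical
  intro J b hb
  refine (absorbed_biUnion J.powerset (fun J' => Box X J' fun j => if j ∈ J then y else b j)
    fun J' => h J' _ fun j => ?_).congr fun t _ => ?_
  · split_ifs
    exacts [hy, hb j]
  · constructor
    · intro ht
      refine ⟨J.filter fun j => X (t j), by simp, fun j => ⟨fun hj => ?_, fun hj => ?_⟩⟩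
      · exact (Finset.mem_filter.1 hj).2
      · by_cases hJ : j ∈ J
        · simp only [if_pos hJ]
          refine ((hX' _).1 ((ht j).1 hJ)).resolve_left fun hx => hj ?_
          exact Finset.mem_filter.2 ⟨hJ, hx⟩
        · simp only [if_neg hJ]
          exact (ht j).2 hJ
    · rintro ⟨J', hJ', ht⟩ j
      rw [Finset.mem_powerset] at hJ'
      constructor
      · intro hj
        rw [hX']
        by_cases hj' : j ∈ J'
        · exact Or.inl ((ht j).1 hj')
        · have := (ht j).2 hj'
          simp only [if_pos hj] at this
          exact Or.inr this
      · intro hj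
        have := (ht j).2 fun hj' => hj (hJ' hj')
        simpa only [if_neg hj] using this

/-- Comprehension for `Φ` on the tuples with components in `X`, which form a single box. -/
theorem NiceFor.comprehension (h : D.NiceFor Φ X) (hD : D.HasSets T) :
    ∃ k, D.code k ∧ ∀ t : Fin m → H, (∀ j, D.obj (t j)) →
      (D.tup k t ↔ (∀ j, X (t j)) ∧ Φ t) := by
  obtain ⟨N, _, f, ⟨⟨y⟩, -⟩, hf⟩ := hD.model
  obtain ⟨x, hx, -⟩ := hf.surj y
  obtain ⟨k, hk, hkt⟩ := hD.code_empty
  obtain ⟨k', hk', ht⟩ := h Finset.univ (fun _ => x) (fun _ => hx) k hk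
  refine ⟨k', hk', fun t hto => ?_⟩
  rw [ht t hto]
  simp [Box, hkt t fun j => Or.inl (hto j)]

end HData

end Comprehension

/-! ### Coded models -/

section CodedModels

variable {L : FirstOrder.Language.{u, v}} {r : ℕ} {H : Type w}

namespace HData

variable (D : HData L (r + 2) H)

/-- The `n`-tuple `x` extends to a tuple in the set with code `k`. -/
def Proj (k : H) {n : ℕ} (x : Fin n → H) : Prop :=
  ∃ t : Fin (r + 2) → H, (∀ j, D.obj (t j)) ∧
    (∀ (i : Fin n) (j : Fin (r + 2)), i.1 = j.1 → t j = x i) ∧ D.tup k t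

variable {κ : ℕ} (c : (Σ n : ℕ, L.Relations n) ≃ Fin κ)

/-- The structure for `L` whose domain, equality and predicates are coded by the components of `a`.
Where a component of `a` is not a code, it stands for the domain, the equality or the predicate of
the structure of all objects. -/
def codedPre (a : Option (Option (Fin κ)) → H) : Pre L H where
  dom x := D.obj x ∧ (D.code (a none) → D.Proj (a none) ![x])
  eq x y := (D.code (a (some none)) → D.Proj (a (some none)) ![x, y]) ∧
    (¬ D.code (a (some none)) → x = y)
  rel {n} R x := (D.code (a (some (some (c ⟨n, R⟩)))) → D.Proj (a (some (some (c ⟨n, R⟩)))) x) ∧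
    (¬ D.code (a (some (some (c ⟨n, R⟩)))) → D.base R x)

open Classical in
/-- The structure that the translation `τ` defines in a coded structure, with the names of two
objects interchanged. The parameter `θ` consists of the codes, the parameters of `τ`, and the two
objects. -/
noncomputable def derivedPre [L.IsRelational] {ι : Type} (τ : Tr L L ι)
    (θ : (Option (Option (Fin κ)) ⊕ ι) ⊕ Fin 2 → H) : Pre L H :=
  let A := (D.codedPre c fun i => θ (.inl (.inl i))).comp τ fun i => θ (.inl (.inr i))
  let s : H → H := Equiv.swap (θ (.inr 0)) (θ (.inr 1))
  ⟨fun x => A.dom (s x), fun x y => A.eq (s x) (s y), fun R x => A.rel R (s ∘ x)⟩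

variable (hc : ∀ R : Σ n : ℕ, L.Relations n, R.1 ≤ r + 2)

/-- The domain, equality and predicates of a structure as predicates of tuples of fixed length. -/
def component (A : Pre L H) (i : Option (Option (Fin κ))) (t : Fin (r + 2) → H) : Prop :=
  match i with
  | none => A.dom (t 0)
  | some none => A.eq (t 0) (t 1)
  | some (some j) => A.rel (c.symm j).2 fun i => t (Fin.castLE (hc _) i)

variable [L.IsRelational] (F : L.Theory)

/-- The coded structure satisfies the axioms in `F` and the axioms of equality. -/
def IsMod (a : Option (Option (Fin κ)) → H) : Prop :=
  (∃ x, (D.codedPre c a).dom x) ∧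
    ∀ φ ∈ F ∪ eqAxioms L, (D.codedPre c a).SatF φ Empty.elim

/-- No coded model of `F` has its domain in `X`. -/
def Small (X : H → Prop) : Prop :=
  ∀ a : Option (Option (Fin κ)) → H, D.IsMod c F a → ¬ ∀ x, (D.codedPre c a).dom x → X x

variable {ι : Type} (τ : Tr L L ι)

/-- Comprehension holds on `X` for all predicates of structures derived from coded ones. -/
def Nice (X : H → Prop) : Prop :=
  ∀ (i : Option (Option (Fin κ))) (θ : (Option (Option (Fin κ)) ⊕ ι) ⊕ Fin 2 → H),
    D.NiceFor (component c hc (D.derivedPre c τ θ) i) X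

variable {D c hc F τ} {T : L.Theory}

theorem isMod_iff (hF : ∀ (N : Type w) [L.Structure N] [Nonempty N], N ⊨ F ↔ N ⊨ T)
    {a : Option (Option (Fin κ)) → H} : D.IsMod c F a ↔
      ∃ (N : Type w) (_ : L.Structure N) (f : H → N), IsModel T N ∧
        (D.codedPre c a).Presents N f := by
  constructor
  · rintro ⟨hne, hax⟩
    obtain ⟨N, _, hN, f, hf⟩ := Pre.exists_presents hne fun φ hφ => hax φ (Or.inr hφ)
    refine ⟨N, _, f, ⟨hN, (hF N).1 ⟨fun φ hφ => ?_⟩⟩, hf⟩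
    exact (hf.sentence_iff φ).1 (hax φ (Or.inl hφ))
  · rintro ⟨N, _, f, ⟨hN, hT⟩, hf⟩
    refine ⟨?_, fun φ hφ => ?_⟩
    · obtain ⟨x, hx, -⟩ := hf.surj hN.some
      exact ⟨x, hx⟩
    · rcases hφ with hφ | hφ
      · exact (hf.sentence_iff φ).2 (((hF N).2 hT).realize_of_mem φ hφ)
      · exact satF_eqAxioms_of_presents hf hφ

theorem Small.of_empty {X : H → Prop} (hX : ∀ x, ¬ X x) : D.Small c F X := by
  rintro a ⟨⟨x, hx⟩, -⟩ hsub
  exact hX x (hsub x hx)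

/-- The objects themselves form a coded model. -/
theorem Small.exists_not (hF : ∀ (N : Type w) [L.Structure N] [Nonempty N], N ⊨ F ↔ N ⊨ T)
    (hD : D.HasSets T) {X : H → Prop} (h : D.Small c F X) : ∃ x, D.obj x ∧ ¬ X x := by
  obtain ⟨N, _, f, hN, hf⟩ := hD.model
  obtain ⟨x, hx, -⟩ := hf.surj hN.1.some
  have hx' : ¬ D.code x := hD.not_code x (Or.inl hx)
  have hmod : D.IsMod c F fun _ => x := by
    refine (isMod_iff hF).2 ⟨N, _, f, hN, hf.congr ?_ ?_ ?_⟩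
    · intro y; simp [codedPre, objPre, hx']
    · intro y z _ _; simp [codedPre, objPre, hx']
    · intro n R y _; simp [codedPre, objPre, hx']
  by_contra hno
  push Not at hno
  exact h _ hmod fun y hy => hno y hy.1

/-- If `X ∪ {y}` carried a coded model `A`, then `A` would contain a smaller model `B` and an
element `z` outside of it; interchanging `y` and `z` moves `B` into `X`, where it is coded by
comprehension. -/
theorem Small.adjoin (hF : ∀ (N : Type w) [L.Structure N] [Nonempty N], N ⊨ F ↔ N ⊨ T)
    (hτ : Tr.Shrinks.{u, v, w} τ T)
    (hD : D.HasSets T) {X X' : H → Prop} (hXo : ∀ x, X x → D.obj x)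
    (h : D.Small c F X) (hn : D.Nice c hc τ X) {y : H} (hX' : ∀ x, X' x → X x ∨ x = y) :
    D.Small c F X' := by
  classical
  intro a ha hsub
  obtain ⟨M, _, f, hM, hf⟩ := (isMod_iff hF).1 ha
  obtain ⟨p, N, _, g, hN, hg, z, hz⟩ := hτ M hM
  choose q hq using fun i => hf.surj (p i)
  obtain ⟨z, hzd, rfl⟩ := hf.surj z
  have hfq : f ∘ q = p := funext fun i => (hq i).2
  rw [← hfq] at hg hz
  have hcomp := hf.comp (fun i => (hq i).1) hg
  have hswap := hcomp.precomp (Equiv.swap y z) (Equiv.surjective _)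
  let θ : (Option (Option (Fin κ)) ⊕ ι) ⊕ Fin 2 → H := Sum.elim (Sum.elim a q) ![y, z]
  set A := D.derivedPre c τ θ with hAdef
  have hA : A.Presents N (g ∘ f ∘ Equiv.swap y z) := hswap
  -- the domain of `A` is contained in `X`
  have hAX : ∀ x, A.dom x → X x := by
    intro x hx
    have hx1 : ((D.codedPre c a).comp τ q).dom (Equiv.swap y z x) := hx
    rw [hf.comp_dom_iff τ fun i => (hq i).1] at hx1
    have hsz : Equiv.swap y z x ≠ z := by
      intro he
      rw [he] at hx1
      exact hz hx1.2
    have hxy : x ≠ y := by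
      rintro rfl
      exact hsz (Equiv.swap_apply_left _ _)
    by_cases hxz : x = z
    · subst hxz
      exact (hX' x (hsub x hzd)).resolve_right hxy
    · rw [Equiv.swap_apply_of_ne_of_ne hxy hxz] at hx1
      exact (hX' x (hsub x hx1.1)).resolve_right hxy
  choose b hb hbt using fun i => (hn i θ).comprehension hD
  refine h b ((isMod_iff hF).2 ⟨N, _, _, hN, hA.congr (B := D.codedPre c b) ?_ ?_ ?_⟩) ?_
  -- the components of `A` are coded by `b`
  · intro x
    constructor
    · rintro ⟨-, hx⟩
      obtain ⟨t, hto, htx, ht⟩ := hx (hb none)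
      have := ((hbt none t hto).1 ht).2
      have h0 : t 0 = x := htx 0 0 rfl
      simpa [component, h0] using this
    · intro hx
      refine ⟨hXo x (hAX x hx), fun _ => ⟨fun _ => x, fun _ => hXo x (hAX x hx), ?_, ?_⟩⟩
      · intro i j _
        rw [Subsingleton.elim i 0]; rfl
      · exact (hbt none _ fun _ => hXo x (hAX x hx)).2 ⟨fun _ => hAX x hx, hx⟩
  · intro x x' hx hx'
    constructor
    · rintro ⟨hp, -⟩
      obtain ⟨t, hto, htx, ht⟩ := hp (hb _)
      have := ((hbt (some none) t hto).1 ht).2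
      have h0 : t 0 = x := htx 0 0 rfl
      have h1 : t 1 = x' := htx 1 1 rfl
      simpa [component, h0, h1] using this
    · intro he
      refine ⟨fun _ => ⟨fun j => if j = 0 then x else x', fun j => ?_, ?_, ?_⟩,
        fun hno => absurd (hb _) hno⟩
      · dsimp only
        split_ifs
        exacts [hXo _ (hAX _ hx), hXo _ (hAX _ hx')]
      · intro i j hij
        fin_cases i
        · exact if_pos (Fin.ext hij.symm)
        · refine if_neg ?_
          rintro rfl
          simp at hij
      · refine (hbt (some none) _ fun j => ?_).2 ⟨fun j => ?_, ?_⟩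
        · split_ifs
          exacts [hXo _ (hAX _ hx), hXo _ (hAX _ hx')]
        · split_ifs
          exacts [hAX _ hx, hAX _ hx']
        · simpa [component] using he
  · intro n R x hx
    have hcomp' : ∀ t : Fin (r + 2) → H,
        (∀ (i : Fin n) (j : Fin (r + 2)), i.1 = j.1 → t j = x i) →
        (component c hc A (some (some (c ⟨n, R⟩))) t ↔ A.rel R x) := by
      intro t htx
      have key : ∀ S : Σ n : ℕ, L.Relations n, S = ⟨n, R⟩ →
          (A.rel S.2 (fun i => t (Fin.castLE (hc S) i)) ↔ A.rel R x) := by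
        rintro _ rfl
        refine iff_of_eq (congrArg _ (funext fun i => ?_))
        exact htx i _ rfl
      exact key _ (c.symm_apply_apply _)
    constructor
    · rintro ⟨hp, -⟩
      obtain ⟨t, hto, htx, ht⟩ := hp (hb _)
      exact (hcomp' t htx).1 ((hbt _ t hto).1 ht).2
    · intro hR
      obtain ⟨d, hd, -⟩ := hA.surj hN.1.some
      have htX : ∀ j : Fin (r + 2), X (if hj : j.1 < n then x ⟨j.1, hj⟩ else d) := by
        intro j
        split_ifs
        exacts [hAX _ (hx _), hAX _ hd]
      have htx : ∀ (i : Fin n) (j : Fin (r + 2)), i.1 = j.1 →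
          (if hj : j.1 < n then x ⟨j.1, hj⟩ else d) = x i := by
        intro i j hij
        rw [dif_pos (hij ▸ i.2)]
        exact congrArg x (Fin.ext hij.symm)
      refine ⟨fun _ => ⟨_, fun j => hXo _ (htX j), htx, ?_⟩, fun hno => absurd (hb _) hno⟩
      exact (hbt _ _ fun j => hXo _ (htX j)).2 ⟨htX, (hcomp' _ htx).2 hR⟩
  · rintro x ⟨hxo, hx⟩
    obtain ⟨t, hto, htx, ht⟩ := hx (hb none)
    have h0 : t 0 = x := htx 0 0 rfl
    rw [← h0]
    exact ((hbt none t hto).1 ht).1 0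

end HData

section Definability

variable {κ : ℕ} (c : (Σ n : ℕ, L.Relations n) ≃ Fin κ)

open HData

theorem uproj {V : Type} {n : ℕ} (k : V) (x : Fin n → V) :
    UD (hLang L (r + 2)) fun (N : Type w) _ (v : V → N) =>
      (hData L (r + 2) N).Proj (v k) (fun i => v (x i)) := by
  refine UD.exs (P := fun (N : Type w) _ (v : V → N) t => (∀ j, (hData L (r + 2) N).obj (t j)) ∧
    (∀ (i : Fin n) (j : Fin (r + 2)), i.1 = j.1 → t j = v (x i)) ∧
      (hData L (r + 2) N).tup (v k) t) ?_
  exact UD.and (UD.forall_index fun j => uhData.obj _)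
    (UD.and (UD.forall_index fun i => UD.forall_index fun j => UD.imp_const fun _ =>
      UD.eq _ (Sum.inl (x i))) (uhData.tup (Sum.inl k) Sum.inr))

theorem ucodedPre : UPre (hLang L (r + 2)) fun (N : Type w) _ a =>
    (hData L (r + 2) N).codedPre c a where
  dom g a := by
    refine UD.and (uhData.obj a) (UD.imp (uhData.code _) ((uproj (g none) ![a]).congr ?_))
    intro N _ v
    rw [show (fun i => v (![a] i)) = ![v a] from comp_vec₁ v a]
  eq g a b := by
    refine UD.and (UD.imp (uhData.code _) ((uproj (g (some none)) ![a, b]).congr ?_))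
      (UD.imp (UD.not (uhData.code _)) (UD.eq a b))
    intro N _ v
    rw [show (fun i => v (![a, b] i)) = ![v a, v b] from comp_vec₂ v a b]
  rel R g a := UD.and (UD.imp (uhData.code _) (uproj (g _) a))
    (UD.imp (UD.not (uhData.code _)) (uhData.base R a))

open Classical in
/-- Interchanging two elements in some arguments of a definable predicate. -/
theorem UD.swap {K : FirstOrder.Language.{u₁, v₁}} {V ι : Type} [Finite ι] (y z : V) (a : ι → V)
    {P : ∀ (N : Type w) [K.Structure N], (V → N) → (ι → N) → Prop}
    (h : UD K fun N _ (w : V ⊕ ι → N) => P N (fun a => w (.inl a)) (fun i => w (.inr i))) :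
    UD K fun N _ (v : V → N) => P N v fun i => Equiv.swap (v y) (v z) (v (a i)) := by
  refine (UD.exs (P := fun (N : Type w) _ (v : V → N) (x : ι → N) =>
    (∀ i, ((v (a i) = v y ∧ x i = v z) ∨ (v (a i) = v z ∧ v (a i) ≠ v y ∧ x i = v y)) ∨
      (v (a i) ≠ v y ∧ v (a i) ≠ v z ∧ x i = v (a i))) ∧ P N v x) ?_).congr fun N _ v => ?_
  · refine UD.and (UD.forall_index fun i => UD.or (UD.or ?_ ?_) ?_) h
    · exact UD.and (UD.eq (Sum.inl (a i)) (Sum.inl y)) (UD.eq _ (Sum.inl z))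
    · exact UD.and (UD.eq (Sum.inl (a i)) (Sum.inl z))
        (UD.and (UD.not (UD.eq (Sum.inl (a i)) (Sum.inl y))) (UD.eq _ (Sum.inl y)))
    · exact UD.and (UD.not (UD.eq (Sum.inl (a i)) (Sum.inl y)))
        (UD.and (UD.not (UD.eq (Sum.inl (a i)) (Sum.inl z))) (UD.eq _ (Sum.inl (a i))))
  · have key : ∀ (x : ι → N) (i : ι),
        ((((v (a i) = v y ∧ x i = v z) ∨ (v (a i) = v z ∧ v (a i) ≠ v y ∧ x i = v y)) ∨
          (v (a i) ≠ v y ∧ v (a i) ≠ v z ∧ x i = v (a i))) ↔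
        x i = Equiv.swap (v y) (v z) (v (a i))) := by
      intro x i
      rw [Equiv.swap_apply_def]
      split_ifs with h1 h2
      · simp only [h1]; tauto
      · rw [h2] at h1
        simp [h1, h2]
      · simp [h1, h2]
    simp only [key]
    constructor
    · rintro ⟨x, hx, hP⟩
      rwa [← show x = _ from funext hx]
    · intro hP
      exact ⟨_, fun i => rfl, hP⟩

theorem uderivedPre [L.IsRelational] {ι : Type} (τ : Tr L L ι) :
    UPre (hLang L (r + 2)) fun (N : Type w) _ θ =>
      (hData L (r + 2) N).derivedPre c τ θ where
  dom g a := UD.swap (ι := Unit) (g (.inr 0)) (g (.inr 1)) (fun _ => a)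
    (P := fun N _ v x => (((hData L (r + 2) N).codedPre c fun i => v (g (.inl (.inl i)))).comp τ
      fun i => v (g (.inl (.inr i)))).dom (x ()))
    (((ucodedPre c).comp τ).dom (fun i => Sum.inl (g (.inl i))) _)
  eq g a b := UD.swap (g (.inr 0)) (g (.inr 1)) ![a, b]
    (P := fun N _ v x => (((hData L (r + 2) N).codedPre c fun i => v (g (.inl (.inl i)))).comp τ
      fun i => v (g (.inl (.inr i)))).eq (x 0) (x 1))
    (((ucodedPre c).comp τ).eq (fun i => Sum.inl (g (.inl i))) _ _)
  rel R g a := UD.swap (g (.inr 0)) (g (.inr 1)) a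
    (P := fun N _ v x => (((hData L (r + 2) N).codedPre c fun i => v (g (.inl (.inl i)))).comp τ
      fun i => v (g (.inl (.inr i)))).rel R x)
    (((ucodedPre c).comp τ).rel R (fun i => Sum.inl (g (.inl i))) _)

theorem finite_eqAxioms [Finite (Σ n : ℕ, L.Relations n)] : (eqAxioms L).Finite := by
  refine Set.Finite.union (by simp) ?_
  refine (Set.finite_range fun x : Σ R : (Σ n : ℕ, L.Relations n), Fin R.1 =>
    eqCongr x.1.2 x.2).subset ?_
  rintro _ ⟨n, R, i, rfl⟩
  exact ⟨⟨⟨n, R⟩, i⟩, rfl⟩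

variable [L.IsRelational] {F : L.Theory}

theorem usmall [Finite (Σ n : ℕ, L.Relations n)] (hF : F.Finite) {V : Type}
    {X : ∀ (N : Type w) [(hLang L (r + 2)).Structure N], (V → N) → N → Prop}
    (hX : ∀ {W : Type} (g : V → W) (a : W),
      UD (hLang L (r + 2)) fun N _ (v : W → N) => X N (fun i => v (g i)) (v a)) :
    UD (hLang L (r + 2)) fun N _ (v : V → N) => (hData L (r + 2) N).Small c F (X N v) := by
  refine UD.alls (P := fun (N : Type w) _ (v : V → N) (a : Option (Option (Fin κ)) → N) =>
    (hData L (r + 2) N).IsMod c F a →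
      ¬ ∀ x, ((hData L (r + 2) N).codedPre c a).dom x → X N v x) ?_
  refine UD.imp (UD.and ?_ ?_) (UD.not ?_)
  · refine UD.ex (P := fun (N : Type w) _ (v : V ⊕ Option (Option (Fin κ)) → N) x =>
      ((hData L (r + 2) N).codedPre c fun i => v (.inr i)).dom x) ?_
    exact (ucodedPre c).dom (fun i => Sum.inl (Sum.inr i)) _
  · exact UD.forall_mem (hF.union finite_eqAxioms) fun φ => (ucodedPre c).satS φ _
  · refine UD.all (P := fun (N : Type w) _ (v : V ⊕ Option (Option (Fin κ)) → N) x =>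
      ((hData L (r + 2) N).codedPre c fun i => v (.inr i)).dom x →
        X N (fun i => v (.inl i)) x) ?_
    exact UD.imp ((ucodedPre c).dom (fun i => Sum.inl (Sum.inr i)) _)
      (hX (fun i => Sum.inl (Sum.inl i)) _)

theorem unice {hc : ∀ R : Σ n : ℕ, L.Relations n, R.1 ≤ r + 2} {ι : Type} [Finite ι]
    (τ : Tr L L ι) {V : Type}
    {X : ∀ (N : Type w) [(hLang L (r + 2)).Structure N], (V → N) → N → Prop}
    (hX : ∀ {W : Type} (g : V → W) (a : W),
      UD (hLang L (r + 2)) fun N _ (v : W → N) => X N (fun i => v (g i)) (v a)) :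
    UD (hLang L (r + 2)) fun N _ (v : V → N) => (hData L (r + 2) N).Nice c hc τ (X N v) := by
  refine UD.forall_index fun i => ?_
  refine UD.alls (P := fun (N : Type w) _ (v : V → N)
    (θ : (Option (Option (Fin κ)) ⊕ ι) ⊕ Fin 2 → N) => (hData L (r + 2) N).NiceFor
      (component c hc ((hData L (r + 2) N).derivedPre c τ θ) i) (X N v)) ?_
  refine UD.forall_index fun J => ?_
  refine UD.alls (P := fun (N : Type w) _
    (v : V ⊕ ((Option (Option (Fin κ)) ⊕ ι) ⊕ Fin 2) → N) b =>
    (∀ j, (hData L (r + 2) N).obj (b j)) →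
    (hData L (r + 2) N).Absorbed (component c hc ((hData L (r + 2) N).derivedPre c τ
      fun i => v (.inr i)) i) (Box (X N fun i => v (.inl i)) J b)) ?_
  refine UD.imp (UD.forall_index fun j => uhData.obj _) ?_
  refine UD.all (P := fun (N : Type w) _
    (v : (V ⊕ ((Option (Option (Fin κ)) ⊕ ι) ⊕ Fin 2)) ⊕ Fin (r + 2) → N) k =>
    (hData L (r + 2) N).code k → ∃ k', (hData L (r + 2) N).code k' ∧
      ∀ t : Fin (r + 2) → N, (∀ j, (hData L (r + 2) N).obj (t j)) →
        ((hData L (r + 2) N).tup k' t ↔ (hData L (r + 2) N).tup k t ∨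
          (Box (X N fun i => v (.inl (.inl i))) J (fun j => v (.inr j)) t ∧
            component c hc ((hData L (r + 2) N).derivedPre c τ
              fun i => v (.inl (.inr i))) i t))) ?_
  refine UD.imp (uhData.code _) ?_
  refine UD.ex (P := fun (N : Type w) _
    (v : ((V ⊕ ((Option (Option (Fin κ)) ⊕ ι) ⊕ Fin 2)) ⊕ Fin (r + 2)) ⊕ Unit → N) k' =>
      (hData L (r + 2) N).code k' ∧
      ∀ t : Fin (r + 2) → N, (∀ j, (hData L (r + 2) N).obj (t j)) →
        ((hData L (r + 2) N).tup k' t ↔ (hData L (r + 2) N).tup (v (.inr ())) t ∨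
          (Box (X N fun i => v (.inl (.inl (.inl i)))) J (fun j => v (.inl (.inr j))) t ∧
            component c hc ((hData L (r + 2) N).derivedPre c τ
              fun i => v (.inl (.inl (.inr i)))) i t))) ?_
  refine UD.and (uhData.code _) ?_
  refine UD.alls (P := fun (N : Type w) _
    (v : (((V ⊕ ((Option (Option (Fin κ)) ⊕ ι) ⊕ Fin 2)) ⊕ Fin (r + 2)) ⊕ Unit) ⊕ Unit → N) t =>
      (∀ j, (hData L (r + 2) N).obj (t j)) →
        ((hData L (r + 2) N).tup (v (.inr ())) t ↔
          (hData L (r + 2) N).tup (v (.inl (.inr ()))) t ∨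
          (Box (X N fun i => v (.inl (.inl (.inl (.inl i))))) J
              (fun j => v (.inl (.inl (.inr j)))) t ∧
            component c hc ((hData L (r + 2) N).derivedPre c τ
              fun i => v (.inl (.inl (.inl (.inr i))))) i t))) ?_
  refine UD.imp (UD.forall_index fun j => uhData.obj _)
    (UD.iff (uhData.tup (Sum.inl (Sum.inr ())) Sum.inr)
    (UD.or (uhData.tup (Sum.inl (Sum.inl (Sum.inr ()))) Sum.inr) (UD.and ?_ ?_)))
  · refine UD.forall_index fun j => UD.and (UD.imp_const fun _ => ?_) (UD.imp_const fun _ => ?_)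
    · exact hX (fun i => Sum.inl (Sum.inl (Sum.inl (Sum.inl (Sum.inl i))))) _
    · exact UD.eq _ (Sum.inl (Sum.inl (Sum.inl (Sum.inr j))))
  · have hB := uderivedPre.{u, v, w} (L := L) (r := r) c τ
    rcases i with _ | _ | j
    · exact hB.dom (fun i => Sum.inl (Sum.inl (Sum.inl (Sum.inl (Sum.inr i))))) _
    · exact hB.eq (fun i => Sum.inl (Sum.inl (Sum.inl (Sum.inl (Sum.inr i))))) _ _
    · exact hB.rel _ (fun i => Sum.inl (Sum.inl (Sum.inl (Sum.inl (Sum.inr i))))) _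

end Definability

end CodedModels

/-! ### Kripke models with constant domain -/

section Kripke

/-- A Kripke model with the worlds `W`, the constant domain `X` and genuine equality. -/
structure Kripke (L : FirstOrder.Language.{u, v}) (W X : Type w) where
  le : W → W → Prop
  star : ∀ {n : ℕ}, L.Relations n → W → (Fin n → X) → Prop
  refl : ∀ p, le p p
  trans : ∀ {p q r}, le p q → le q r → le p r
  mono : ∀ {n} (R : L.Relations n) {p q x}, le q p → star R p x → star R q x

namespace Kripke

variable {L : FirstOrder.Language.{u, v}} {W X : Type w} (D : Kripke L W X)

/-- The structure for the language of `KM` given by a Kripke model. -/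
def pre : Pre (kmLang L) (W ⊕ X) where
  dom _ := True
  eq x y := x = y
  rel R x := match R with
    | .isSort .world => ∃ p, x 0 = .inl p
    | .isSort .elt => ∃ y, x 0 = .inr y
    | .of .le => ∃ p q, x 0 = .inl p ∧ x 1 = .inl q ∧ D.le p q
    | .of .dom => ∃ p y, x 0 = .inl p ∧ x 1 = .inr y
    | .of (.star R) => ∃ p y, x 0 = .inl p ∧ (∀ i, x (Fin.succ i) = .inr (y i)) ∧ D.star R p y
    | .of .eqStar => ∃ p y, x 0 = .inl p ∧ x 1 = .inr y ∧ x 2 = .inr y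

theorem pre_star_iff {n : ℕ} (R : L.Relations n) (x : Fin (n + 1) → W ⊕ X) :
    D.pre.rel (FlatRel.of (KMRel.star R)) x ↔
      ∃ p y, x 0 = .inl p ∧ (∀ i, x (Fin.succ i) = .inr (y i)) ∧ D.star R p y := by
  simp only [pre]

/-- Forcing in a Kripke model. -/
def Forces [L.IsRelational] (D : Kripke L W X) {α : Type*} :
    ∀ {n : ℕ}, L.BoundedFormula α n → (α ⊕ Fin n → X) → W → Prop
  | _, .falsum, _, _ => False
  | _, .equal t₁ t₂, e, _ => e (termVar t₁) = e (termVar t₂)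
  | _, .rel R ts, e, p => ∀ q, D.le q p → ∃ r, D.le r q ∧ D.star R r fun i => e (termVar (ts i))
  | _, .imp φ ψ, e, p => ∀ q, D.le q p → ¬ (D.Forces φ e q ∧ ∀ r, D.le r q → ¬ D.Forces ψ e r)
  | _, .all φ, e, p => ∀ q, D.le q p → ∀ x, D.Forces φ (extend e x) q

section Realize

theorem realize_kmAll_world {V : Type} (φ : (kmLang L).Formula (V ⊕ Unit)) (v : V → W ⊕ X) :
    letI := D.pre.str
    (kmAll .world φ).Realize v ↔ ∀ q : W, φ.Realize (Sum.elim v fun _ => .inl q) := by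
  let _ := D.pre.str
  have hsort : ∀ x : W ⊕ X,
      RelMap (L := kmLang L) (FlatRel.isSort KMSort.world) ![x] ↔ ∃ p, x = .inl p :=
    fun x => Iff.rfl
  simp only [kmAll, Formula.realize_iAlls]
  constructor
  · intro h q
    have := h fun _ => .inl q
    rw [Formula.Realize, BoundedFormula.realize_imp, realize_inSort, hsort] at this
    exact this ⟨q, rfl⟩
  · intro h x
    rw [Formula.Realize, BoundedFormula.realize_imp, realize_inSort, hsort]
    rintro ⟨q, hq⟩
    have hx : x = fun _ => .inl q := funext fun _ => hq
    rw [hx]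
    exact h q

theorem realize_kmAll_elt {V : Type} (φ : (kmLang L).Formula (V ⊕ Unit)) (v : V → W ⊕ X) :
    letI := D.pre.str
    (kmAll .elt φ).Realize v ↔ ∀ y : X, φ.Realize (Sum.elim v fun _ => .inr y) := by
  let _ := D.pre.str
  have hsort : ∀ x : W ⊕ X,
      RelMap (L := kmLang L) (FlatRel.isSort KMSort.elt) ![x] ↔ ∃ p, x = .inr p :=
    fun x => Iff.rfl
  simp only [kmAll, Formula.realize_iAlls]
  constructor
  · intro h q
    have := h fun _ => .inr q
    rw [Formula.Realize, BoundedFormula.realize_imp, realize_inSort, hsort] at this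
    exact this ⟨q, rfl⟩
  · intro h x
    rw [Formula.Realize, BoundedFormula.realize_imp, realize_inSort, hsort]
    rintro ⟨q, hq⟩
    have hx : x = fun _ => .inr q := funext fun _ => hq
    rw [hx]
    exact h q

theorem realize_kmAtom {V : Type} {l : ℕ} (R : KMRel L l) (ts : Fin l → V) (v : V → W ⊕ X) :
    letI := D.pre.str
    (kmAtom R ts).Realize v ↔ D.pre.rel (FlatRel.of R) (v ∘ ts) := by
  let _ := D.pre.str
  rw [kmAtom, Formula.Realize, realize_atom]
  rfl

theorem realize_kmAllBelow {V : Type} (φ : (kmLang L).Formula (V ⊕ Unit)) (v : V → W ⊕ X) {p : V}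
    {w : W} (hp : v p = .inl w) :
    letI := D.pre.str
    (kmAllBelow p φ).Realize v ↔
      ∀ q : W, D.le q w → φ.Realize (Sum.elim v fun _ => .inl q) := by
  let _ := D.pre.str
  rw [kmAllBelow, realize_kmAll_world]
  refine forall_congr' fun q => ?_
  rw [Formula.realize_imp, realize_kmAtom]
  refine imp_congr_left ⟨?_, fun h => ⟨q, w, rfl, hp, h⟩⟩
  rintro ⟨q', w', hq, hw, h⟩
  have h1 : q = q' := Sum.inl.inj hq
  have h2 : w = w' := Sum.inl.inj (hp.symm.trans hw)
  rwa [h1, h2]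

theorem realize_forceAtom {V : Type} {l : ℕ} (R : KMRel L (l + 1)) (v : V → W ⊕ X) {p : V}
    {w : W} (hp : v p = .inl w) (x : Fin l → V) :
    letI := D.pre.str
    (forceAtom R p x).Realize v ↔ ∀ q, D.le q w → ∃ r, D.le r q ∧
      D.pre.rel (FlatRel.of R) (Fin.cons (.inl r) (v ∘ x)) := by
  let _ := D.pre.str
  rw [forceAtom, D.realize_kmAllBelow _ v hp]
  refine forall_congr' fun q => imp_congr_right fun _ => ?_
  rw [Formula.realize_not, D.realize_kmAllBelow _ _ (w := q) rfl]
  simp only [Formula.realize_not, realize_kmAtom]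
  push Not
  refine exists_congr fun r => and_congr_right fun _ => iff_of_eq (congrArg _ ?_)
  funext i
  refine Fin.cases rfl (fun j => rfl) i

/-- The formula `force φ` of `KM` expresses forcing. -/
theorem realize_force [L.IsRelational] {α : Type} : ∀ {n : ℕ} (φ : L.BoundedFormula α n) {V : Type}
    (e : α ⊕ Fin n → V) (p : V) (v : V → W ⊕ X) (x : α ⊕ Fin n → X) (w : W)
    (_ : ∀ a, v (e a) = .inr (x a)) (_ : v p = .inl w),
    letI := D.pre.str
    (force φ e p).Realize v ↔ D.Forces φ x w := by
  let _ := D.pre.str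
  intro n φ
  induction φ with
  | falsum => intros; exact Iff.rfl
  | equal t₁ t₂ =>
    intro V e p v x w he hp
    rw [force, D.realize_forceAtom _ _ hp, Forces]
    constructor
    · intro h
      obtain ⟨r, -, p', y, -, h1, h2⟩ := h w (D.refl w)
      have h1' : v (e (termVar t₁)) = .inr y := h1
      have h2' : v (e (termVar t₂)) = .inr y := h2
      rw [he] at h1' h2'
      rw [Sum.inr.inj h1', Sum.inr.inj h2']
    · intro h q _
      refine ⟨q, D.refl q, q, x (termVar t₁), rfl, he _, ?_⟩
      rw [h]
      exact he _
  | rel R ts =>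
    intro V e p v x w he hp
    rw [force, D.realize_forceAtom _ _ hp, Forces]
    refine forall_congr' fun q => imp_congr_right fun _ => exists_congr fun r =>
      and_congr_right fun _ => ?_
    rw [pre_star_iff]
    refine ⟨?_, fun h => ⟨r, _, rfl, fun i => he _, h⟩⟩
    rintro ⟨r', y, hr, hy, h⟩
    obtain rfl : r = r' := Sum.inl.inj hr
    have : (fun i => x (termVar (ts i))) = y := by
      funext i
      have := hy i
      rw [Fin.cons_succ, Function.comp, he] at this
      exact Sum.inr.inj this
    rwa [this]
  | imp φ ψ ih₁ ih₂ =>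
    intro V e p v x w he hp
    rw [force, D.realize_kmAllBelow _ _ hp, Forces]
    refine forall_congr' fun q => imp_congr_right fun _ => ?_
    rw [Formula.realize_not, Formula.realize_inf, D.realize_kmAllBelow _ _ (w := q) rfl,
      ih₁ (fun a => Sum.inl (e a)) (Sum.inr ()) (Sum.elim v fun _ => .inl q) x q (fun a => he a)
        rfl]
    refine not_congr (and_congr_right fun _ => forall_congr' fun r => imp_congr_right fun _ => ?_)
    rw [Formula.realize_not, ih₂ (fun a => Sum.inl (Sum.inl (e a))) (Sum.inr ())
      (Sum.elim (Sum.elim v fun _ => .inl q) fun _ => .inl r) x r (fun a => he a) rfl]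
  | all φ ih =>
    intro V e p v x w he hp
    rw [force, D.realize_kmAllBelow _ _ hp, Forces]
    refine forall_congr' fun q => imp_congr_right fun _ => ?_
    rw [realize_kmAll_elt]
    refine forall_congr' fun y => ?_
    rw [Formula.realize_imp, realize_kmAtom]
    refine (imp_iff_right ⟨q, y, rfl, rfl⟩).trans (ih _ _ _ _ q (fun a => ?_) rfl)
    have h1 := congrFun (extend_comp
      (Sum.elim (Sum.elim v fun _ => Sum.inl q) fun _ : Unit => Sum.inr y)
      (fun a => Sum.inl (Sum.inl (e a))) (Sum.inr () : (V ⊕ Unit) ⊕ Unit)) a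
    have h2 := congrFun (extend_comp (Sum.inr : X → W ⊕ X) x y) a
    refine h1.trans (Eq.trans ?_ h2.symm)
    refine congrFun (congrArg (fun z => extend z (Sum.inr y)) ?_) a
    funext b
    exact he b

end Realize

section Forcing

variable [L.IsRelational] {D}

theorem Forces.mono {α : Type*} : ∀ {n : ℕ} {φ : L.BoundedFormula α n}
    {e : α ⊕ Fin n → X} {p q : W},
    D.le q p → D.Forces φ e p → D.Forces φ e q := by
  intro n φ e p q hq h
  cases φ with
  | falsum => exact h
  | equal t₁ t₂ => exact h
  | rel R ts => exact fun r hr => h r (D.trans hr hq)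
  | imp φ ψ => exact fun r hr => h r (D.trans hr hq)
  | all φ => exact fun r hr => h r (D.trans hr hq)

/-- What is forced densely below a world is forced there. -/
theorem forces_of_dense {α : Type*} : ∀ {n : ℕ} {φ : L.BoundedFormula α n}
    {e : α ⊕ Fin n → X} {p : W},
    (∀ q, D.le q p → ∃ r, D.le r q ∧ D.Forces φ e r) → D.Forces φ e p := by
  intro n φ
  induction φ with
  | falsum =>
    intro e p h
    obtain ⟨r, -, hr⟩ := h p (D.refl p)
    exact hr
  | equal t₁ t₂ =>
    intro e p h
    obtain ⟨r, -, hr⟩ := h p (D.refl p)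
    exact hr
  | rel R ts =>
    intro e p h q hq
    obtain ⟨r, hr, hf⟩ := h q hq
    obtain ⟨s, hs, hs'⟩ := hf r (D.refl r)
    exact ⟨s, D.trans hs hr, hs'⟩
  | imp φ ψ ih₁ ih₂ =>
    rintro e p h q hq ⟨h1, h2⟩
    obtain ⟨r, hr, hf⟩ := h q hq
    exact hf r (D.refl r) ⟨h1.mono hr, fun s hs => h2 s (D.trans hs hr)⟩
  | all φ ih =>
    intro e p h q hq x
    refine ih fun r hr => ?_
    obtain ⟨s, hs, hf⟩ := h r (D.trans hr hq)
    exact ⟨s, hs, hf s (D.refl s) x⟩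

variable {α : Type*} {n : ℕ} {φ ψ : L.BoundedFormula α n} {e : α ⊕ Fin n → X} {p : W}

/-- As forcing is closed under density, the implication read as `¬ (φ ∧ ¬ ψ)` is forced in the
usual sense. -/
theorem forces_imp : D.Forces (φ.imp ψ) e p ↔
    ∀ q, D.le q p → D.Forces φ e q → D.Forces ψ e q := by
  constructor
  · intro h q hq hφ
    refine forces_of_dense fun r hr => ?_
    by_contra hno
    push Not at hno
    exact h r (D.trans hr hq) ⟨hφ.mono hr, hno⟩
  · rintro h q hq ⟨hφ, hψ⟩
    exact hψ q (D.refl q) (h q hq hφ)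

theorem forces_not : D.Forces φ.not e p ↔ ∀ q, D.le q p → ¬ D.Forces φ e q :=
  forces_imp

theorem forces_inf : D.Forces (φ ⊓ ψ) e p ↔ D.Forces φ e p ∧ D.Forces ψ e p := by
  change D.Forces (φ.imp ψ.not).not e p ↔ _
  simp only [forces_not, forces_imp]
  constructor
  · intro h
    constructor <;> refine forces_of_dense fun _ hq => ?_ <;> by_contra hno <;> push Not at hno
    · exact h _ hq fun r hr hφ => absurd hφ (hno r hr)
    · exact h _ hq fun r hr _ s hs hψ => hno s (D.trans hs hr) hψ
  · rintro ⟨h1, h2⟩ q hq h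
    exact h q (D.refl q) (h1.mono hq) q (D.refl q) (h2.mono hq)

theorem forces_sup : D.Forces (φ ⊔ ψ) e p ↔
    ∀ q, D.le q p → ∃ r, D.le r q ∧ (D.Forces φ e r ∨ D.Forces ψ e r) := by
  change D.Forces (φ.not.imp ψ) e p ↔ _
  rw [forces_imp]
  simp only [forces_not]
  constructor
  · intro h q hq
    by_cases hφ : ∀ r, D.le r q → ¬ D.Forces φ e r
    · exact ⟨q, D.refl q, Or.inr (h q hq hφ)⟩
    · push Not at hφ
      obtain ⟨r, hr, hφ⟩ := hφ
      exact ⟨r, hr, Or.inl hφ⟩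
  · intro h q hq hφ
    refine forces_of_dense fun r hr => ?_
    obtain ⟨s, hs, h | h⟩ := h r (D.trans hr hq)
    · exact absurd h (hφ s (D.trans hs hr))
    · exact ⟨s, hs, h⟩

theorem forces_iff : D.Forces (φ.iff ψ) e p ↔
    ∀ q, D.le q p → (D.Forces φ e q ↔ D.Forces ψ e q) := by
  rw [BoundedFormula.iff, forces_inf, forces_imp, forces_imp]
  exact ⟨fun h q hq => ⟨h.1 q hq, h.2 q hq⟩,
    fun h => ⟨fun q hq => (h q hq).1, fun q hq => (h q hq).2⟩⟩

theorem forces_all {φ : L.BoundedFormula α (n + 1)} : D.Forces φ.all e p ↔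
    ∀ x, D.Forces φ (extend e x) p :=
  ⟨fun h x => h p (D.refl p) x, fun h _ hq x => (h x).mono hq⟩

theorem forces_ex {φ : L.BoundedFormula α (n + 1)} : D.Forces φ.ex e p ↔
    ∀ q, D.le q p → ∃ r, D.le r q ∧ ∃ x, D.Forces φ (extend e x) r := by
  rw [BoundedFormula.ex, forces_not]
  refine forall_congr' fun q => imp_congr_right fun _ => ?_
  rw [forces_all]
  simp only [forces_not]
  push Not
  exact ⟨fun ⟨x, r, hr, h⟩ => ⟨r, hr, x, h⟩, fun ⟨r, hr, x, h⟩ => ⟨x, r, hr, h⟩⟩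

theorem forces_alls : ∀ {n : ℕ} {φ : L.BoundedFormula α n} {e : α → X},
    D.Forces φ.alls (Sum.elim e Fin.elim0) p ↔ ∀ xs : Fin n → X, D.Forces φ (Sum.elim e xs) p := by
  intro n
  induction n with
  | zero =>
    intro φ e
    constructor
    · intro h xs
      rw [Subsingleton.elim xs Fin.elim0]
      exact h
    · intro h
      exact h _
  | succ n ih =>
    intro φ e
    have hext : ∀ (xs : Fin n → X) x, extend (Sum.elim e xs) x = Sum.elim e (Fin.snoc xs x) :=
      fun _ _ => rfl
    rw [BoundedFormula.alls, ih]
    simp only [forces_all, hext]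
    constructor
    · intro h xs
      have := h (Fin.init xs) (xs (Fin.last n))
      rwa [Fin.snoc_init_self] at this
    · intro h xs x
      exact h _

/-- Equality being genuine, the axioms of equality are forced. -/
theorem forces_eqAxioms {φ : L.Sentence} (hφ : φ ∈ eqAxioms L) :
    D.Forces φ (Sum.elim Empty.elim Fin.elim0) p := by
  rcases hφ with (rfl | rfl | rfl) | ⟨n, R, i, rfl⟩
  · rw [eqRefl, forces_all]
    exact fun x => rfl
  · rw [eqSymm]
    simp only [forces_all, forces_imp]
    intro x y q _ h
    exact Eq.symm h
  · rw [eqTrans]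
    simp only [forces_all, forces_imp]
    intro x y z q _ h q' _ h'
    exact Eq.trans h h'
  · rw [eqCongr, forces_alls]
    simp only [forces_imp]
    intro xs q _ h q' _ h'
    have hxy : xs i.castSucc = xs (Fin.last n) := h
    intro r hr
    obtain ⟨s, hs, hs'⟩ := h' r hr
    refine ⟨s, hs, ?_⟩
    refine (iff_of_eq (congrArg _ (funext fun j => ?_))).1 hs'
    change xs j.castSucc = xs (Function.update Fin.castSucc i (Fin.last n) j)
    by_cases hj : j = i
    · subst hj
      simp [hxy]
    · simp [Function.update_of_ne hj]

end Forcing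

/-- A Kripke model whose worlds force the axioms of `U` is a model of `KM(U)`. -/
theorem models_KM [L.IsRelational] [Nonempty W] [Nonempty X] {U : L.Theory}
    (hU : ∀ φ ∈ U, ∀ p, D.Forces φ (Sum.elim Empty.elim Fin.elim0) p) :
    letI := D.pre.str
    (W ⊕ X) ⊨ KM U := by
  let _ := D.pre.str
  have hw : ∀ x : W ⊕ X,
      RelMap (L := kmLang L) (FlatRel.isSort KMSort.world) ![x] ↔ ∃ p, x = .inl p :=
    fun x => Iff.rfl
  have he : ∀ x : W ⊕ X,
      RelMap (L := kmLang L) (FlatRel.isSort KMSort.elt) ![x] ↔ ∃ p, x = .inr p :=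
    fun x => Iff.rfl
  have hle : ∀ {α : Type} {n : ℕ} (s t : (kmLang L).Term (α ⊕ Fin n)) (v : α → W ⊕ X)
      (xs : Fin n → W ⊕ X), (kmLe s t).Realize v xs ↔
        ∃ p q, s.realize (Sum.elim v xs) = .inl p ∧ t.realize (Sum.elim v xs) = .inl q ∧
          D.le p q := by
    intro α n s t v xs
    rw [kmLe, realize_atom]
    exact Iff.rfl
  have hdom : ∀ {α : Type} {n : ℕ} (s t : (kmLang L).Term (α ⊕ Fin n)) (v : α → W ⊕ X)
      (xs : Fin n → W ⊕ X), (kmDom s t).Realize v xs ↔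
        ∃ p y, s.realize (Sum.elim v xs) = .inl p ∧ t.realize (Sum.elim v xs) = .inr y := by
    intro α n s t v xs
    rw [kmDom, realize_atom]
    exact Iff.rfl
  refine ⟨fun φ hφ => ?_⟩
  rcases hφ with (((hφ | hφ) | ⟨l, R, i, hR, rfl⟩) | ⟨l, R, hR, rfl⟩) | ⟨ψ, hψ, rfl⟩
  · rcases hφ with ((rfl | ⟨s, t, hst, rfl⟩) | ⟨s, rfl⟩) | ⟨l, R, i, rfl⟩
    · simp only [Sentence.Realize, Formula.Realize, BoundedFormula.realize_all,
        BoundedFormula.realize_iSup, realize_inSort]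
      rintro (p | y)
      · exact ⟨.world, p, rfl⟩
      · exact ⟨.elt, y, rfl⟩
    · simp only [Sentence.Realize, Formula.Realize, BoundedFormula.realize_all,
        BoundedFormula.realize_not, BoundedFormula.realize_inf, realize_inSort]
      intro x
      cases s <;> cases t
      · exact absurd rfl hst
      · rintro ⟨⟨p, hp⟩, y, hy⟩
        exact Sum.inl_ne_inr (hp.symm.trans hy)
      · rintro ⟨⟨y, hy⟩, p, hp⟩
        exact Sum.inl_ne_inr (hp.symm.trans hy)
      · exact absurd rfl hst
    · simp only [Sentence.Realize, Formula.Realize, BoundedFormula.realize_ex, realize_inSort]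
      cases s
      · exact ⟨.inl (Classical.arbitrary W), _, rfl⟩
      · exact ⟨.inr (Classical.arbitrary X), _, rfl⟩
    · rw [Sentence.Realize, BoundedFormula.realize_alls]
      intro xs
      rw [BoundedFormula.realize_imp, realize_atom, realize_inSort]
      cases R with
      | le =>
        rintro ⟨p, q, hp, hq, -⟩
        fin_cases i
        · exact ⟨p, hp⟩
        · exact ⟨q, hq⟩
      | dom =>
        rintro ⟨p, q, hp, hq⟩
        fin_cases i
        · exact ⟨p, hp⟩
        · exact ⟨q, hq⟩
      | eqStar =>
        rintro ⟨p, y, hp, hy, hy'⟩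
        fin_cases i
        · exact ⟨p, hp⟩
        · exact ⟨y, hy⟩
        · exact ⟨y, hy'⟩
      | star R =>
        intro h
        obtain ⟨p, y, hp, hy, -⟩ := (D.pre_star_iff R _).1 h
        refine Fin.cases ?_ (fun j => ?_) i
        · exact ⟨p, hp⟩
        · exact ⟨y j, hy j⟩
  · rcases hφ with rfl | rfl | rfl | rfl
    · simp only [kmRefl, allS, Sentence.Realize, Formula.Realize, BoundedFormula.realize_all,
        BoundedFormula.realize_imp, realize_inSort, hle]
      rintro x ⟨p, hp⟩
      exact ⟨p, p, hp, hp, D.refl p⟩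
    · simp only [kmTrans, allS, Sentence.Realize, Formula.Realize, BoundedFormula.realize_all,
        BoundedFormula.realize_imp, BoundedFormula.realize_inf, realize_inSort, hle]
      rintro x - y - z - ⟨⟨p, q, hp, hq, hpq⟩, q', r, hq', hr, hqr⟩
      obtain rfl : q = q' := Sum.inl.inj (hq.symm.trans hq')
      exact ⟨p, r, hp, hr, D.trans hpq hqr⟩
    · simp only [kmDomNonempty, allS, exS, Sentence.Realize, Formula.Realize,
        BoundedFormula.realize_all, BoundedFormula.realize_ex, BoundedFormula.realize_inf,
        BoundedFormula.realize_imp, realize_inSort, hdom]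
      rintro x ⟨p, hp⟩
      exact ⟨.inr (Classical.arbitrary X), ⟨_, rfl⟩, p, _, hp, rfl⟩
    · simp only [kmDomMono, allS, Sentence.Realize, Formula.Realize, BoundedFormula.realize_all,
        BoundedFormula.realize_imp, realize_inSort, hle, hdom]
      rintro x - y - ⟨q, p, hq, hp, -⟩ z - ⟨p', a, hp', ha⟩
      exact ⟨q, a, hq, ha⟩
  · rw [kmStarDom, Sentence.Realize, BoundedFormula.realize_alls]
    intro xs
    rw [BoundedFormula.realize_imp, realize_atom, hdom]
    cases hR with
    | star R =>
      intro h
      obtain ⟨p, y, hp, hy, -⟩ := (D.pre_star_iff R _).1 h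
      exact ⟨p, y i, hp, hy i⟩
    | eqStar =>
      rintro ⟨p, y, hp, hy, hy'⟩
      fin_cases i
      · exact ⟨p, y, hp, hy⟩
      · exact ⟨p, y, hp, hy'⟩
  · rw [kmStarMono, Sentence.Realize, BoundedFormula.realize_alls]
    intro xs
    rw [BoundedFormula.realize_imp, BoundedFormula.realize_imp, realize_atom, realize_atom, hle]
    rintro ⟨q, p, hq, hp, hqp⟩
    cases hR with
    | star R =>
      intro h
      obtain ⟨p', y, hp', hy, h⟩ := (D.pre_star_iff R _).1 h
      obtain rfl : p = p' := Sum.inl.inj (hp.symm.trans hp')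
      exact (D.pre_star_iff R _).2 ⟨q, y, hq, fun i => hy i, D.mono R hqp h⟩
    | eqStar =>
      rintro ⟨p', y, hp', hy, hy'⟩
      exact ⟨q, y, hq, hy, hy'⟩
  · rw [forced, Sentence.Realize, realize_kmAll_world]
    intro q
    rw [D.realize_force ψ _ _ _ (Sum.elim Empty.elim Fin.elim0) q ?_ rfl]
    · rcases hψ with hψ | hψ
      · exact hU ψ hψ q
      · exact forces_eqAxioms hψ
    · rintro (a | i)
      · exact a.elim
      · exact i.elim0

end Kripke

end Kripke

/-! ### Definable Kripke models -/

section DefinableKripke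

variable {L : FirstOrder.Language.{u, v}} {H : Type w}

/-- The structure for the language of `KM` with the worlds `Wd`, the elements `Ob`, the order `Le`
and the predicates `Star`, restricted to arguments of the right sorts. -/
def kripkePre (L : FirstOrder.Language.{u, v}) (Wd Ob : H → Prop) (Le : H → H → Prop)
    (Star : ∀ {n : ℕ}, L.Relations n → H → (Fin n → H) → Prop) : Pre (kmLang L) H where
  dom x := Wd x ∨ Ob x
  eq x y := x = y
  rel R x := match R with
    | .isSort .world => Wd (x 0)
    | .isSort .elt => Ob (x 0)
    | .of .le => Wd (x 0) ∧ Wd (x 1) ∧ Le (x 0) (x 1)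
    | .of .dom => Wd (x 0) ∧ Ob (x 1)
    | .of (.star R) => Wd (x 0) ∧ (∀ i, Ob (Fin.tail x i)) ∧ Star R (x 0) (Fin.tail x)
    | .of .eqStar => Wd (x 0) ∧ Ob (x 1) ∧ x 1 = x 2

open Classical in
/-- The structure with the definable worlds and elements is isomorphic to the Kripke model on the
corresponding subtypes. -/
theorem kripkePre_presents {Wd Ob : H → Prop} {Le : H → H → Prop}
    {Star : ∀ {n : ℕ}, L.Relations n → H → (Fin n → H) → Prop}
    (hdisj : ∀ x, Ob x → ¬ Wd x) (D : Kripke L {x // Wd x} {x // Ob x}) [Nonempty {x // Wd x}]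
    (hle : ∀ p q, D.le p q ↔ Le p q)
    (hstar : ∀ {n} (R : L.Relations n) p x, D.star R p x ↔ Star R p fun i => x i) :
    letI := D.pre.str
    ∃ f, (kripkePre L Wd Ob Le Star).Presents ({x // Wd x} ⊕ {x // Ob x}) f := by
  let _ := D.pre.str
  let f : H → {x // Wd x} ⊕ {x // Ob x} := fun x =>
    if h : Wd x then .inl ⟨x, h⟩ else if h : Ob x then .inr ⟨x, h⟩ else
      .inl (Classical.arbitrary _)
  have hW : ∀ {x} (h : Wd x), f x = .inl ⟨x, h⟩ := fun h => dif_pos h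
  have hO : ∀ {x} (h : Ob x), f x = .inr ⟨x, h⟩ := fun h =>
    (dif_neg (hdisj _ h)).trans (dif_pos h)
  have hWi : ∀ {x}, Wd x ∨ Ob x → ∀ {p}, f x = .inl p → x = p.1 := by
    rintro x (h | h) p hp
    · rw [hW h] at hp
      exact congrArg Subtype.val (Sum.inl.inj hp)
    · rw [hO h] at hp
      cases hp
  have hOi : ∀ {x}, Wd x ∨ Ob x → ∀ {p}, f x = .inr p → x = p.1 := by
    rintro x (h | h) p hp
    · rw [hW h] at hp
      cases hp
    · rw [hO h] at hp
      exact congrArg Subtype.val (Sum.inr.inj hp)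
  refine ⟨f, ⟨?_, ?_, ?_⟩⟩
  · rintro (⟨x, h⟩ | ⟨x, h⟩)
    · exact ⟨x, Or.inl h, hW h⟩
    · exact ⟨x, Or.inr h, hO h⟩
  · intro x y hx hy
    refine ⟨congrArg f, fun h => ?_⟩
    rcases hy with hy | hy
    · rw [hW hy] at h
      exact hWi hx h
    · rw [hO hy] at h
      exact hOi hx h
  · intro n R x hx
    change _ ↔ D.pre.rel R (f ∘ x)
    cases R with
    | isSort s =>
      cases s with
      | world =>
        refine ⟨fun h => ⟨⟨x 0, h⟩, hW h⟩, ?_⟩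
        rintro ⟨p, hp⟩
        have := hWi (hx 0) hp
        change Wd (x 0)
        exact this ▸ p.2
      | elt =>
        refine ⟨fun h => ⟨⟨x 0, h⟩, hO h⟩, ?_⟩
        rintro ⟨p, hp⟩
        have := hOi (hx 0) hp
        change Ob (x 0)
        exact this ▸ p.2
    | of R =>
      cases R with
      | le =>
        constructor
        · rintro ⟨h0, h1, h⟩
          exact ⟨⟨x 0, h0⟩, ⟨x 1, h1⟩, hW h0, hW h1, (hle _ _).2 h⟩
        · rintro ⟨p, q, hp, hq, h⟩
          have h0 := hWi (hx 0) hp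
          have h1 := hWi (hx 1) hq
          change Wd (x 0) ∧ Wd (x 1) ∧ Le (x 0) (x 1)
          rw [h0, h1]
          exact ⟨p.2, q.2, (hle _ _).1 h⟩
      | dom =>
        constructor
        · rintro ⟨h0, h1⟩
          exact ⟨⟨x 0, h0⟩, ⟨x 1, h1⟩, hW h0, hO h1⟩
        · rintro ⟨p, q, hp, hq⟩
          have h0 := hWi (hx 0) hp
          have h1 := hOi (hx 1) hq
          change Wd (x 0) ∧ Ob (x 1)
          rw [h0, h1]
          exact ⟨p.2, q.2⟩
      | eqStar =>
        constructor
        · rintro ⟨h0, h1, h⟩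
          exact ⟨⟨x 0, h0⟩, ⟨x 1, h1⟩, hW h0, hO h1, (congrArg f h.symm).trans (hO h1)⟩
        · rintro ⟨p, q, hp, hq, hq'⟩
          have h0 := hWi (hx 0) hp
          have h1 := hOi (hx 1) hq
          have h2 := hOi (hx 2) hq'
          change Wd (x 0) ∧ Ob (x 1) ∧ x 1 = x 2
          rw [h0, h1, h2]
          exact ⟨p.2, q.2, rfl⟩
      | star R =>
        rw [D.pre_star_iff]
        simp only [kripkePre]
        constructor
        · rintro ⟨h0, h1, h⟩
          exact ⟨⟨x 0, h0⟩, fun i => ⟨_, h1 i⟩, hW h0, fun i => hO (h1 i), (hstar _ _ _).2 h⟩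
        · rintro ⟨p, y, hp, hy, h⟩
          have h0 := hWi (hx 0) hp
          have h1 : Fin.tail x = fun i => (y i).1 := funext fun i => hOi (hx i.succ) (hy i)
          rw [h0, h1]
          exact ⟨p.2, fun i => (y i).2, (hstar _ _ _).1 h⟩

theorem kripkePre_upre {K : FirstOrder.Language.{u₁, v₁}} {V : Type}
    {Wd Ob : ∀ (N : Type w) [K.Structure N], N → Prop}
    {Le : ∀ (N : Type w) [K.Structure N], N → N → Prop}
    {Star : ∀ (N : Type w) [K.Structure N] {n : ℕ}, L.Relations n → N → (Fin n → N) → Prop}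
    (hW : ∀ {V : Type} (a : V), UD K fun N _ (v : V → N) => Wd N (v a))
    (hO : ∀ {V : Type} (a : V), UD K fun N _ (v : V → N) => Ob N (v a))
    (hle : ∀ {V : Type} (a b : V), UD K fun N _ (v : V → N) => Le N (v a) (v b))
    (hstar : ∀ {V : Type} {n : ℕ} (R : L.Relations n) (a : V) (g : Fin n → V),
      UD K fun N _ (v : V → N) => Star N R (v a) fun i => v (g i)) :
    UPre K fun N _ (_ : V → N) => kripkePre L (Wd N) (Ob N) (Le N) (Star N) where
  dom _ a := UD.or (hW a) (hO a)
  eq _ a b := UD.eq a b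
  rel R _ a := by
    cases R with
    | isSort s =>
      cases s with
      | world => exact hW _
      | elt => exact hO _
    | of R =>
      cases R with
      | le => exact UD.and (hW _) (UD.and (hW _) (hle _ _))
      | dom => exact UD.and (hW _) (hO _)
      | eqStar => exact UD.and (hW _) (UD.and (hO _) (UD.eq _ _))
      | star R =>
        simp only [kripkePre]
        exact UD.and (hW _) (UD.and (UD.forall_index fun i => hO _) (hstar R _ _))

end DefinableKripke

/-! ### Forcing adjunctive sets -/

section Generic

variable {L : FirstOrder.Language.{u, v}} {r : ℕ} {H : Type w}

namespace HData

variable (D : HData L (r + 2) H)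

/-- The set with code `w` contains a tuple that begins with the object `z` and the class `k`. -/
def Pair (w z k : H) : Prop :=
  D.obj z ∧ D.cls k ∧ ∃ t : Fin (r + 2) → H, (∀ j, D.elt (t j)) ∧ t 0 = z ∧ t 1 = k ∧ D.tup w t

/-- The object `z` has been assigned a class by `w`. -/
def Supp (w z : H) : Prop := ∃ k, D.Pair w z k

/-- The object `y` belongs to the class that `w` assigns to `z`. -/
def MemAt (w y z : H) : Prop := D.obj y ∧ ∃ k, D.Pair w z k ∧ D.mem y k

/-- The condition `q` assigns classes to at least the objects to which `p` does, and the same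
ones to these. -/
def Le (q p : H) : Prop :=
  ∀ z, D.Supp p z → D.Supp q z ∧ ∀ y, D.MemAt q y z ↔ D.MemAt p y z

variable {κ : ℕ} (c : (Σ n : ℕ, L.Relations n) ≃ Fin κ)
  (hc : ∀ R : Σ n : ℕ, L.Relations n, R.1 ≤ r + 2) [L.IsRelational] (F : L.Theory)
  {ι : Type} (τ : Tr L L ι)

/-- The conditions of the forcing: codes of partial functions from objects to classes, up to
coextensiveness of classes, with a small domain. -/
structure IsWorld (w : H) : Prop where
  code : D.code w
  nice : D.Nice c hc τ (D.Supp w)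
  small : D.Small c F (D.Supp w)
  unique : ∀ z k k', D.Pair w z k → D.Pair w z k' → ∀ y, D.obj y → (D.mem y k ↔ D.mem y k')

/-- The predicates of the Kripke model: those of `L` do not depend on the world, and `y ∈ z` holds
at `w` if `y` belongs to the class that `w` assigns to `z`. -/
def Star {n : ℕ} (R : (L.sum memLang).Relations n) (w : H) (x : Fin n → H) : Prop :=
  match R with
  | .inl R => D.base R x
  | .inr .mem => D.MemAt w (x 0) (x 1)

/-- The Kripke model of the partial functions from objects to classes with a small domain. -/
def kripke : Kripke (L.sum memLang) {w // D.IsWorld c hc F τ w} {x // D.obj x} where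
  le q p := D.Le q p
  star R p x := D.Star R p fun i => x i
  refl p z hz := ⟨hz, fun y => Iff.rfl⟩
  trans hpq hqr z hz := ⟨(hpq z (hqr z hz).1).1, fun y =>
    ((hpq z (hqr z hz).1).2 y).trans ((hqr z hz).2 y)⟩
  mono R p q x hqp h := by
    rcases R with R | R
    · exact h
    · cases R
      obtain ⟨hy, k, hk, hm⟩ := h
      exact ((hqp _ ⟨k, hk⟩).2 _).2 ⟨hy, k, hk, hm⟩

variable {D c hc F τ} {T : L.Theory}

/-- The empty partial function is a condition. -/
theorem HasSets.exists_isWorld (hD : D.HasSets T) : ∃ w, D.IsWorld c hc F τ w := by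
  obtain ⟨w, hw, hno⟩ := hD.code_empty
  have hP : ∀ z k, ¬ D.Pair w z k := fun z k ⟨_, _, t, ht, _, _, htup⟩ => hno t ht htup
  have hS : ∀ z, ¬ D.Supp w z := fun z ⟨k, hk⟩ => hP z k hk
  exact ⟨w, hw, fun i θ => hD.niceFor_empty hS, Small.of_empty hS,
    fun z k k' h => absurd h (hP z k)⟩

/-- Any class can be assigned to an object outside of the domain of a condition, as niceness and
smallness of the domain are preserved when an object is added to it. -/
theorem IsWorld.exists_extend {w : H} (hw : D.IsWorld c hc F τ w)
    (hF : ∀ (N : Type w) [L.Structure N] [Nonempty N], N ⊨ F ↔ N ⊨ T)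
    (hτ : Tr.Shrinks.{u, v, w} τ T)
    (hD : D.HasSets T) {z k : H} (hz : D.obj z) (hzw : ¬ D.Supp w z) (hk : D.cls k) :
    ∃ w', D.IsWorld c hc F τ w' ∧ D.Le w' w ∧ D.Supp w' z ∧
      ∀ y, D.obj y → (D.MemAt w' y z ↔ D.mem y k) := by
  obtain ⟨w', hw', ht'⟩ := hD.code_adjoin w (Fin.cons z fun _ => k) hw.code
    fun j => Fin.cases (Or.inl hz) (fun _ => Or.inr hk) j
  have hP : ∀ z' k', D.Pair w' z' k' ↔ D.Pair w z' k' ∨ (z' = z ∧ k' = k) := by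
    intro z' k'
    constructor
    · rintro ⟨hz', hk', t, ht, h0, h1, htup⟩
      rcases (ht' t ht).1 htup with h | rfl
      · exact Or.inl ⟨hz', hk', t, ht, h0, h1, h⟩
      · exact Or.inr ⟨h0.symm, h1.symm⟩
    · rintro (⟨hz', hk', t, ht, h0, h1, htup⟩ | ⟨rfl, rfl⟩)
      · exact ⟨hz', hk', t, ht, h0, h1, (ht' t ht).2 (Or.inl htup)⟩
      · have ht : ∀ j, D.elt ((Fin.cons z' fun _ => k' : Fin (r + 2) → H) j) :=
          fun j => Fin.cases (Or.inl hz) (fun _ => Or.inr hk) j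
        exact ⟨hz, hk, _, ht, rfl, rfl, (ht' _ ht).2 (Or.inr rfl)⟩
  have hS : ∀ z', D.Supp w' z' ↔ D.Supp w z' ∨ z' = z := by
    intro z'
    simp only [Supp, hP]
    constructor
    · rintro ⟨k', h | ⟨h, -⟩⟩
      exacts [Or.inl ⟨k', h⟩, Or.inr h]
    · rintro (⟨k', h⟩ | h)
      exacts [⟨k', Or.inl h⟩, ⟨k, Or.inr ⟨h, rfl⟩⟩]
  have hno : ∀ k', ¬ D.Pair w z k' := fun k' h => hzw ⟨k', h⟩
  refine ⟨w', ⟨hw', fun i θ => (hw.nice i θ).adjoin hz hS, ?_, ?_⟩, ?_, (hS z).2 (Or.inr rfl), ?_⟩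
  · refine Small.adjoin hF hτ hD ?_ hw.small hw.nice fun x => (hS x).1
    rintro x ⟨k, hx, -⟩
    exact hx
  · intro z' k₁ k₂ h₁ h₂ y hy
    rcases (hP _ _).1 h₁ with h₁ | ⟨rfl, rfl⟩
    · rcases (hP _ _).1 h₂ with h₂ | ⟨rfl, rfl⟩
      · exact hw.unique z' k₁ k₂ h₁ h₂ y hy
      · exact absurd h₁ (hno _)
    · rcases (hP _ _).1 h₂ with h₂ | ⟨-, rfl⟩
      · exact absurd h₂ (hno _)
      · exact Iff.rfl
  · intro z' hz'
    have hne : z' ≠ z := by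
      rintro rfl
      exact hzw hz'
    refine ⟨(hS z').2 (Or.inl hz'), fun y => ?_⟩
    simp only [MemAt, hP, hne, false_and, or_false]
  · intro y hy
    simp only [MemAt, hP, hno, false_or, true_and, hy, exists_eq_left]

/-- Objects at which a condition is defined have their elements decided by it. -/
theorem forces_asMem {α : Type*} {n : ℕ} (s t : (L.sum memLang).Term (α ⊕ Fin n))
    {e : α ⊕ Fin n → {x // D.obj x}} {p : {w // D.IsWorld c hc F τ w}}
    (h : D.Supp p (e (termVar t))) :
    (D.kripke c hc F τ).Forces (asMem L s t) e p ↔ D.MemAt p (e (termVar s)) (e (termVar t)) := by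
  constructor
  · intro hf
    obtain ⟨q, hq, hm⟩ := hf p ((D.kripke c hc F τ).refl p)
    exact ((hq _ h).2 _).1 hm
  · intro hm q hq
    exact ⟨q, (D.kripke c hc F τ).refl q, ((hq _ h).2 _).2 hm⟩

/-- The predicates of `L` being independent of the world, forcing is truth for formulas of `L`. -/
theorem forces_onFormula {α : Type*} : ∀ {n : ℕ} (φ : L.BoundedFormula α n)
    {e : α ⊕ Fin n → {x // D.obj x}} {p : {w // D.IsWorld c hc F τ w}},
    (D.kripke c hc F τ).Forces (LHom.sumInl.onBoundedFormula φ) e p ↔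
      D.objPre.Sat φ fun a => e a := by
  have hterm : ∀ {β : Type _} (t : L.Term β),
      termVar ((LHom.sumInl : L →ᴸ L.sum memLang).onTerm t) = termVar t := by
    intro β t
    cases t with
    | var => rfl
    | func f _ => exact isEmptyElim f
  intro n φ
  induction φ with
  | falsum => intros; exact Iff.rfl
  | equal t₁ t₂ =>
    intro e p
    change e (termVar _) = e (termVar _) ↔ (_ : H) = _
    rw [hterm, hterm, Subtype.ext_iff]
  | rel R ts =>
    intro e p
    have hx : (fun i => (e (termVar ((LHom.sumInl : L →ᴸ L.sum memLang).onTerm (ts i)))).1) =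
        fun i => (e (termVar (ts i))).1 := by
      simp only [hterm]
    change (∀ q, _ → ∃ r, _ ∧ D.base R _) ↔ D.base R _
    constructor
    · intro h
      obtain ⟨q, -, hq⟩ := h p ((D.kripke c hc F τ).refl p)
      rw [← hx]
      exact hq
    · intro h q _
      refine ⟨q, (D.kripke c hc F τ).refl q, ?_⟩
      rw [← hx] at h
      exact h
  | imp φ ψ ih₁ ih₂ =>
    intro e p
    refine Kripke.forces_imp.trans ?_
    simp only [ih₁, ih₂]
    exact ⟨fun h => h p ((D.kripke c hc F τ).refl p), fun h _ _ => h⟩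
  | all φ ih =>
    intro e p
    refine Kripke.forces_all.trans ?_
    simp only [ih]
    rw [Subtype.forall]
    refine forall_congr' fun x => forall_congr' fun hx => iff_of_eq (congrArg _ ?_)
    exact extend_comp Subtype.val e ⟨x, hx⟩

/-- There is always an object to which no class has been assigned yet. -/
theorem IsWorld.exists_new (hF : ∀ (N : Type w) [L.Structure N] [Nonempty N], N ⊨ F ↔ N ⊨ T)
    (hτ : Tr.Shrinks.{u, v, w} τ T) (hD : D.HasSets T) {p : H} (hp : D.IsWorld c hc F τ p)
    {k : H} (hk : D.cls k) :
    ∃ (q : {w // D.IsWorld c hc F τ w}) (z : {x // D.obj x}), D.Le q p ∧ D.Supp q z ∧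
      ∀ y, D.obj y → (D.MemAt q y z ↔ D.mem y k) := by
  obtain ⟨z, hz, hzp⟩ := hp.small.exists_not hF hD
  obtain ⟨q, hq, h1, h2, h3⟩ := hp.exists_extend hF hτ hD hz hzp hk
  exact ⟨⟨q, hq⟩, ⟨z, hz⟩, h1, h2, h3⟩

/-- Any object can be put into the domain of a condition. -/
theorem IsWorld.exists_supp (hF : ∀ (N : Type w) [L.Structure N] [Nonempty N], N ⊨ F ↔ N ⊨ T)
    (hτ : Tr.Shrinks.{u, v, w} τ T) (hD : D.HasSets T) {p : H} (hp : D.IsWorld c hc F τ p)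
    {z : H} (hz : D.obj z) :
    ∃ q : {w // D.IsWorld c hc F τ w}, D.Le q p ∧ D.Supp q z := by
  by_cases hzp : D.Supp p z
  · exact ⟨⟨p, hp⟩, (D.kripke c hc F τ).refl ⟨p, hp⟩, hzp⟩
  · obtain ⟨k, hk, -⟩ := hD.cls_empty
    obtain ⟨q, hq, h1, h2, -⟩ := hp.exists_extend hF hτ hD hz hzp hk
    exact ⟨⟨q, hq⟩, h1, h2⟩

/-- A new object gets the empty class. -/
theorem forces_asEmpty (hF : ∀ (N : Type w) [L.Structure N] [Nonempty N], N ⊨ F ↔ N ⊨ T)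
    (hτ : Tr.Shrinks.{u, v, w} τ T) (hD : D.HasSets T) (p : {w // D.IsWorld c hc F τ w}) :
    (D.kripke c hc F τ).Forces (asEmpty L) (Sum.elim Empty.elim Fin.elim0) p := by
  rw [asEmpty, Kripke.forces_ex]
  intro q _
  obtain ⟨k, hk, hk'⟩ := hD.cls_empty
  obtain ⟨s, z, hs, hz, hm⟩ := q.2.exists_new hF hτ hD hk
  refine ⟨s, hs, z, ?_⟩
  rw [Kripke.forces_all]
  intro y
  rw [Kripke.forces_not]
  intro s' hs'
  have hz' := hs' z.1 hz
  rw [forces_asMem]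
  · intro h
    exact hk' y y.2 ((hm y y.2).1 ((hz'.2 y).1 h))
  · exact hz'.1

/-- After a class `k` has been assigned to `x`, a new object gets the class `k ∪ {y}`. -/
theorem forces_asAdj (hF : ∀ (N : Type w) [L.Structure N] [Nonempty N], N ⊨ F ↔ N ⊨ T)
    (hτ : Tr.Shrinks.{u, v, w} τ T) (hD : D.HasSets T) (p : {w // D.IsWorld c hc F τ w}) :
    (D.kripke c hc F τ).Forces (asAdj L) (Sum.elim Empty.elim Fin.elim0) p := by
  rw [asAdj, Kripke.forces_all]
  intro x
  rw [Kripke.forces_all]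
  intro y
  rw [Kripke.forces_ex]
  intro q _
  obtain ⟨q₁, hq₁, k, hk⟩ := q.2.exists_supp hF hτ hD x.2
  obtain ⟨k', hk', hm'⟩ := hD.cls_adjoin k y hk.2.1 y.2
  obtain ⟨s, z, hs, hz, hm⟩ := q₁.2.exists_new hF hτ hD hk'
  have hsx := hs x.1 ⟨k, hk⟩
  refine ⟨s, (D.kripke c hc F τ).trans hs hq₁, z, ?_⟩
  rw [Kripke.forces_all]
  intro a
  -- below `s`, the elements of `x` and `z` are decided
  have hx : ∀ s' : {w // D.IsWorld c hc F τ w}, D.Le s' s →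
      (D.MemAt s' a x ↔ D.mem a k) := by
    intro s' hs'
    rw [(hs' _ hsx.1).2, hsx.2]
    exact ⟨fun ⟨_, k₁, hk₁, h⟩ => (q₁.2.unique _ _ _ hk₁ hk _ a.2).1 h, fun h => ⟨a.2, k, hk, h⟩⟩
  rw [Kripke.forces_iff]
  intro s' hs'
  have hz' := hs' _ hz
  rw [Kripke.forces_sup, forces_asMem]
  swap
  · exact hz'.1
  refine (((hz'.2 a).trans (hm a a.2)).trans (hm' a a.2)).trans ?_
  constructor
  · intro h s₁ hs₁
    refine ⟨s₁, (D.kripke c hc F τ).refl s₁, h.imp (fun h => ?_) fun h => Subtype.ext h⟩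
    have hs₁' := (D.kripke c hc F τ).trans hs₁ hs'
    rw [forces_asMem]
    · exact (hx s₁ hs₁').2 h
    · exact (hs₁' _ hsx.1).1
  · intro h
    obtain ⟨s₁, hs₁, h⟩ := h s' ((D.kripke c hc F τ).refl s')
    have hs₁' := (D.kripke c hc F τ).trans hs₁ hs'
    refine h.imp (fun h => ?_) fun h => congrArg Subtype.val h
    rw [forces_asMem] at h
    · exact (hx s₁ hs₁').1 h
    · exact (hs₁' _ hsx.1).1

theorem forces_AS (hF : ∀ (N : Type w) [L.Structure N] [Nonempty N], N ⊨ F ↔ N ⊨ T)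
    (hτ : Tr.Shrinks.{u, v, w} τ T) (hD : D.HasSets T) (p : {w // D.IsWorld c hc F τ w})
    {φ : (L.sum memLang).Sentence}
    (hφ : φ ∈ AS T) :
    (D.kripke c hc F τ).Forces φ (Sum.elim Empty.elim Fin.elim0) p := by
  rcases hφ with ⟨ψ, hψ, rfl⟩ | rfl | rfl
  · obtain ⟨N, _, f, hN, hf⟩ := hD.model
    refine (forces_onFormula ψ).2 ?_
    have h := (hf.sentence_iff ψ).2 (hN.2.realize_of_mem ψ hψ)
    refine (iff_of_eq (congrArg _ ?_)).1 h
    funext a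
    rcases a with a | i
    · exact a.elim
    · exact i.elim0
  · exact forces_asEmpty hF hτ hD p
  · exact forces_asAdj hF hτ hD p

end HData

end Generic

/-! ### Definability of the forcing -/

section DefinableForcing

variable {L : FirstOrder.Language.{u, v}} {r : ℕ}

theorem upair {V : Type} (a z k : V) :
    UD (hLang L (r + 2)) fun (N : Type w) _ (v : V → N) =>
      (hData L (r + 2) N).Pair (v a) (v z) (v k) := by
  refine UD.and (uhData.obj z) (UD.and (uhData.cls k) (UD.exs
    (P := fun (N : Type w) _ (v : V → N) t => (∀ j, (hData L (r + 2) N).elt (t j)) ∧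
      t 0 = v z ∧ t 1 = v k ∧ (hData L (r + 2) N).tup (v a) t) ?_))
  exact UD.and (UD.forall_index fun j => uhData.elt _) (UD.and (UD.eq _ (Sum.inl z))
    (UD.and (UD.eq _ (Sum.inl k)) (uhData.tup (Sum.inl a) Sum.inr)))

theorem usupp {V : Type} (a z : V) :
    UD (hLang L (r + 2)) fun (N : Type w) _ (v : V → N) =>
      (hData L (r + 2) N).Supp (v a) (v z) := by
  refine UD.ex (P := fun (N : Type w) _ (v : V → N) k =>
    (hData L (r + 2) N).Pair (v a) (v z) k) ?_
  exact upair (Sum.inl a) (Sum.inl z) _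

theorem umemAt {V : Type} (a y z : V) :
    UD (hLang L (r + 2)) fun (N : Type w) _ (v : V → N) =>
      (hData L (r + 2) N).MemAt (v a) (v y) (v z) := by
  refine UD.and (uhData.obj y) (UD.ex (P := fun (N : Type w) _ (v : V → N) k =>
    (hData L (r + 2) N).Pair (v a) (v z) k ∧ (hData L (r + 2) N).mem (v y) k) ?_)
  exact UD.and (upair (Sum.inl a) (Sum.inl z) _) (uhData.mem (Sum.inl y) _)

theorem ule {V : Type} (a b : V) :
    UD (hLang L (r + 2)) fun (N : Type w) _ (v : V → N) =>
      (hData L (r + 2) N).Le (v a) (v b) := by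
  refine UD.all (P := fun (N : Type w) _ (v : V → N) z => (hData L (r + 2) N).Supp (v b) z →
    (hData L (r + 2) N).Supp (v a) z ∧ ∀ y, (hData L (r + 2) N).MemAt (v a) y z ↔
      (hData L (r + 2) N).MemAt (v b) y z) ?_
  refine UD.imp (usupp (Sum.inl b) _) (UD.and (usupp (Sum.inl a) _) (UD.all
    (P := fun (N : Type w) _ (v : V ⊕ Unit → N) y =>
      (hData L (r + 2) N).MemAt (v (.inl a)) y (v (.inr ())) ↔
        (hData L (r + 2) N).MemAt (v (.inl b)) y (v (.inr ()))) ?_))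
  exact UD.iff (umemAt (Sum.inl (Sum.inl a)) _ (Sum.inl (Sum.inr ())))
    (umemAt (Sum.inl (Sum.inl b)) _ (Sum.inl (Sum.inr ())))

theorem ustar {V : Type} {n : ℕ} (R : (L.sum memLang).Relations n) (a : V) (g : Fin n → V) :
    UD (hLang L (r + 2)) fun (N : Type w) _ (v : V → N) =>
      (hData L (r + 2) N).Star R (v a) fun i => v (g i) := by
  rcases R with R | R
  · exact uhData.base R g
  · cases R
    exact umemAt _ _ _

variable {κ : ℕ} (c : (Σ n : ℕ, L.Relations n) ≃ Fin κ)
  (hc : ∀ R : Σ n : ℕ, L.Relations n, R.1 ≤ r + 2) [L.IsRelational]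
  [Finite (Σ n : ℕ, L.Relations n)] {F : L.Theory} {ι : Type} [Finite ι] (τ : Tr L L ι)

theorem uisWorld (hF : F.Finite) {V : Type} (a : V) :
    UD (hLang L (r + 2)) fun (N : Type w) _ (v : V → N) =>
      (hData L (r + 2) N).IsWorld c hc F τ (v a) := by
  have hX : ∀ {W : Type} (g : V → W) (b : W), UD (hLang L (r + 2)) fun (N : Type w) _
      (v : W → N) => (hData L (r + 2) N).Supp (v (g a)) (v b) := fun g b => usupp (g a) b
  have hu : UD (hLang L (r + 2)) fun (N : Type w) _ (v : V → N) => ∀ x : Fin 3 → N,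
      (hData L (r + 2) N).Pair (v a) (x 0) (x 1) → (hData L (r + 2) N).Pair (v a) (x 0) (x 2) →
        ∀ y, (hData L (r + 2) N).obj y →
          ((hData L (r + 2) N).mem y (x 1) ↔ (hData L (r + 2) N).mem y (x 2)) := by
    refine UD.alls (P := fun (N : Type w) _ (v : V → N) (x : Fin 3 → N) =>
      (hData L (r + 2) N).Pair (v a) (x 0) (x 1) → (hData L (r + 2) N).Pair (v a) (x 0) (x 2) →
        ∀ y, (hData L (r + 2) N).obj y →
          ((hData L (r + 2) N).mem y (x 1) ↔ (hData L (r + 2) N).mem y (x 2))) ?_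
    refine UD.imp (upair (Sum.inl a) _ _) (UD.imp (upair (Sum.inl a) _ _) (UD.all
      (P := fun (N : Type w) _ (v : V ⊕ Fin 3 → N) y => (hData L (r + 2) N).obj y →
        ((hData L (r + 2) N).mem y (v (.inr 1)) ↔ (hData L (r + 2) N).mem y (v (.inr 2)))) ?_))
    exact UD.imp (uhData.obj _) (UD.iff (uhData.mem _ (Sum.inl (Sum.inr 1)))
      (uhData.mem _ (Sum.inl (Sum.inr 2))))
  have hn := unice (hc := hc) c τ (X := fun (N : Type w) _ (v : V → N) =>
    (hData L (r + 2) N).Supp (v a)) hX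
  have hs := usmall c hF (X := fun (N : Type w) _ (v : V → N) =>
    (hData L (r + 2) N).Supp (v a)) hX
  refine (UD.and (uhData.code a) (UD.and hn (UD.and hs hu))).congr fun N _ v => ?_
  refine ⟨fun ⟨h1, h2, h3, h4⟩ => ⟨h1, h2, h3, fun z k k' => h4 ![z, k, k']⟩, fun h =>
    ⟨h.1, h.2, h.3, fun x => h.4 _ _ _⟩⟩

/-- Structures with objects, classes and coded sets of tuples interpret a Kripke model that forces
adjunctive sets. -/
theorem interp_KM_AS {T : L.Theory} (hc : ∀ R : Σ n : ℕ, L.Relations n, R.1 ≤ r + 2)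
    (hfin : F.Finite)
    (hF : ∀ (N : Type w) [L.Structure N] [Nonempty N], N ⊨ F ↔ N ⊨ T)
    (hτ : Tr.Shrinks.{u, v, w} τ T) :
    Interp (fun (N : Type w) [(hLang L (r + 2)).Structure N] => (hData L (r + 2) N).HasSets T)
      (IsModel (KM (AS T))) := by
  obtain ⟨κ, ⟨c⟩⟩ := Finite.exists_equiv_fin (Σ n : ℕ, L.Relations n)
  refine Interp.of_upre (ι := Empty) (P := fun _ _ _ => True)
    (kripkePre_upre (Wd := fun N _ => (hData L (r + 2) N).IsWorld c hc F τ)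
      (Ob := fun N _ => (hData L (r + 2) N).obj) (Le := fun N _ => (hData L (r + 2) N).Le)
      (Star := fun N _ _ R => (hData L (r + 2) N).Star R)
      (fun a => uisWorld c hc τ hfin a) (fun a => uhData.obj a) ule ustar)
    UD.tt fun H _ hD => ⟨⟨Empty.elim, trivial⟩, fun _ _ => ?_⟩
  have hW : Nonempty {w // (hData L (r + 2) H).IsWorld c hc F τ w} :=
    nonempty_subtype.2 hD.exists_isWorld
  have hX : Nonempty {x // (hData L (r + 2) H).obj x} := by
    obtain ⟨N, _, f, hN, hf⟩ := hD.model
    obtain ⟨x, hx, -⟩ := hf.surj hN.1.some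
    exact ⟨⟨x, hx⟩⟩
  obtain ⟨f, hf⟩ := kripkePre_presents (Le := (hData L (r + 2) H).Le)
    (Star := (hData L (r + 2) H).Star) (fun x hx hw => hD.not_code x (Or.inl hx) hw.code)
    ((hData L (r + 2) H).kripke c hc F τ) (fun p q => Iff.rfl) (fun R p x => Iff.rfl)
  exact ⟨_, ((hData L (r + 2) H).kripke c hc F τ).pre.str, f, ⟨inferInstance,
    Kripke.models_KM _ fun φ hφ p => HData.forces_AS hF hτ hD p hφ⟩, hf⟩

end DefinableForcing

end ForcingInterp

theorem mainTheorem5 {L : FirstOrder.Language.{u, v}} [L.IsRelational]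
    [Finite (Σ n : ℕ, L.Relations n)] (T : L.Theory)
    (hfin : ForcingInterp.FinitelyAxiomatizable T)
    (hAC : ForcingInterp.InterpretsDim 1 T (ForcingInterp.AC T)) :
    ForcingInterp.ForcingInterprets T (ForcingInterp.AS T) := by
  obtain ⟨F, hFfin, hTF, hFT⟩ := hfin
  have hF : ∀ (N : Type max u v) [L.Structure N] [Nonempty N], N ⊨ F ↔ N ⊨ T := fun N _ _ =>
    ⟨fun h => ⟨fun φ hφ => Language.Theory.ModelsBoundedFormula.realize_sentence (hFT φ hφ) N⟩,
      fun h => ⟨fun φ hφ => Language.Theory.ModelsBoundedFormula.realize_sentence (hTF φ hφ) N⟩⟩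
  obtain ⟨r, hr⟩ : ∃ r, ∀ R : Σ n : ℕ, L.Relations n, R.1 ≤ r :=
    (Set.finite_range fun R : Σ n : ℕ, L.Relations n => R.1).bddAbove.imp fun r hr R =>
      hr ⟨R, rfl⟩
  have hadj := ForcingInterp.interp_adj_of_interp_AC (ForcingInterp.interp_of_interpretsDim hAC)
  obtain ⟨ι, _, τ, hτ⟩ := ForcingInterp.exists_shrinks hadj
  exact ⟨1, one_pos, ForcingInterp.interpretsDim_of_interp
    ((ForcingInterp.interp_sets hadj hadj (r + 2)).trans
    (ForcingInterp.interp_KM_AS τ (fun R => (hr R).trans (Nat.le_add_right r 2)) hFfin hF hτ))⟩
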